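/- All graphs are finite and simple. For a graph $G$ let $\theta(G)=|E(G)|-|V(G)|+\omega(G)$ be its cyclomatic number ($\omega(G)$ is the number of connected components) and $p(G)$ its number of pendent vertices (vertices of degree $1$). A major vertex is a vertex of degree at least $3$, and a cycle-vertex is a vertex lying on a cycle of $G$; $\mathcal{X}(G)$ denotes the set of major vertices and $\mathcal{M}(G)$ the set of major vertices that are not cycle-vertices. $\mathcal{S}(G)$ is the set of Hermitian matrices $B=(b_{ij})$ indexed by $V(G)$ such that, for $i\ne j$, $b_{ij}\neq 0$ if and only if $i$ and $j$ are adjacent (the diagonal is unrestricted). For an induced subgraph $H$ of $G$, $B(H)$ is the principal submatrix of $B$ indexed by $V(H)$, $\sigma(B(H))$ its set of eigenvalues, and $m_B(H,\lambda)$ the multiplicity of $\lambda$ as an eigenvalue of $B(H)$. $\mathcal{U}$ is the set of connected graphs with cyclomatic number $1$ and at most one pendent vertex. An $\infty$-graph consists either of two vertex-disjoint cycles together with a path of length at least $1$ joining a vertex of the one to a vertex of the other (and otherwise disjoint from them), or of two cycles with exactly one common vertex. A $\theta$-graph is the union of three internally disjoint paths with the same two distinct end vertices, at most one of which has length $1$.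 **Theorem.** Let $G$ be a connected graph with $\theta(G)\ge 1$ and $G\notin\mathcal{U}$, let $B\in\mathcal{S}(G)$, and let $\lambda$ be an eigenvalue of $B$. Then $m_B(G,\lambda)=2\theta(G)+p(G)-1$ if and only if one of the following holds. (a) $G$ is an $\infty$-graph or a $\theta$-graph, and for every cycle-vertex $y$ of degree $2$ that is adjacent to a major vertex of $G$, $m_B(G-y,\lambda)=m_B(G,\lambda)-1=2$; moreover, if $G$ is a $\theta$-graph, then $m_B(G-x,\lambda)=2$ for every $x\in\mathcal{X}(G)$. (b) Each cycle of $G$ contains exactly one major vertex, and this vertex has degree $3$; no two vertices of $\mathcal{M}(G)$ are adjacent; and $G-\mathcal{M}(G)$ is the disjoint union of $\theta(G)$ graphs $C^*_1,\dots,C^*_{\theta(G)}\in\mathcal{U}$ and $l\ge 0$ paths $P^1,\dots,P^l$ (each with at least one vertex), where $m_B(C^*_j,\lambda)=2$ for all $1\le j\le\theta(G)$ and $\lambda\in\sigma(B(P^i))$ for all $1\le i\le l$. -/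

import Mathlib

namespace GraphMult

variable {V : Type*}

/-- The degree of `v` in `G` (number of neighbours; the graphs below are finite). -/
noncomputable def deg (G : SimpleGraph V) (v : V) : ℕ := (G.neighborSet v).ncard

/-- A major vertex: a vertex of degree at least `3`. -/
def IsMajor (G : SimpleGraph V) (v : V) : Prop := 3 ≤ deg G v

/-- A cycle-vertex: a vertex lying on some cycle of `G`. -/
def IsCycleVertex (G : SimpleGraph V) (v : V) : Prop := ∃ c : G.Walk v v, c.IsCycle

/-- The set of major vertices that lie on no cycle of `G`. -/
def nonCycleMajor (G : SimpleGraph V) : Set V := {v | IsMajor G v ∧ ¬ IsCycleVertex G v}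

/-- The number `p(G)` of pendent vertices, i.e. of vertices of degree `1`. -/
noncomputable def pendentCount (G : SimpleGraph V) : ℕ := {v | deg G v = 1}.ncard

/-- The cyclomatic number `θ(G) = |E(G)| - |V(G)| + ω(G)`, where `ω(G)` is the number of
connected components. -/
noncomputable def cyclomatic (G : SimpleGraph V) : ℤ :=
  (Nat.card G.edgeSet : ℤ) - (Nat.card V : ℤ) + (Nat.card G.ConnectedComponent : ℤ)

/-- The class `𝒰`: unicyclic graphs (connected, cyclomatic number `1`) with at most one
pendent vertex. -/
def InU (G : SimpleGraph V) : Prop :=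
  G.Connected ∧ cyclomatic G = 1 ∧ pendentCount G ≤ 1

/-- `G` is a path `P_n` with `n ≥ 1` vertices. -/
def IsPathGraph (G : SimpleGraph V) : Prop :=
  ∃ n : ℕ, Nonempty (G ≃g SimpleGraph.pathGraph (n + 1))

/-- `G` is an `∞`-graph: two cycles `C`, `D` through `a`, `b` respectively, and a path `P` from
`a` to `b` meeting `C` only in `a` and `D` only in `b`. Either `a ≠ b` and the cycles are
disjoint, or `a = b`, the path is trivial and `a` is the only common vertex of the cycles.
Nothing else belongs to `G`. -/
def IsInftyGraph (G : SimpleGraph V) : Prop :=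
  ∃ (a b : V) (C : G.Walk a a) (D : G.Walk b b) (P : G.Walk a b),
    C.IsCycle ∧ D.IsCycle ∧ P.IsPath ∧
    (∀ v, v ∈ C.support → v ∈ D.support → v = a ∧ v = b) ∧
    (∀ v, v ∈ C.support → v ∈ P.support → v = a) ∧
    (∀ v, v ∈ D.support → v ∈ P.support → v = b) ∧
    (∀ v, v ∈ C.support ∨ v ∈ D.support ∨ v ∈ P.support) ∧
    (∀ e ∈ G.edgeSet, e ∈ C.edges ∨ e ∈ D.edges ∨ e ∈ P.edges)

/-- `G` is a `θ`-graph: the union of three internally disjoint paths with common, distinct, end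
vertices `u`, `v`, at most one of which has length `1`. -/
def IsThetaGraph (G : SimpleGraph V) : Prop :=
  ∃ (u v : V) (P Q R : G.Walk u v), u ≠ v ∧
    P.IsPath ∧ Q.IsPath ∧ R.IsPath ∧
    (∀ w, w ∈ P.support → w ∈ Q.support → w = u ∨ w = v) ∧
    (∀ w, w ∈ P.support → w ∈ R.support → w = u ∨ w = v) ∧
    (∀ w, w ∈ Q.support → w ∈ R.support → w = u ∨ w = v) ∧
    ¬ (P.length = 1 ∧ Q.length = 1) ∧
    ¬ (P.length = 1 ∧ R.length = 1) ∧
    ¬ (Q.length = 1 ∧ R.length = 1) ∧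
    (∀ w, w ∈ P.support ∨ w ∈ Q.support ∨ w ∈ R.support) ∧
    (∀ e ∈ G.edgeSet, e ∈ P.edges ∨ e ∈ Q.edges ∨ e ∈ R.edges)

/-- `B ∈ 𝒮(G)`: the matrix `B` is Hermitian, and off the diagonal it is nonzero exactly at the
adjacent pairs of `G`; the diagonal is unrestricted. -/
def InS (G : SimpleGraph V) (B : Matrix V V ℂ) : Prop :=
  B.IsHermitian ∧ ∀ i j, i ≠ j → (B i j ≠ 0 ↔ G.Adj i j)

/-- `x` is an eigenvalue of the square matrix `A`. -/
def IsEigenvalue [Fintype V] (A : Matrix V V ℂ) (x : ℝ) : Prop :=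
  Module.End.HasEigenvalue A.mulVecLin (x : ℂ)

/-- The multiplicity of `x` as an eigenvalue of `A` (`0` if it is none): the dimension of the
eigenspace. For Hermitian `A` geometric and algebraic multiplicities agree. -/
noncomputable def mult [Fintype V] (A : Matrix V V ℂ) (x : ℝ) : ℕ :=
  Module.finrank ℂ (Module.End.eigenspace A.mulVecLin (x : ℂ))

/-- The principal submatrix `B(H)` of `B` for the induced subgraph `H` on the vertex set `S`. -/
def principal (B : Matrix V V ℂ) (S : Set V) : Matrix S S ℂ :=
  B.submatrix Subtype.val Subtype.val

open Classical in
/-- `m_B(G[S], x)`. -/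
noncomputable def multOn [Fintype V] (B : Matrix V V ℂ) (S : Set V) (x : ℝ) : ℕ :=
  mult (principal B S) x

open Classical in
/-- `x ∈ σ(B(G[S]))`. -/
def IsEigenvalueOn [Fintype V] (B : Matrix V V ℂ) (S : Set V) (x : ℝ) : Prop :=
  IsEigenvalue (principal B S) x

/-- The graph `G - 𝓜(G)`. -/
def reduced (G : SimpleGraph V) : SimpleGraph ↥(nonCycleMajor G)ᶜ :=
  G.induce (nonCycleMajor G)ᶜ

/-- The vertex set, in `V`, of a connected component of `G - 𝓜(G)`. -/
def compSet (G : SimpleGraph V) (c : (reduced G).ConnectedComponent) : Set V :=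
  Subtype.val '' c.supp

/-- Form (a). The vertex `y` ranges over the cycle-vertices of degree `2` that are adjacent to a
major vertex. -/
def FormA [Fintype V] (G : SimpleGraph V) (B : Matrix V V ℂ) (x : ℝ) : Prop :=
  (IsInftyGraph G ∨ IsThetaGraph G) ∧
  (∀ y, IsCycleVertex G y → deg G y = 2 → (∃ w, G.Adj y w ∧ IsMajor G w) →
    multOn B {y}ᶜ x = 2 ∧ (mult B x : ℤ) - 1 = 2) ∧
  (IsThetaGraph G → ∀ w, IsMajor G w → multOn B {w}ᶜ x = 2)

/-- Form (b). Every cycle has exactly one major vertex, of degree `3`; the vertices of `𝓜(G)` are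
pairwise non-adjacent; and `G - 𝓜(G)` is the disjoint union of exactly `θ(G)` graphs of `𝒰`, each
with multiplicity `2`, and of paths, each with `x` as an eigenvalue. -/
def FormB [Fintype V] (G : SimpleGraph V) (B : Matrix V V ℂ) (x : ℝ) : Prop :=
  (∀ (u : V) (c : G.Walk u u), c.IsCycle →
    ∃ w ∈ c.support, deg G w = 3 ∧ ∀ z ∈ c.support, IsMajor G z → z = w) ∧
  (∀ u ∈ nonCycleMajor G, ∀ v ∈ nonCycleMajor G, ¬ G.Adj u v) ∧
  (∀ c : (reduced G).ConnectedComponent,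
    (InU (G.induce (compSet G c)) ∧ multOn B (compSet G c) x = 2) ∨
    (IsPathGraph (G.induce (compSet G c)) ∧ IsEigenvalueOn B (compSet G c) x)) ∧
  (Nat.card {c : (reduced G).ConnectedComponent // InU (G.induce (compSet G c))} : ℤ)
    = cyclomatic G

end GraphMult

/-! Upper bound. Delete non-bridge edges of $G$ one at a time until a spanning tree $T$ is left,
taking $uv$ only while $u$ has degree at least $3$: then only $v$ can become a new leaf, so $T$ has
at most $p(G)+\theta(G)$ leaves (`exists_isCut`). On the matrix side such a deletion subtracts a
rank one matrix and lowers the multiplicity by at most one (`mult_le_cutMatrix`). For a matrix with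
the pattern of a tree, non-zero values of an eigenvector propagate away from a root until they reach
a leaf; an eigenvector vanishing at all leaves but one is therefore zero, and the multiplicity is
less than the number of leaves (`mult_lt_pendentCount`). Together, $m\le 2\theta+p-1$.

Equality makes every step tight. The values at all leaves of $T$ but one can be prescribed, so any
two leaves carry an eigenvector vanishing at all other leaves. It follows that all eigenvectors
vanish at the major vertices of $T$, yet on no edge do they all vanish at both ends. Moreover each
eigenvector $y$ of the tree matrix is an eigenvector of $B$ with $t y_a+b_{ab}y_b=0$ for every
deleted edge $(a,b)$, where $t\ne 0$ is a free parameter. Since $y_b$ can be non-zero at the leaf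
$b$, no major vertex separates $a$ from $b$. If $T$ has at least three leaves, a component of $T$
minus its major vertices is a path with at most one leaf of $T$, hence regains at most one deleted
edge. This is form (b); the parameters $t=\pm1$ give two independent eigenvectors on each unicyclic
component. If $T$ has two leaves it is a path, $G\notin\mathcal U$ leaves only $\theta=2$, $p=0$,
and a path with one extra edge at each end is an $\infty$- or a $\theta$-graph.

Converse. Form (a) says that the multiplicity is $3$; as $\theta\le 2$ and $p=0$, the upper bound
forces $\theta=2$ and equality. In form (b), extend eigenvectors of the components by zero and
impose the $|\mathcal M(G)|$ remaining equations (`sum_multOn_le`); a degree count turns the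
resulting lower bound into $2\theta+p-1$. -/

namespace GraphMult

open SimpleGraph

variable {V : Type*}

/-! ### Degrees -/

lemma deg_eq_one_iff {G : SimpleGraph V} {v : V} :
    deg G v = 1 ↔ ∃ w, ∀ z, G.Adj v z ↔ z = w := by
  unfold deg
  rw [Set.ncard_eq_one]
  constructor
  · rintro ⟨w, hw⟩
    exact ⟨w, fun z => by rw [← mem_neighborSet, hw, Set.mem_singleton_iff]⟩
  · rintro ⟨w, hw⟩
    exact ⟨w, by ext z; simp [hw]⟩

lemma eq_of_deg_eq_one {G : SimpleGraph V} {v a b : V} (h : deg G v = 1) (ha : G.Adj v a)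
    (hb : G.Adj v b) : a = b := by
  obtain ⟨w, hw⟩ := deg_eq_one_iff.1 h
  rw [(hw a).1 ha, (hw b).1 hb]

lemma one_le_deg [Finite V] {G : SimpleGraph V} {v a : V} (ha : G.Adj v a) : 1 ≤ deg G v := by
  unfold deg
  rw [Nat.one_le_iff_ne_zero, ← pos_iff_ne_zero, Set.ncard_pos]
  exact ⟨a, ha⟩

lemma two_le_deg [Finite V] {G : SimpleGraph V} {v a b : V} (ha : G.Adj v a)
    (hb : G.Adj v b) (hab : a ≠ b) : 2 ≤ deg G v := by
  unfold deg
  exact (Set.one_lt_ncard (Set.toFinite _)).2 ⟨a, ha, b, hb, hab⟩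

lemma three_le_deg [Finite V] {G : SimpleGraph V} {v a b c : V} (ha : G.Adj v a)
    (hb : G.Adj v b) (hc : G.Adj v c) (hab : a ≠ b) (hac : a ≠ c) (hbc : b ≠ c) :
    3 ≤ deg G v := by
  unfold deg
  exact (Set.two_lt_ncard (Set.toFinite _)).2 ⟨a, ha, b, hb, c, hc, hab, hac, hbc⟩

lemma exists_adj_of_one_le_deg {G : SimpleGraph V} {v : V} (h : 1 ≤ deg G v) :
    ∃ a, G.Adj v a := by
  have : (G.neighborSet v).Nonempty := by
    apply Set.nonempty_of_ncard_ne_zero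
    unfold deg at h
    omega
  exact this

lemma exists_adj_ne_of_two_le_deg {G : SimpleGraph V} {v : V} (h : 2 ≤ deg G v) (p : V) :
    ∃ a, G.Adj v a ∧ a ≠ p := by
  obtain ⟨a, ha, hap⟩ := Set.exists_ne_of_one_lt_ncard (s := G.neighborSet v) (by exact h) p
  exact ⟨a, ha, hap⟩

lemma exists_two_adj_ne_of_three_le_deg [Finite V] {G : SimpleGraph V} {v : V}
    (h : 3 ≤ deg G v) (p : V) :
    ∃ a b, G.Adj v a ∧ G.Adj v b ∧ a ≠ p ∧ b ≠ p ∧ a ≠ b := by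
  have h2 : 1 < (G.neighborSet v \ {p}).ncard := by
    have := Set.ncard_le_ncard_sdiff_add_ncard (G.neighborSet v) {p} (Set.toFinite _)
    rw [Set.ncard_singleton] at this
    unfold deg at h
    omega
  obtain ⟨a, ha, b, hb, hab⟩ := (Set.one_lt_ncard (Set.toFinite _)).1 h2
  exact ⟨a, b, ha.1, hb.1, ha.2, hb.2, hab⟩

lemma deg_mono [Finite V] {G H : SimpleGraph V} (h : H ≤ G) (v : V) : deg H v ≤ deg G v :=
  Set.ncard_le_ncard (fun _ hz => h hz) (Set.toFinite _)

/-! ### Descendants in a rooted tree -/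

/-- `y` is a descendant of `z` with respect to the root `r`: `z` lies between `r` and `y`. -/
def Below (T : SimpleGraph V) (r z y : V) : Prop := T.dist r y = T.dist r z + T.dist z y

/-- `c` is a child of `z` with respect to the root `r`. -/
def IsChild (T : SimpleGraph V) (r z c : V) : Prop :=
  T.Adj z c ∧ T.dist r c = T.dist r z + 1

lemma below_refl (T : SimpleGraph V) (r z : V) : Below T r z z := by simp [Below]

lemma below_root (T : SimpleGraph V) (r z : V) : Below T r r z := by simp [Below]

lemma exists_pred {T : SimpleGraph V} (hT : T.Connected) {c y : V} (h : c ≠ y) :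
    ∃ y', T.Adj y' y ∧ T.dist c y = T.dist c y' + 1 := by
  obtain ⟨w, hw⟩ := hT.exists_walk_length_eq_dist y c
  cases w with
  | nil => exact absurd rfl h
  | @cons _ y' _ h' w' =>
    refine ⟨y', h'.symm, ?_⟩
    have h1 := dist_le w'
    have h2 := hT.dist_triangle (u := y) (v := y') (w := c)
    rw [dist_eq_one_iff_adj.2 h'] at h2
    rw [Walk.length_cons] at hw
    rw [dist_comm (u := c), dist_comm (u := c)]
    omega

section Tree

variable {T : SimpleGraph V}

lemma Below.trans_child (hT : T.Connected) {r z y c : V} (h : Below T r z y)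
    (hc : IsChild T r y c) : Below T r z c := by
  unfold Below at *
  have h1 := hT.dist_triangle (u := z) (v := y) (w := c)
  have h2 := hT.dist_triangle (u := r) (v := z) (w := c)
  rw [dist_eq_one_iff_adj.2 hc.1] at h1
  have := hc.2
  omega

lemma Below.trans (hT : T.Connected) {r z y c : V} (h : Below T r z y)
    (hc : Below T r y c) : Below T r z c := by
  unfold Below at *
  have h1 := hT.dist_triangle (u := z) (v := y) (w := c)
  have h2 := hT.dist_triangle (u := r) (v := z) (w := c)
  omega

lemma IsChild.below {r z c : V} (h : IsChild T r z c) : Below T r z c := by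
  unfold Below
  rw [dist_eq_one_iff_adj.2 h.1, h.2]

lemma adj_cases (hT : T.IsTree) (r : V) {z c : V} (h : T.Adj z c) :
    IsChild T r z c ∨ IsChild T r c z := by
  rcases hT.dist_eq_dist_add_one_of_adj r h with h1 | h1
  · exact Or.inr ⟨h.symm, h1⟩
  · exact Or.inl ⟨h, h1⟩

/-- A geodesic to a parent, prolonged by the edge to $z$, is a geodesic to $z$; in a tree there is
only one path from $r$ to $z$, so its penultimate vertex is determined. -/
lemma parent_unique (hT : T.IsTree) {r z p q : V} (hp : IsChild T r p z) (hq : IsChild T r q z) :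
    p = q := by
  have key : ∀ p, IsChild T r p z → ∃ w : T.Walk r z, w.IsPath ∧ w.penultimate = p := by
    intro p hp
    obtain ⟨w, hw⟩ := hT.connected.exists_walk_length_eq_dist r p
    refine ⟨w.concat hp.1, ?_, by simp⟩
    apply Walk.isPath_of_length_eq_dist
    rw [Walk.length_concat, hw, hp.2]
  obtain ⟨w1, h1, e1⟩ := key p hp
  obtain ⟨w2, h2, e2⟩ := key q hq
  have := (hT.existsUnique_path r z).unique h1 h2
  rw [← e1, ← e2, this]

lemma isChild_of_ne (hT : T.IsTree) {r z p c : V} (hp : IsChild T r p z) (hc : T.Adj z c)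
    (hcp : c ≠ p) : IsChild T r z c := by
  rcases adj_cases hT r hc with h | h
  · exact h
  · exact absurd (parent_unique hT h hp) hcp

lemma isChild_root {r c : V} (hc : T.Adj r c) : IsChild T r r c :=
  ⟨hc, by rw [dist_self, dist_eq_one_iff_adj.2 hc]⟩

lemma exists_parent (hT : T.IsTree) {r z : V} (h : r ≠ z) : ∃ p, IsChild T r p z :=
  exists_pred hT.connected h

/-- The parent of a proper descendant of `z` is a descendant of `z`. -/
lemma Below.parent (hT : T.IsTree) {r z y p : V} (h : Below T r z y) (hzy : z ≠ y)
    (hp : IsChild T r p y) : Below T r z p := by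
  obtain ⟨y', h1, h2⟩ := exists_pred hT.connected hzy
  have h3 : IsChild T r y' y := by
    refine ⟨h1, ?_⟩
    have h4 := hT.connected.dist_triangle (u := r) (v := z) (w := y')
    have h5 := hT.connected.dist_triangle (u := r) (v := y') (w := y)
    rw [dist_eq_one_iff_adj.2 h1] at h5
    unfold Below at h
    omega
  obtain rfl := parent_unique hT h3 hp
  unfold Below at *
  have := h3.2
  omega

lemma below_antisymm (hT : T.IsTree) {r z y : V} (h : Below T r z y)
    (hd : T.dist r y ≤ T.dist r z) : z = y := by
  unfold Below at h
  exact hT.connected.dist_eq_zero_iff.1 (by omega)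

/-- Climbing from $y$ through successive parents meets only one vertex at each depth. Applied to
siblings, this separates the branches at a vertex. -/
lemma children_disjoint (hT : T.IsTree) {r c d y : V}
    (hcd : T.dist r c = T.dist r d) (h1 : Below T r c y) (h2 : Below T r d y) : c = d := by
  induction hn : T.dist r y using Nat.strong_induction_on generalizing y with
  | _ n ih =>
    by_cases e1 : c = y
    · subst e1
      exact (below_antisymm hT h2 (by omega)).symm
    by_cases e2 : d = y
    · subst e2
      exact below_antisymm hT h1 (by omega)
    have hr : r ≠ y := by
      rintro rfl
      unfold Below at h1
      rw [dist_self] at h1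
      exact e1 (hT.connected.dist_eq_zero_iff.1 (by omega))
    obtain ⟨p, hp⟩ := exists_parent hT hr
    exact ih (T.dist r p) (by have := hp.2; omega) (h1.parent hT e1 hp) (h2.parent hT e2 hp) rfl

/-- A descendant of `z` other than `z` is a descendant of a child of `z`. -/
lemma Below.exists_child (hT : T.IsTree) {r z y : V} (h : Below T r z y) (hzy : z ≠ y) :
    ∃ c, IsChild T r z c ∧ Below T r c y := by
  obtain ⟨c, h1, h2⟩ := exists_pred hT.connected (c := y) (y := z) (Ne.symm hzy)
  unfold Below at h
  have h3 := hT.connected.dist_triangle (u := r) (v := c) (w := y)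
  have h4 := hT.connected.dist_triangle (u := r) (v := z) (w := c)
  rw [dist_eq_one_iff_adj.2 h1.symm] at h4
  rw [dist_comm (u := y), dist_comm (u := y)] at h2
  exact ⟨c, ⟨h1.symm, by omega⟩, by unfold Below; omega⟩

lemma deg_eq_one_of_no_child [Nontrivial V] (hT : T.IsTree) {r z : V}
    (h : ∀ c, ¬ IsChild T r z c) : r ≠ z ∧ deg T z = 1 := by
  have hr : r ≠ z := by
    rintro rfl
    obtain ⟨c, hc⟩ := hT.connected.preconnected.exists_adj_of_nontrivial r
    exact h c (isChild_root hc)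
  refine ⟨hr, ?_⟩
  obtain ⟨p, hp⟩ := exists_parent hT hr
  rw [deg_eq_one_iff]
  refine ⟨p, fun c => ⟨fun hc => ?_, fun hc => hc ▸ hp.1.symm⟩⟩
  by_contra hne
  exact h c (isChild_of_ne hT hp hc hne)

lemma no_child_of_deg_eq_one (hT : T.IsTree) {r z : V} (hr : r ≠ z) (h : deg T z = 1) (c : V) :
    ¬ IsChild T r z c := by
  intro hc
  obtain ⟨p, hp⟩ := exists_parent hT hr
  obtain rfl := eq_of_deg_eq_one h hc.1 hp.1.symm
  have := hc.2
  have := hp.2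
  omega

/-- In a finite nonempty set of vertices, closed enough, pick one farthest from the root. -/
lemma exists_farthest [Finite V] (T : SimpleGraph V) (r : V) {S : Set V} (hS : S.Nonempty) :
    ∃ y ∈ S, ∀ y' ∈ S, T.dist r y' ≤ T.dist r y := by
  obtain ⟨y, hy, hmax⟩ := Set.exists_max_image S (T.dist r) (Set.toFinite _) hS
  exact ⟨y, hy, hmax⟩

lemma exists_leaf_below [Finite V] [Nontrivial V] (hT : T.IsTree) (r z : V) :
    ∃ b, r ≠ b ∧ deg T b = 1 ∧ Below T r z b := by
  obtain ⟨b, hb, hmax⟩ := exists_farthest T r (S := {y | Below T r z y}) ⟨z, below_refl T r z⟩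
  obtain ⟨h1, h2⟩ := deg_eq_one_of_no_child hT (r := r) (z := b) fun c hc => by
    have := hmax c (Below.trans_child hT.connected hb hc)
    have := hc.2
    omega
  exact ⟨b, h1, h2, hb⟩

lemma below_of_leaf (hT : T.IsTree) {r b y : V} (hr : r ≠ b) (hb : deg T b = 1)
    (h : Below T r b y) : y = b := by
  by_contra hne
  obtain ⟨c, hc, -⟩ := h.exists_child hT (Ne.symm hne)
  exact no_child_of_deg_eq_one hT hr hb c hc

/-- If all vertices between the leaves `a` and `b` have degree at most `2`, there are no other
leaves. -/
lemma leaf_eq_of_between [Finite V] (hT : T.IsTree) {a b c : V} (ha : deg T a = 1)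
    (hc : deg T c = 1) (hb : deg T b = 1) (hab : a ≠ b)
    (h : ∀ z, Below T a z b → ¬ IsMajor T z) : c = a ∨ c = b := by
  by_contra hne
  push Not at hne
  -- Walking from $a$ towards $b$, each vertex met also lies between $a$ and $c$: leaving this route
  -- towards $c$ would need a vertex of degree $3$, or a second edge at the leaf $a$.
  have key : ∀ n z, T.dist a z = n → Below T a z b → Below T a z c := by
    intro n
    induction n with
    | zero =>
      intro z hz _
      rw [hT.connected.dist_eq_zero_iff] at hz
      subst hz
      exact below_root T a c
    | succ n ih =>
      intro z hz hzb
      have haz : a ≠ z := by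
        rintro rfl
        simp at hz
      obtain ⟨p, hp⟩ := exists_parent hT haz
      have hpb := hp.below.trans hT.connected hzb
      have hpc := ih p (by have := hp.2; omega) hpb
      have hpne : p ≠ c := by
        rintro rfl
        exact no_child_of_deg_eq_one hT (Ne.symm hne.1) hc z hp
      obtain ⟨d, hd, hdc⟩ := hpc.exists_child hT hpne
      by_cases hdz : d = z
      · exact hdz ▸ hdc
      exfalso
      by_cases hap : a = p
      · subst hap
        exact hdz (eq_of_deg_eq_one ha hd.1 hp.1)
      · obtain ⟨q, hq⟩ := exists_parent hT hap
        refine h p hpb (three_le_deg hd.1 hp.1 hq.1.symm hdz ?_ ?_)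
        · rintro rfl
          have := hd.2; have := hq.2; omega
        · rintro rfl
          have := hp.2; have := hq.2; omega
  have := key _ b rfl (below_refl T a b)
  exact hne.2 (below_of_leaf hT hab hb this)

end Tree

section

/-! ### Eigenvectors of matrices whose graph is a tree -/

/-- The off-diagonal nonzero pattern of `A` is the adjacency of `G`. -/
def HasPattern (G : SimpleGraph V) (A : Matrix V V ℂ) : Prop :=
  ∀ i j, i ≠ j → (A i j ≠ 0 ↔ G.Adj i j)

lemma mem_eigenspace [Fintype V] {A : Matrix V V ℂ} {x : ℝ} {y : V → ℂ} :
    y ∈ Module.End.eigenspace A.mulVecLin (x : ℂ) ↔ ∀ i, ∑ j, A i j * y j = x * y i := by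
  rw [Module.End.mem_eigenspace_iff, funext_iff]
  rfl

variable [Fintype V] {T : SimpleGraph V} {A : Matrix V V ℂ} {x : ℝ} {y : V → ℂ}

/-- Row $c$ of the eigenvalue equation has right-hand side $0$, so it cannot contain exactly one
non-zero term. -/
lemma exists_second_nonzero (hA : HasPattern T A)
    (hy : y ∈ Module.End.eigenspace A.mulVecLin (x : ℂ)) {c z : V}
    (hc : y c = 0) (hz : y z ≠ 0) (hcz : T.Adj c z) : ∃ d, T.Adj c d ∧ d ≠ z ∧ y d ≠ 0 := by
  by_contra! hne
  have h1 := mem_eigenspace.1 hy c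
  rw [hc, mul_zero, Finset.sum_eq_single z] at h1
  · rcases mul_eq_zero.1 h1 with h2 | h2
    · exact (hA c z hcz.ne).2 hcz h2
    · exact hz h2
  · intro d _ hd
    by_cases hcd : c = d
    · rw [← hcd, hc, mul_zero]
    by_cases hadj : T.Adj c d
    · rw [hne d hadj hd, mul_zero]
    · rw [show A c d = 0 from by_contra fun h => hadj ((hA c d hcd).1 h), zero_mul]
  · simp

/-- If an eigenvector does not vanish at `z` then it does not vanish somewhere below any child of
`z`. -/
lemma exists_nonzero_below_child (hT : T.IsTree) (hA : HasPattern T A)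
    (hy : y ∈ Module.End.eigenspace A.mulVecLin (x : ℂ)) {r z c : V}
    (hz : y z ≠ 0) (hc : IsChild T r z c) : ∃ w, Below T r c w ∧ y w ≠ 0 := by
  by_cases h0 : y c = 0
  · obtain ⟨d, hd, hdz, hyd⟩ := exists_second_nonzero hA hy h0 hz hc.1.symm
    exact ⟨d, (isChild_of_ne hT hc hd hdz).below, hyd⟩
  · exact ⟨c, below_refl T r c, h0⟩

/-- An eigenvector that does not vanish at `z` does not vanish at some leaf below `z`. -/
lemma exists_nonzero_leaf_below [Nontrivial V] (hT : T.IsTree) (hA : HasPattern T A)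
    (hy : y ∈ Module.End.eigenspace A.mulVecLin (x : ℂ)) {r z : V}
    (hz : y z ≠ 0) : ∃ b, r ≠ b ∧ deg T b = 1 ∧ Below T r z b ∧ y b ≠ 0 := by
  -- A farthest non-zero descendant has no child, since below any child there would be a non-zero
  -- vertex still farther away.
  obtain ⟨b, ⟨hb, hyb⟩, hmax⟩ := exists_farthest T r (S := {w | Below T r z w ∧ y w ≠ 0})
    ⟨z, below_refl T r z, hz⟩
  obtain ⟨h1, h2⟩ := deg_eq_one_of_no_child hT (r := r) (z := b) fun c hc => by
    obtain ⟨w, hw, hyw⟩ := exists_nonzero_below_child hT hA hy hyb hc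
    have h3 := hmax w ⟨(hb.trans_child hT.connected hc).trans hT.connected hw, hyw⟩
    have h4 := hc.2
    unfold Below at hw
    omega
  exact ⟨b, h1, h2, hb, hyb⟩

lemma exists_nonzero_leaf_below_child [Nontrivial V] (hT : T.IsTree) (hA : HasPattern T A)
    (hy : y ∈ Module.End.eigenspace A.mulVecLin (x : ℂ)) {r z c : V}
    (hz : y z ≠ 0) (hc : IsChild T r z c) :
    ∃ b, r ≠ b ∧ deg T b = 1 ∧ Below T r c b ∧ y b ≠ 0 := by
  obtain ⟨w, hw, hyw⟩ := exists_nonzero_below_child hT hA hy hz hc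
  obtain ⟨b, h1, h2, h3, h4⟩ := exists_nonzero_leaf_below hT hA hy (r := r) hyw
  exact ⟨b, h1, h2, hw.trans hT.connected h3, h4⟩

/-- An eigenvector that vanishes at all leaves except possibly `r` is zero. -/
lemma eq_zero_of_leaves [Nontrivial V] (hT : T.IsTree) (hA : HasPattern T A)
    (hy : y ∈ Module.End.eigenspace A.mulVecLin (x : ℂ)) (r : V)
    (h : ∀ b, r ≠ b → deg T b = 1 → y b = 0) : y = 0 := by
  by_contra hne
  obtain ⟨z, hz⟩ := Function.ne_iff.1 hne
  obtain ⟨b, h1, h2, -, h4⟩ := exists_nonzero_leaf_below hT hA hy (r := r) hz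
  exact h4 (h b h1 h2)

/-- An eigenvector vanishing at all leaves but two vanishes at every major vertex. -/
lemma eq_zero_of_isMajor_of_two_leaves [Nontrivial V] (hT : T.IsTree) (hA : HasPattern T A)
    (hy : y ∈ Module.End.eigenspace A.mulVecLin (x : ℂ)) {r b v : V} (hr : deg T r = 1)
    (h : ∀ c, r ≠ c → deg T c = 1 → c ≠ b → y c = 0) (hv : IsMajor T v) : y v = 0 := by
  by_contra hne
  have hrv : r ≠ v := by
    rintro rfl
    unfold IsMajor at hv
    omega
  obtain ⟨p, hp⟩ := exists_parent hT hrv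
  obtain ⟨c, d, hc, hd, hcp, hdp, hcd⟩ := exists_two_adj_ne_of_three_le_deg hv p
  have hc := isChild_of_ne hT hp hc hcp
  have hd := isChild_of_ne hT hp hd hdp
  -- Each of two branches at $v$ must contain a non-zero leaf, but $b$ is the only candidate and
  -- lies in just one of them.
  obtain ⟨b1, h1, h2, h3, h4⟩ := exists_nonzero_leaf_below_child hT hA hy hne hc
  obtain ⟨b2, k1, k2, k3, k4⟩ := exists_nonzero_leaf_below_child hT hA hy hne hd
  have e1 : b1 = b := by_contra fun e => h4 (h b1 h1 h2 e)
  have e2 : b2 = b := by_contra fun e => k4 (h b2 k1 k2 e)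
  subst e1
  subst e2
  exact hcd (children_disjoint hT (by rw [hc.2, hd.2]) h3 k3)

/-- An eigenvector vanishing at all leaves but two cannot vanish at both ends of an edge on the
path joining these. -/
lemma ne_zero_or_ne_zero_of_two_leaves [Nontrivial V] (hT : T.IsTree) (hA : HasPattern T A)
    (hy : y ∈ Module.End.eigenspace A.mulVecLin (x : ℂ)) {r b p z : V}
    (h : ∀ c, r ≠ c → deg T c = 1 → c ≠ b → y c = 0) (hb : y b ≠ 0) (hpz : IsChild T r p z)
    (hzb : Below T r z b) : y p ≠ 0 ∨ y z ≠ 0 := by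
  by_contra! hne
  -- For the non-zero vertex $w$ below $z$ nearest to the root, the parent $q$ vanishes, so $q$ has
  -- a second non-zero neighbour $d$. By minimality, and by $y_p=0$ when $q=z$, this $d$ is a
  -- sibling of $w$, and the two branches compete for the single leaf $b$.
  obtain ⟨w, ⟨hw, hyw⟩, hmin⟩ := Set.exists_min_image {w | Below T r z w ∧ y w ≠ 0} (T.dist r)
    (Set.toFinite _) ⟨b, hzb, hb⟩
  have hzw : z ≠ w := by
    rintro rfl
    exact hyw hne.2
  have hrw : r ≠ w := by
    rintro rfl
    have := hpz.2
    unfold Below at hw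
    rw [dist_self] at hw
    omega
  obtain ⟨q, hq⟩ := exists_parent hT hrw
  have hzq := hw.parent hT hzw hq
  have hq0 : y q = 0 := by
    by_contra hyq
    have := hmin q ⟨hzq, hyq⟩
    have := hq.2
    omega
  obtain ⟨d, hd, hdw, hyd⟩ := exists_second_nonzero hA hy hq0 hyw hq.1
  have hdc : IsChild T r q d := by
    rcases adj_cases hT r hd with h1 | h1
    · exact h1
    exfalso
    by_cases e : z = q
    · subst e
      rw [parent_unique hT h1 hpz] at hyd
      exact hyd hne.1
    · have := hmin d ⟨hzq.parent hT e h1, hyd⟩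
      have := h1.2
      have := hq.2
      omega
  obtain ⟨b1, h1, h2, h3, h4⟩ := exists_nonzero_leaf_below hT hA hy (r := r) hyw
  obtain ⟨b2, k1, k2, k3, k4⟩ := exists_nonzero_leaf_below hT hA hy (r := r) hyd
  have e1 : b1 = b := by_contra fun e => h4 (h b1 h1 h2 e)
  have e2 : b2 = b := by_contra fun e => k4 (h b2 k1 k2 e)
  subst e1
  subst e2
  exact hdw (children_disjoint hT (by rw [hdc.2, hq.2]) k3 h3)

/-- Restriction of eigenvectors to the leaves other than `r`. -/
noncomputable def leafRestrict (T : SimpleGraph V) (A : Matrix V V ℂ) (x : ℝ) (r : V) :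
    Module.End.eigenspace A.mulVecLin (x : ℂ) →ₗ[ℂ] ({b : V // deg T b = 1 ∧ b ≠ r} → ℂ) :=
  (LinearMap.funLeft ℂ ℂ Subtype.val).comp (Submodule.subtype _)

lemma leafRestrict_injective [Nontrivial V] (hT : T.IsTree) (hA : HasPattern T A) (x : ℝ) (r : V) :
    Function.Injective (leafRestrict T A x r) := by
  rw [← LinearMap.ker_eq_bot, LinearMap.ker_eq_bot']
  intro y hy
  apply Subtype.ext
  apply eq_zero_of_leaves hT hA y.2 r
  intro b hb1 hb2
  exact congrFun hy ⟨b, hb2, hb1.symm⟩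

lemma card_other_leaves {r : V} (hr : deg T r = 1) :
    Nat.card {b : V // deg T b = 1 ∧ b ≠ r} + 1 = pendentCount T := by
  unfold pendentCount
  rw [show Nat.card {b : V // deg T b = 1 ∧ b ≠ r} = ({b | deg T b = 1} \ {r} : Set V).ncard
    from rfl]
  exact Set.ncard_sdiff_singleton_add_one (s := {b | deg T b = 1}) hr (Set.toFinite _)

lemma exists_leaf [Nontrivial V] (hT : T.IsTree) : ∃ r, deg T r = 1 := by
  obtain ⟨z⟩ := hT.connected.nonempty
  obtain ⟨b, -, h, -⟩ := exists_leaf_below hT z z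
  exact ⟨b, h⟩

lemma finrank_pi_leaves (r : V) :
    Module.finrank ℂ ({b : V // deg T b = 1 ∧ b ≠ r} → ℂ) =
      Nat.card {b : V // deg T b = 1 ∧ b ≠ r} := by
  have : Fintype {b : V // deg T b = 1 ∧ b ≠ r} := Fintype.ofFinite _
  rw [Module.finrank_fintype_fun_eq_card, Nat.card_eq_fintype_card]

/-- The multiplicity of an eigenvalue of a tree is less than the number of leaves. -/
theorem mult_lt_pendentCount [Nontrivial V] (hT : T.IsTree) (hA : HasPattern T A) (x : ℝ) :
    mult A x + 1 ≤ pendentCount T := by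
  obtain ⟨r, hr⟩ := exists_leaf hT
  rw [← card_other_leaves hr, ← finrank_pi_leaves]
  exact Nat.succ_le_succ (LinearMap.finrank_le_finrank_of_injective
    (leafRestrict_injective hT hA x r))

/-- In the extremal case, the values at all leaves but one can be prescribed. -/
lemma leafRestrict_surjective [Nontrivial V] (hT : T.IsTree) (hA : HasPattern T A)
    (h : mult A x + 1 = pendentCount T) {r : V} (hr : deg T r = 1) :
    Function.Surjective (leafRestrict T A x r) := by
  refine (LinearMap.injective_iff_surjective_of_finrank_eq_finrank ?_).1
    (leafRestrict_injective hT hA x r)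
  rw [finrank_pi_leaves]
  have := card_other_leaves hr
  unfold mult at h
  omega

/-- The basic tool of the extremal case: all three statements below about the zeros of eigenvectors
are read off from these vectors. -/
lemma exists_eigenvector_of_two_leaves [Nontrivial V] (hT : T.IsTree) (hA : HasPattern T A)
    (h : mult A x + 1 = pendentCount T) {r b : V} (hr : deg T r = 1) (hb : deg T b = 1)
    (hrb : r ≠ b) :
    ∃ y ∈ Module.End.eigenspace A.mulVecLin (x : ℂ), y b = 1 ∧ y r ≠ 0 ∧
      ∀ c, r ≠ c → deg T c = 1 → c ≠ b → y c = 0 := by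
  classical
  obtain ⟨y, hy⟩ := leafRestrict_surjective hT hA h hr (Pi.single ⟨b, hb, hrb.symm⟩ 1)
  have h1 : y.1 b = 1 := by
    have := congrFun hy ⟨b, hb, hrb.symm⟩
    rwa [Pi.single_eq_same] at this
  have h2 : ∀ c, r ≠ c → deg T c = 1 → c ≠ b → y.1 c = 0 := by
    intro c hrc hc hcb
    have := congrFun hy ⟨c, hc, hrc.symm⟩
    rwa [Pi.single_eq_of_ne (by simpa using hcb)] at this
  refine ⟨y.1, y.2, h1, fun h0 => ?_, h2⟩
  -- If $y$ vanished at $r$ too, then $b$ could serve as the exempted leaf.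
  have h3 : y.1 = 0 := eq_zero_of_leaves hT hA y.2 b fun c hbc hc => by
    by_cases e : r = c
    · rw [← e, h0]
    · exact h2 c e hc (Ne.symm hbc)
  rw [h3] at h1
  simp at h1

/-- In the extremal case, all eigenvectors vanish at the major vertices. -/
theorem eq_zero_of_isMajor [Nontrivial V] (hT : T.IsTree) (hA : HasPattern T A)
    (h : mult A x + 1 = pendentCount T) (hy : y ∈ Module.End.eigenspace A.mulVecLin (x : ℂ))
    {v : V} (hv : IsMajor T v) : y v = 0 := by
  classical
  obtain ⟨r, hr⟩ := exists_leaf hT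
  have key : ∀ b : V, ∃ u ∈ Module.End.eigenspace A.mulVecLin (x : ℂ),
      u v = 0 ∧ (deg T b = 1 → b ≠ r → u b = 1) ∧
      ∀ c, r ≠ c → deg T c = 1 → c ≠ b → u c = 0 := by
    intro b
    by_cases hb : deg T b = 1 ∧ b ≠ r
    · obtain ⟨u, hu, h1, -, h2⟩ := exists_eigenvector_of_two_leaves hT hA h hr hb.1 hb.2.symm
      exact ⟨u, hu, eq_zero_of_isMajor_of_two_leaves hT hA hu hr h2 hv, fun _ _ => h1, h2⟩
    · exact ⟨0, Submodule.zero_mem _, rfl, fun h1 h2 => absurd ⟨h1, h2⟩ hb, fun _ _ _ _ => rfl⟩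
  choose u hu h1 h2 h3 using key
  let S := Finset.univ.filter fun b => deg T b = 1 ∧ b ≠ r
  -- The difference vanishes at every leaf except possibly $r$.
  have hsum : y - ∑ b ∈ S, y b • u b = 0 := by
    refine eq_zero_of_leaves hT hA (x := x) ?_ r ?_
    · exact Submodule.sub_mem _ hy (Submodule.sum_mem _ fun b _ => Submodule.smul_mem _ _ (hu b))
    · intro c hrc hc
      rw [Pi.sub_apply, Finset.sum_apply, Finset.sum_eq_single c]
      · simp [h2 c hc hrc.symm]
      · intro b _ hbc
        simp [h3 b c hrc hc hbc.symm]
      · intro hcS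
        exact absurd (by simp [S, hc, hrc.symm]) hcS
  have := congrFun hsum v
  simpa [Finset.sum_apply, h1, sub_eq_zero] using this

/-- In the extremal case, no edge has all eigenvectors vanishing at both ends. -/
theorem exists_ne_zero_of_adj [Nontrivial V] (hT : T.IsTree) (hA : HasPattern T A)
    (h : mult A x + 1 = pendentCount T) {p z : V} (hpz : T.Adj p z) :
    ∃ y ∈ Module.End.eigenspace A.mulVecLin (x : ℂ), y p ≠ 0 ∨ y z ≠ 0 := by
  obtain ⟨r, hr⟩ := exists_leaf hT
  have key : ∀ p z, IsChild T r p z →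
      ∃ y ∈ Module.End.eigenspace A.mulVecLin (x : ℂ), y p ≠ 0 ∨ y z ≠ 0 := by
    intro p z hpz
    obtain ⟨b, hrb, hb, hzb⟩ := exists_leaf_below hT r z
    obtain ⟨y, hy, h1, h2, h3⟩ := exists_eigenvector_of_two_leaves hT hA h hr hb hrb
    exact ⟨y, hy, ne_zero_or_ne_zero_of_two_leaves hT hA hy h3 (by simp [h1]) hpz hzb⟩
  rcases adj_cases hT r hpz with h1 | h1
  · exact key p z h1
  · obtain ⟨y, hy, h2⟩ := key z p h1
    exact ⟨y, hy, h2.symm⟩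

/-- In the extremal case, a major vertex between the leaf `v` and `u` allows an eigenvector that
vanishes at `u` but not at `v`. -/
theorem exists_ne_zero_eq_zero_of_between [Nontrivial V] (hT : T.IsTree) (hA : HasPattern T A)
    (h : mult A x + 1 = pendentCount T) {v u w : V} (hv : deg T v = 1) (hw : IsMajor T w)
    (hwu : Below T v w u) :
    ∃ y ∈ Module.End.eigenspace A.mulVecLin (x : ℂ), y v ≠ 0 ∧ y u = 0 := by
  have hvw : v ≠ w := by
    rintro rfl
    unfold IsMajor at hw
    omega
  obtain ⟨p, hp⟩ := exists_parent hT hvw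
  -- Rooted at $v$, the vertex $w$ has at least two children and at most one of them leads to $u$.
  -- An eigenvector living on $v$ and a leaf below another child has to vanish at $u$.
  have hchild : ∃ c, IsChild T v w c ∧ ¬ Below T v c u := by
    obtain ⟨c, d, hc, hd, hcp, hdp, hcd⟩ := exists_two_adj_ne_of_three_le_deg hw p
    have hc := isChild_of_ne hT hp hc hcp
    have hd := isChild_of_ne hT hp hd hdp
    by_cases hcu : Below T v c u
    · refine ⟨d, hd, fun hdu => hcd ?_⟩
      exact children_disjoint hT (by rw [hc.2, hd.2]) hcu hdu
    · exact ⟨c, hc, hcu⟩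
  obtain ⟨c, hc, hcu⟩ := hchild
  obtain ⟨b, hvb, hb, hcb⟩ := exists_leaf_below hT v c
  obtain ⟨y, hy, h1, h2, h3⟩ := exists_eigenvector_of_two_leaves hT hA h hv hb hvb
  refine ⟨y, hy, h2, ?_⟩
  by_contra hyu
  obtain ⟨b', k1, k2, k3, k4⟩ := exists_nonzero_leaf_below hT hA hy (r := v) hyu
  have e : b' = b := by_contra fun e => k4 (h3 b' k1 k2 e)
  subst e
  by_cases huw : w = u
  · subst huw
    exact hyu (eq_zero_of_isMajor hT hA h hy hw)
  obtain ⟨d, hd, hdu⟩ := hwu.exists_child hT huw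
  have := children_disjoint hT (by rw [hc.2, hd.2]) hcb (hdu.trans hT.connected k3)
  exact hcu (this ▸ hdu)

end

/-! ### Cyclomatic number, bridges and cycle-vertices -/

lemma cyclomatic_of_connected {G : SimpleGraph V} (h : G.Connected) :
    cyclomatic G = (Nat.card G.edgeSet : ℤ) - (Nat.card V : ℤ) + 1 := by
  unfold cyclomatic
  have h1 : Subsingleton G.ConnectedComponent := h.preconnected.subsingleton_connectedComponent
  have h3 := h.nonempty
  have h2 : Nonempty G.ConnectedComponent := inferInstance
  rw [Nat.card_eq_one_iff_unique.2 ⟨h1, h2⟩]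
  rfl

lemma isTree_iff_cyclomatic [Finite V] {G : SimpleGraph V} :
    G.IsTree ↔ G.Connected ∧ cyclomatic G = 0 := by
  rw [isTree_iff_connected_and_card]
  refine and_congr_right fun h => ?_
  rw [cyclomatic_of_connected h]
  omega

lemma cyclomatic_nonneg [Finite V] {G : SimpleGraph V} (h : G.Connected) : 0 ≤ cyclomatic G := by
  have := h.card_vert_le_card_edgeSet_add_one
  rw [cyclomatic_of_connected h]
  omega

lemma cyclomatic_deleteEdge [Finite V] {G : SimpleGraph V} (h : G.Connected) {u v : V}
    (huv : G.Adj u v) (hb : ¬ G.IsBridge s(u, v)) :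
    cyclomatic G = cyclomatic (G.deleteEdges {s(u, v)}) + 1 := by
  rw [cyclomatic_of_connected h,
    cyclomatic_of_connected (h.connected_delete_edge_of_not_isBridge hb)]
  have : Nat.card (G.deleteEdges {s(u, v)}).edgeSet + 1 = Nat.card G.edgeSet := by
    rw [edgeSet_deleteEdges]
    exact Set.ncard_sdiff_singleton_add_one (s := G.edgeSet) huv (Set.toFinite _)
  omega

lemma reachable_of_walk {H K : SimpleGraph V} {a b : V} (p : H.Walk a b)
    (h : ∀ c d, H.Adj c d → c ∈ p.support → d ∈ p.support → K.Reachable c d) :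
    K.Reachable a b := by
  induction p with
  | nil => exact Reachable.refl _
  | @cons a c b hac p ih =>
    refine (h a c hac (by simp) (by simp)).trans (ih fun c d hcd hc hd => ?_)
    exact h c d hcd (by simp [hc]) (by simp [hd])

lemma reachable_of_reachable {H K : SimpleGraph V} {a b : V} (hab : H.Reachable a b)
    (h : ∀ c d, H.Adj c d → K.Reachable c d) : K.Reachable a b := by
  obtain ⟨p⟩ := hab
  exact reachable_of_walk p fun c d hcd _ _ => h c d hcd

lemma deleteEdge_adj {G : SimpleGraph V} {u v a b : V} :
    (G.deleteEdges {s(u, v)}).Adj a b ↔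
      G.Adj a b ∧ ¬ (a = u ∧ b = v) ∧ ¬ (a = v ∧ b = u) := by
  simp [deleteEdges_adj]

lemma isBridge_comm {G : SimpleGraph V} {u v : V} : G.IsBridge s(u, v) ↔ G.IsBridge s(v, u) := by
  rw [Sym2.eq_swap]

/-- Cycles are handled through non-bridges from here on, since these behave well under deletion of
edges. -/
lemma isCycleVertex_iff {G : SimpleGraph V} {v : V} :
    IsCycleVertex G v ↔ ∃ w, G.Adj v w ∧ ¬ G.IsBridge s(v, w) := by
  classical
  constructor
  · rintro ⟨c, hc⟩
    have hadj := c.adj_snd hc.not_nil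
    refine ⟨c.snd, hadj, fun hb => hb.notMem_edges_of_isCycle hc ?_⟩
    exact Walk.mk_start_snd_mem_edges hc.not_nil
  · rintro ⟨w, hw, hb⟩
    rw [isBridge_iff, not_not] at hb
    obtain ⟨u, c, hc, he⟩ := adj_and_reachable_delete_edges_iff_exists_cycle.1 ⟨hw, hb⟩
    exact ⟨c.rotate v (c.fst_mem_support_of_mem_edges he), hc.rotate _⟩

/-- A vertex of a non-bridge edge lies on a second one. -/
lemma exists_second_nonbridge {G : SimpleGraph V} {v a : V} (ha : G.Adj v a)
    (hb : ¬ G.IsBridge s(v, a)) : ∃ b, b ≠ a ∧ G.Adj v b ∧ ¬ G.IsBridge s(v, b) := by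
  rw [isBridge_iff, not_not] at hb
  obtain ⟨p, hp⟩ := hb.exists_isPath
  cases p with
  | nil => exact absurd rfl ha.ne
  | @cons _ b _ h q =>
    rw [Walk.cons_isPath_iff] at hp
    rw [deleteEdge_adj] at h
    have hba : b ≠ a := by
      rintro rfl
      exact h.2.1 ⟨rfl, rfl⟩
    refine ⟨b, hba, h.1, ?_⟩
    rw [isBridge_iff, not_not]
    -- Without the edge $vb$ one still gets from $v$ to $b$: along $va$, then back along the rest of
    -- the path, which no longer meets $v$.
    refine Reachable.trans (Adj.reachable (v := a) ?_) (Reachable.symm ?_)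
    · rw [deleteEdge_adj]
      exact ⟨ha, fun h => hba h.2.symm, fun h' => h.1.ne h'.1⟩
    · refine reachable_of_walk q fun c d hcd hc hd => Adj.reachable ?_
      rw [deleteEdge_adj] at hcd ⊢
      refine ⟨hcd.1, ?_, ?_⟩
      · rintro ⟨rfl, -⟩
        exact hp.2 hc
      · rintro ⟨-, rfl⟩
        exact hp.2 hd

lemma two_le_deg_of_nonbridge [Finite V] {G : SimpleGraph V} {v a : V} (ha : G.Adj v a)
    (hb : ¬ G.IsBridge s(v, a)) : 2 ≤ deg G v := by
  obtain ⟨b, hba, h, -⟩ := exists_second_nonbridge ha hb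
  exact two_le_deg h ha hba

lemma eq_or_eq_of_deg_eq_two [Finite V] {G : SimpleGraph V} {v a b c : V} (h : deg G v ≤ 2)
    (ha : G.Adj v a) (hb : G.Adj v b) (hc : G.Adj v c) (hab : a ≠ b) : c = a ∨ c = b := by
  by_contra! hne
  have := three_le_deg ha hb hc hab hne.1.symm hne.2.symm
  omega

lemma forall_of_closed {G : SimpleGraph V} (hG : G.Connected) {p : V → Prop} {z : V} (hz : p z)
    (h : ∀ a b, G.Adj a b → p a → p b) (w : V) : p w := by
  obtain ⟨W⟩ := hG.preconnected z w
  induction W with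
  | nil => exact hz
  | cons h1 _ ih => exact ih (h _ _ h1 hz)

/-- If all cycle-vertices of a connected graph that is not a tree have degree at most `2`, the
graph is a cycle. -/
lemma isCycle_of_deg_le_two [Finite V] {G : SimpleGraph V} (hG : G.Connected) (hT : ¬ G.IsTree)
    (h : ∀ v a, G.Adj v a → ¬ G.IsBridge s(v, a) → deg G v ≤ 2) :
    (∀ v, deg G v = 2) ∧ ∀ v a, G.Adj v a → ¬ G.IsBridge s(v, a) := by
  have h1 : ∃ u v, G.Adj u v ∧ ¬ G.IsBridge s(u, v) := by
    by_contra! hne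
    exact hT ⟨hG, isAcyclic_iff_forall_adj_isBridge.2 fun u v huv => hne u v huv⟩
  obtain ⟨u, v, huv, hb⟩ := h1
  -- A vertex on one non-bridge edge lies on two, and degree at most $2$ leaves no room for a
  -- bridge.
  have key : ∀ a b, G.Adj a b → (∃ c, G.Adj a c ∧ ¬ G.IsBridge s(a, c)) →
      ¬ G.IsBridge s(a, b) := by
    rintro a b hab ⟨c, hc, hcb⟩
    obtain ⟨d, hdc, hd, hdb⟩ := exists_second_nonbridge hc hcb
    rcases eq_or_eq_of_deg_eq_two (h a c hc hcb) hc hd hab hdc.symm with rfl | rfl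
    · exact hcb
    · exact hdb
  have all : ∀ w, ∃ c, G.Adj w c ∧ ¬ G.IsBridge s(w, c) := by
    refine fun w => forall_of_closed hG (p := fun w => ∃ c, G.Adj w c ∧ ¬ G.IsBridge s(w, c))
      ⟨v, huv, hb⟩ ?_ w
    intro a b hab ha
    exact ⟨a, hab.symm, fun hb => key a b hab ha (isBridge_comm.1 hb)⟩
  refine ⟨fun w => ?_, fun w a hwa => key w a hwa (all w)⟩
  obtain ⟨c, hc, hcb⟩ := all w
  exact le_antisymm (h w c hc hcb) (two_le_deg_of_nonbridge hc hcb)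

lemma deg_deleteEdge [Finite V] {G : SimpleGraph V} {u v : V} (huv : G.Adj u v) :
    deg (G.deleteEdges {s(u, v)}) u + 1 = deg G u := by
  unfold deg
  rw [show (G.deleteEdges {s(u, v)}).neighborSet u = G.neighborSet u \ {v} from ?_]
  · exact Set.ncard_sdiff_singleton_add_one (s := G.neighborSet u) huv (Set.toFinite _)
  · ext z
    simp only [mem_neighborSet, deleteEdge_adj, Set.mem_sdiff, Set.mem_singleton_iff]
    constructor
    · rintro ⟨h1, h2, -⟩
      exact ⟨h1, fun h => h2 ⟨trivial, h⟩⟩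
    · rintro ⟨h1, h2⟩
      exact ⟨h1, fun h => h2 h.2, fun h => huv.ne h.1⟩

lemma deg_deleteEdge_right [Finite V] {G : SimpleGraph V} {u v : V} (huv : G.Adj u v) :
    deg (G.deleteEdges {s(u, v)}) v + 1 = deg G v := by
  rw [Sym2.eq_swap]
  exact deg_deleteEdge huv.symm

lemma deg_deleteEdge_of_ne {G : SimpleGraph V} {u v z : V} (hu : z ≠ u) (hv : z ≠ v) :
    deg (G.deleteEdges {s(u, v)}) z = deg G z := by
  unfold deg
  congr 1
  ext w
  simp [mem_neighborSet, hu, hv]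

/-- A connected graph that is neither a tree nor a cycle has a non-bridge edge at a major vertex
whose deletion does not leave a cycle. -/
lemma exists_good_edge [Finite V] {G : SimpleGraph V} (hG : G.Connected) (hT : ¬ G.IsTree)
    (h2 : ∃ z, deg G z ≠ 2) :
    ∃ u v, G.Adj u v ∧ ¬ G.IsBridge s(u, v) ∧ 3 ≤ deg G u ∧
      ∃ z, deg (G.deleteEdges {s(u, v)}) z ≠ 2 := by
  have h1 : ∃ u v, G.Adj u v ∧ ¬ G.IsBridge s(u, v) ∧ 3 ≤ deg G u := by
    by_contra! hne
    obtain ⟨z, hz⟩ := h2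
    exact hz ((isCycle_of_deg_le_two hG hT fun v a hva hb => by
      have := hne v a hva hb
      omega).1 z)
  obtain ⟨u, v, huv, hb, hu⟩ := h1
  by_cases hz : ∃ z, deg (G.deleteEdges {s(u, v)}) z ≠ 2
  · exact ⟨u, v, huv, hb, hu, hz⟩
  push Not at hz
  have hG' := hG.connected_delete_edge_of_not_isBridge hb
  have hT' : ¬ (G.deleteEdges {s(u, v)}).IsTree := by
    intro hT'
    have : Fintype V := Fintype.ofFinite V
    have : Nontrivial V := ⟨u, v, huv.ne⟩
    obtain ⟨r, hr⟩ := exists_leaf hT'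
    rw [hz r] at hr
    omega
  have hcyc := isCycle_of_deg_le_two hG' hT' fun w a _ _ => (hz w).le
  -- Here deleting $uv$ leaves a cycle. Delete instead an edge $uy$ of that cycle: then $y$, of
  -- degree $2$ in $G$, becomes pendent.
  obtain ⟨y, hy⟩ := exists_adj_of_one_le_deg (G := G.deleteEdges {s(u, v)}) (v := u)
    (by rw [hz u]; omega)
  have hyb := hcyc.2 u y hy
  have huy := deleteEdge_adj.1 hy
  have hyv : y ≠ v := fun e => huy.2.1 ⟨rfl, e⟩
  refine ⟨u, y, huy.1, fun hb => hyb (IsBridge.anti (deleteEdges_le _) hb), hu, y, ?_⟩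
  have e1 := deg_deleteEdge_right huy.1
  have e2 := deg_deleteEdge_of_ne (G := G) huy.1.ne.symm hyv
  rw [hz y] at e2
  omega

/-! ### Spanning trees with controlled leaves -/

/-- `G` arises from the tree `T` by adding the edges `uv` for `(u, v) ∈ D`. -/
structure IsCut (G T : SimpleGraph V) (D : Finset (V × V)) : Prop where
  isTree : T.IsTree
  adj_iff : ∀ a b, G.Adj a b ↔ T.Adj a b ∨ (a, b) ∈ D ∨ (b, a) ∈ D
  not_adj : ∀ a b, (a, b) ∈ D → ¬ T.Adj a b
  -- Pairs are oriented, as the second entry will be the end that may become a leaf. Each edge is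
  -- recorded once; the case $a=b$ is excluded as well.
  not_mem : ∀ a b, (a, b) ∈ D → (b, a) ∉ D

lemma IsCut.insert_edge [DecidableEq V] {G T : SimpleGraph V} {D : Finset (V × V)} {u v : V}
    (hc : IsCut (G.deleteEdges {s(u, v)}) T D) (huv : G.Adj u v) :
    (u, v) ∉ D ∧ IsCut G T (insert (u, v) D) := by
  have n0 : ¬ (G.deleteEdges {s(u, v)}).Adj u v := fun h => (deleteEdge_adj.1 h).2.1 ⟨rfl, rfl⟩
  have n1 : (u, v) ∉ D := fun h => n0 ((hc.adj_iff u v).2 (Or.inr (Or.inl h)))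
  have n2 : (v, u) ∉ D := fun h => n0 ((hc.adj_iff u v).2 (Or.inr (Or.inr h)))
  have n3 : ¬ T.Adj u v := fun h => n0 ((hc.adj_iff u v).2 (Or.inl h))
  have mem : ∀ a b, (a, b) ∈ insert (u, v) D ↔ (a = u ∧ b = v) ∨ (a, b) ∈ D := fun a b => by
    rw [Finset.mem_insert, Prod.mk.injEq]
  refine ⟨n1, hc.isTree, ?_, ?_, ?_⟩
  · intro a b
    have h1 := hc.adj_iff a b
    rw [deleteEdge_adj] at h1
    rw [mem, mem]
    constructor
    · intro hab
      by_cases e1 : a = u ∧ b = v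
      · exact Or.inr (Or.inl (Or.inl e1))
      by_cases e2 : a = v ∧ b = u
      · exact Or.inr (Or.inr (Or.inl ⟨e2.2, e2.1⟩))
      rcases h1.1 ⟨hab, e1, e2⟩ with h | h | h
      · exact Or.inl h
      · exact Or.inr (Or.inl (Or.inr h))
      · exact Or.inr (Or.inr (Or.inr h))
    · rintro (h | (⟨rfl, rfl⟩ | h) | (⟨rfl, rfl⟩ | h))
      · exact (h1.2 (Or.inl h)).1
      · exact huv
      · exact (h1.2 (Or.inr (Or.inl h))).1
      · exact huv.symm
      · exact (h1.2 (Or.inr (Or.inr h))).1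
  · intro a b h
    rcases (mem a b).1 h with ⟨rfl, rfl⟩ | h
    · exact n3
    · exact hc.not_adj a b h
  · intro a b h h'
    rcases (mem a b).1 h with ⟨rfl, rfl⟩ | h1
    · rcases (mem _ _).1 h' with ⟨h', -⟩ | h'
      · exact huv.ne h'.symm
      · exact n2 h'
    · rcases (mem _ _).1 h' with ⟨rfl, rfl⟩ | h'
      · exact n2 h1
      · exact hc.not_mem a b h1 h'

lemma IsTree.isCut {T : SimpleGraph V} (hT : T.IsTree) : IsCut T T ∅ :=
  ⟨hT, by simp, by simp, by simp⟩

/-- A connected graph that is not a cycle has a spanning tree with few leaves. -/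
theorem exists_isCut [Finite V] {G : SimpleGraph V} (hG : G.Connected)
    (h2 : ∃ z, deg G z ≠ 2) :
    ∃ T D, IsCut G T D ∧ (D.card : ℤ) = cyclomatic G ∧
      ∀ b, deg T b = 1 → deg G b = 1 ∨ ∃ a, (a, b) ∈ D := by
  classical
  obtain ⟨n, hn⟩ := Int.eq_ofNat_of_zero_le (cyclomatic_nonneg hG)
  induction n generalizing G with
  | zero =>
    exact ⟨G, ∅, IsTree.isCut (isTree_iff_cyclomatic.2 ⟨hG, hn⟩), by simp [hn],
      fun b hb => Or.inl hb⟩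
  | succ n ih =>
    have hT : ¬ G.IsTree := fun hT => by
      have := (isTree_iff_cyclomatic.1 hT).2
      omega
    obtain ⟨u, v, huv, hb, hu, hz⟩ := exists_good_edge hG hT h2
    have hcyc := cyclomatic_deleteEdge hG huv hb
    obtain ⟨T, D, hc, hD, hleaf⟩ := ih (hG.connected_delete_edge_of_not_isBridge hb) hz (by
      push_cast at hn
      omega)
    obtain ⟨h1, h3⟩ := hc.insert_edge huv
    refine ⟨T, _, h3, ?_, fun b hb1 => ?_⟩
    · rw [Finset.card_insert_of_notMem h1]
      push_cast
      omega
    -- The vertex $u$ keeps degree at least $2$, so $v$ is the only vertex that the deletion can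
    -- make pendent.
    · rcases hleaf b hb1 with h | ⟨a, h⟩
      · by_cases e : b = v
        · exact Or.inr ⟨u, by simp [e]⟩
        · left
          by_cases e' : b = u
          · subst e'
            have := deg_deleteEdge huv
            omega
          · rwa [deg_deleteEdge_of_ne e' e] at h
      · exact Or.inr ⟨a, Finset.mem_insert_of_mem h⟩

section

/-! ### Removing edges by rank one perturbations -/

open Classical in
/-- The row vector of the rank one matrix that removes the edge `p`. -/
noncomputable def cutRow (B : Matrix V V ℂ) (t : ℂ) (p : V × V) (j : V) : ℂ :=
  if j = p.1 then t else if j = p.2 then B p.1 p.2 else 0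

open Classical in
/-- The column vector of the rank one matrix that removes the edge `p`. -/
noncomputable def cutCol (B : Matrix V V ℂ) (t : ℂ) (p : V × V) (i : V) : ℂ :=
  if i = p.1 then 1 else if i = p.2 then B p.2 p.1 / t else 0

/-- The matrix `B` with the edges in `D` removed by rank one perturbations. -/
noncomputable def cutMatrix (B : Matrix V V ℂ) (D : Finset (V × V)) (t : ℂ) : Matrix V V ℂ :=
  fun i j => B i j - ∑ p ∈ D, cutCol B t p i * cutRow B t p j

variable {G T : SimpleGraph V} {D : Finset (V × V)} {B : Matrix V V ℂ} {x : ℝ} {t : ℂ}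

lemma IsCut.ne (hc : IsCut G T D) {a b : V} (h : (a, b) ∈ D) : a ≠ b := by
  rintro rfl
  exact hc.not_mem a a h h

lemma cutCol_mul_cutRow {p : V × V} {i j : V} (hij : i ≠ j)
    (h : cutCol B t p i * cutRow B t p j ≠ 0) : p = (i, j) ∨ p = (j, i) := by
  have h1 := left_ne_zero_of_mul h
  have h2 := right_ne_zero_of_mul h
  unfold cutCol at h1
  unfold cutRow at h2
  obtain ⟨a, b⟩ := p
  simp only [Prod.mk.injEq]
  by_cases e1 : i = a
  · by_cases e2 : j = a
    · exact absurd (e1.trans e2.symm) hij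
    by_cases e3 : j = b
    · exact Or.inl ⟨e1.symm, e3.symm⟩
    · simp [e2, e3] at h2
  · by_cases e3 : i = b
    · by_cases e2 : j = a
      · exact Or.inr ⟨e2.symm, e3.symm⟩
      by_cases e4 : j = b
      · exact absurd (e3.trans e4.symm) hij
      · simp [e2, e4] at h2
    · simp [e1, e3] at h1

/-- Column times row equals $b_{ab}$ at $(a,b)$ and $b_{ba}$ at $(b,a)$, cancelling the deleted
edge. Its other two entries lie on the diagonal, where the pattern imposes nothing; this is why
$t\ne 0$ is free. -/
lemma IsCut.hasPattern (hc : IsCut G T D) (hB : HasPattern G B) (ht : t ≠ 0) :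
    HasPattern T (cutMatrix B D t) := by
  intro i j hij
  unfold cutMatrix
  by_cases h1 : (i, j) ∈ D
  · rw [Finset.sum_eq_single (i, j)]
    · simp [cutCol, cutRow, hij.symm, hc.not_adj i j h1]
    · intro p hp hne
      by_contra h
      rcases cutCol_mul_cutRow hij h with rfl | rfl
      · exact hne rfl
      · exact hc.not_mem i j h1 hp
    · exact fun h => absurd h1 h
  by_cases h2 : (j, i) ∈ D
  · rw [Finset.sum_eq_single (j, i)]
    · have h3 : ¬ T.Adj i j := fun h => hc.not_adj j i h2 h.symm
      simp [cutCol, cutRow, hij, ht, h3]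
    · intro p hp hne
      by_contra h
      rcases cutCol_mul_cutRow hij h with rfl | rfl
      · exact h1 hp
      · exact hne rfl
    · exact fun h => absurd h2 h
  · rw [Finset.sum_eq_zero, sub_zero, hB i j hij, hc.adj_iff]
    · simp [h1, h2]
    · intro p hp
      by_contra h
      rcases cutCol_mul_cutRow hij h with rfl | rfl
      · exact h1 hp
      · exact h2 hp

lemma pendentCount_le_of_leaf [Finite V] (hl : ∀ b, deg T b = 1 → deg G b = 1 ∨ ∃ a, (a, b) ∈ D) :
    pendentCount T ≤ pendentCount G + D.card := by
  classical
  have h1 : {b | deg T b = 1} ⊆ {b | deg G b = 1} ∪ (D.image Prod.snd : Finset V) := by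
    intro b hb
    rcases hl b hb with h | ⟨a, h⟩
    · exact Or.inl h
    · exact Or.inr (by simpa using ⟨a, h⟩)
  have h2 := Set.ncard_le_ncard h1 (Set.toFinite _)
  have h3 := Set.ncard_union_le {b | deg G b = 1} ((D.image Prod.snd : Finset V) : Set V)
  rw [Set.ncard_coe_finset] at h3
  have h4 := Finset.card_image_le (s := D) (f := Prod.snd)
  unfold pendentCount
  omega

lemma nontrivial_of_not_isTree (hG : G.Connected) (h : ¬ G.IsTree) : Nontrivial V := by
  by_contra hV
  rw [not_nontrivial_iff_subsingleton] at hV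
  have := hG.nonempty
  exact h IsTree.of_subsingleton

variable [Fintype V]

lemma sum_cutRow (y : V → ℂ) {a b : V} (hab : a ≠ b) :
    ∑ j, cutRow B t (a, b) j * y j = t * y a + B a b * y b := by
  classical
  rw [← Finset.sum_subset (Finset.subset_univ {a, b}), Finset.sum_pair hab]
  · simp [cutRow, hab.symm]
  · intro j _ hj
    simp only [Finset.mem_insert, Finset.mem_singleton, not_or] at hj
    simp [cutRow, hj.1, hj.2]

lemma sum_cutMatrix (y : V → ℂ) (i : V) :
    ∑ j, cutMatrix B D t i j * y j =
      ∑ j, B i j * y j - ∑ p ∈ D, cutCol B t p i * ∑ j, cutRow B t p j * y j := by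
  unfold cutMatrix
  simp only [sub_mul, Finset.sum_sub_distrib, Finset.sum_mul, Finset.mul_sum]
  congr 1
  rw [Finset.sum_comm]
  simp only [mul_assoc]

lemma mem_eigenspace_cutMatrix {y : V → ℂ} (h : ∀ p ∈ D, ∑ j, cutRow B t p j * y j = 0) :
    y ∈ Module.End.eigenspace (cutMatrix B D t).mulVecLin (x : ℂ) ↔
      y ∈ Module.End.eigenspace B.mulVecLin (x : ℂ) := by
  simp only [mem_eigenspace, sum_cutMatrix]
  refine forall_congr' fun i => ?_
  rw [Finset.sum_eq_zero (s := D), sub_zero]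
  intro p hp
  rw [h p hp, mul_zero]

/-- The functionals given by the rows `cutRow`, for the edges in `D`. -/
noncomputable def cutFunctional (B : Matrix V V ℂ) (D : Finset (V × V)) (t : ℂ) :
    (V → ℂ) →ₗ[ℂ] (D → ℂ) where
  toFun y p := ∑ j, cutRow B t p j * y j
  map_add' y z := by
    ext p
    simp [mul_add, Finset.sum_add_distrib]
  map_smul' c y := by
    ext p
    simp [Finset.mul_sum, mul_left_comm]

/-- Linear algebra behind the comparison of two subspaces that agree on the kernel of `f`. -/
lemma finrank_le_of_inf_ker_le {E F : Type*} [AddCommGroup E] [Module ℂ E] [FiniteDimensional ℂ E]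
    [AddCommGroup F] [Module ℂ F] [FiniteDimensional ℂ F] (f : E →ₗ[ℂ] F) (M N : Submodule ℂ E)
    (h : M ⊓ LinearMap.ker f ≤ N) :
    Module.finrank ℂ M ≤ Module.finrank ℂ N + Module.finrank ℂ F ∧
      (Module.finrank ℂ M = Module.finrank ℂ N + Module.finrank ℂ F →
        M ⊓ LinearMap.ker f = N) := by
  have h1 := (f.domRestrict M).finrank_range_add_finrank_ker
  have h2 : Module.finrank ℂ (LinearMap.ker (f.domRestrict M)) =
      Module.finrank ℂ (M ⊓ LinearMap.ker f : Submodule ℂ E) := by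
    rw [LinearMap.ker_domRestrict, ← Submodule.finrank_map_subtype_eq M,
      Submodule.map_comap_subtype]
  have h3 := Submodule.finrank_le (LinearMap.range (f.domRestrict M))
  have h4 := Submodule.finrank_mono h
  refine ⟨by omega, fun h5 => Submodule.eq_of_le_of_finrank_eq h (by omega)⟩

/-- The two eigenspaces agree on the common kernel of the $|D|$ row functionals. If the bound is
attained, the eigenspace of the cut matrix lies inside that kernel. -/
lemma mult_le_cutMatrix (B : Matrix V V ℂ) (D : Finset (V × V)) (t : ℂ) (x : ℝ) :
    mult B x ≤ mult (cutMatrix B D t) x + D.card ∧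
      (mult B x = mult (cutMatrix B D t) x + D.card →
        ∀ y ∈ Module.End.eigenspace (cutMatrix B D t).mulVecLin (x : ℂ),
          y ∈ Module.End.eigenspace B.mulVecLin (x : ℂ) ∧
            ∀ p ∈ D, ∑ j, cutRow B t p j * y j = 0) := by
  have h := finrank_le_of_inf_ker_le (cutFunctional B D t)
    (Module.End.eigenspace B.mulVecLin (x : ℂ))
    (Module.End.eigenspace (cutMatrix B D t).mulVecLin (x : ℂ)) (by
      rintro y ⟨h1, h2⟩
      exact (mem_eigenspace_cutMatrix fun p hp => congrFun h2 ⟨p, hp⟩).2 h1)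
  rw [Module.finrank_fintype_fun_eq_card, Fintype.card_coe] at h
  refine ⟨h.1, fun he y hy => ?_⟩
  rw [← h.2 he] at hy
  exact ⟨hy.1, fun p hp => congrFun hy.2 ⟨p, hp⟩⟩

lemma IsCut.mult_le [Nontrivial V] (hc : IsCut G T D) (hB : HasPattern G B) (x : ℝ) :
    mult B x + 1 ≤ pendentCount T + D.card := by
  have h1 := (mult_le_cutMatrix B D 1 x).1
  have h2 := mult_lt_pendentCount hc.isTree (hc.hasPattern hB one_ne_zero) x
  omega

/-- The equality in the hypothesis does not involve $t$, so the conclusion is available for every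
non-zero $t$; two values are used later. -/
lemma IsCut.extremal [Nontrivial V] (hc : IsCut G T D) (hB : HasPattern G B)
    (h : mult B x + 1 = pendentCount T + D.card) (ht : t ≠ 0) :
    mult (cutMatrix B D t) x + 1 = pendentCount T ∧
      ∀ y ∈ Module.End.eigenspace (cutMatrix B D t).mulVecLin (x : ℂ),
        y ∈ Module.End.eigenspace B.mulVecLin (x : ℂ) ∧
          ∀ a b, (a, b) ∈ D → t * y a + B a b * y b = 0 := by
  have h1 := mult_le_cutMatrix B D t x
  have h2 := mult_lt_pendentCount hc.isTree (hc.hasPattern hB ht) x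
  refine ⟨by omega, fun y hy => ?_⟩
  obtain ⟨h3, h4⟩ := h1.2 (by omega) y hy
  exact ⟨h3, fun a b hab => by rw [← sum_cutRow y (hc.ne hab), h4 _ hab]⟩

/-- The general bound for the multiplicity of an eigenvalue. -/
theorem mult_le_of_exists_deg_ne_two (hG : G.Connected) (h2 : ∃ z, deg G z ≠ 2) [Nontrivial V]
    (hB : HasPattern G B) (x : ℝ) :
    (mult B x : ℤ) ≤ 2 * cyclomatic G + pendentCount G - 1 := by
  obtain ⟨T, D, hc, hD, hl⟩ := exists_isCut hG h2
  have h3 := hc.mult_le hB x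
  have h4 := pendentCount_le_of_leaf hl
  omega

/-- The general bound gives $2+1-1$ unless $G$ is a cycle. Then deleting one edge leaves a tree with
at most two leaves, which gives the same number. -/
theorem InU.mult_le_two (hG : InU G) (hB : HasPattern G B) (x : ℝ) : mult B x ≤ 2 := by
  classical
  obtain ⟨hconn, hcyc, hp⟩ := hG
  have hT : ¬ G.IsTree := fun hT => by
    have := (isTree_iff_cyclomatic.1 hT).2
    omega
  have := nontrivial_of_not_isTree hconn hT
  by_cases h2 : ∃ z, deg G z ≠ 2
  · have := mult_le_of_exists_deg_ne_two hconn h2 hB x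
    omega
  push Not at h2
  have h1 : ∃ u v, G.Adj u v ∧ ¬ G.IsBridge s(u, v) := by
    by_contra! hne
    exact hT ⟨hconn, isAcyclic_iff_forall_adj_isBridge.2 fun u v huv => hne u v huv⟩
  obtain ⟨u, v, huv, hb⟩ := h1
  have hT' : (G.deleteEdges {s(u, v)}).IsTree := by
    have := cyclomatic_deleteEdge hconn huv hb
    exact isTree_iff_cyclomatic.2
      ⟨hconn.connected_delete_edge_of_not_isBridge hb, by omega⟩
  have h3 := ((IsTree.isCut hT').insert_edge huv).2.mult_le hB x
  have h4 : pendentCount (G.deleteEdges {s(u, v)}) ≤ 2 := by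
    unfold pendentCount
    refine (Set.ncard_le_ncard (t := {u, v}) ?_ (Set.toFinite _)).trans
      ((Set.ncard_insert_le u {v}).trans (by rw [Set.ncard_singleton]))
    intro z hz
    by_contra hne
    simp only [Set.mem_insert_iff, Set.mem_singleton_iff, not_or] at hne
    have h5 : deg _ z = 1 := hz
    rw [deg_deleteEdge_of_ne hne.1 hne.2, h2 z] at h5
    omega
  have h6 := Finset.card_insert_le (u, v) (∅ : Finset (V × V))
  rw [Finset.card_empty] at h6
  omega

end

/-! ### Paths -/

lemma pendentCount_le_two [Finite V] {T : SimpleGraph V} (hT : T.IsTree)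
    (h : ∀ z, ¬ IsMajor T z) : pendentCount T ≤ 2 := by
  by_contra hlt
  unfold pendentCount at hlt
  push Not at hlt
  obtain ⟨a, ha, b, hb, c, hc, hab, hac, hbc⟩ := (Set.two_lt_ncard (Set.toFinite _)).1 hlt
  rcases leaf_eq_of_between hT ha hc hb hab (fun z _ => h z) with e | e
  · exact hac e.symm
  · exact hbc e.symm

/-- Without branching every vertex has at most one child, so each depth is occupied at most once. -/
lemma dist_injective_of_deg_le_two [Finite V] {T : SimpleGraph V} (hT : T.IsTree)
    (h : ∀ z, ¬ IsMajor T z) {r : V} (hr : deg T r ≤ 1) : Function.Injective (T.dist r) := by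
  have hchild : ∀ p z z', IsChild T r p z → IsChild T r p z' → z = z' := by
    intro p z z' hz hz'
    by_contra hne
    by_cases hp : r = p
    · subst hp
      have := two_le_deg hz.1 hz'.1 hne
      omega
    · obtain ⟨q, hq⟩ := exists_parent hT hp
      refine h p (three_le_deg hz.1 hz'.1 hq.1.symm hne ?_ ?_)
      · rintro rfl
        have := hz.2; have := hq.2; omega
      · rintro rfl
        have := hz'.2; have := hq.2; omega
  have key : ∀ n z z', T.dist r z = n → T.dist r z' = n → z = z' := by
    intro n
    induction n with
    | zero =>
      intro z z' hz hz'
      rw [hT.connected.dist_eq_zero_iff] at hz hz'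
      rw [← hz, hz']
    | succ n ih =>
      intro z z' hz hz'
      obtain ⟨p, hp⟩ := exists_parent hT (r := r) (z := z) (by rintro rfl; simp at hz)
      obtain ⟨q, hq⟩ := exists_parent hT (r := r) (z := z') (by rintro rfl; simp at hz')
      have := hp.2
      have := hq.2
      obtain rfl := ih p q (by omega) (by omega)
      exact hchild p z z' hp hq
  exact fun z z' hzz => key _ z z' rfl hzz.symm

/-- A numbering of the vertices of a tree without major vertices, starting from an end. -/
lemma exists_equiv_fin [Finite V] {T : SimpleGraph V} (hT : T.IsTree)
    (h : ∀ z, ¬ IsMajor T z) {r : V} (hr : deg T r ≤ 1) :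
    ∃ (n : ℕ) (f : V ≃ Fin (n + 1)), f r = 0 ∧
      ∀ a b, T.Adj a b ↔ (f a : ℕ) + 1 = f b ∨ (f b : ℕ) + 1 = f a := by
  have : Fintype V := Fintype.ofFinite V
  have hinj := dist_injective_of_deg_le_two hT h hr
  have hlt : ∀ z, T.dist r z < Fintype.card V := by
    intro z
    obtain ⟨p, hp, hp'⟩ := hT.connected.exists_path_of_dist r z
    rw [← hp']
    exact hp.length_lt
  obtain ⟨n, hn⟩ : ∃ n, Fintype.card V = n + 1 :=
    Nat.exists_eq_succ_of_ne_zero (by have := hlt r; omega)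
  let f : V → Fin (n + 1) := fun z => ⟨T.dist r z, hn ▸ hlt z⟩
  have hf : Function.Bijective f := by
    rw [Fintype.bijective_iff_injective_and_card]
    refine ⟨fun a b hab => hinj (congrArg Fin.val hab), by simp [hn]⟩
  refine ⟨n, Equiv.ofBijective f hf, ?_, fun a b => ?_⟩
  · simp [f]
  simp only [Equiv.ofBijective_apply, f]
  have key : ∀ a b, T.dist r a + 1 = T.dist r b → T.Adj a b := by
    intro a b hab
    obtain ⟨p, hp⟩ := exists_parent hT (r := r) (z := b) (by rintro rfl; simp at hab)
    have e : p = a := hinj (by have := hp.2; omega)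
    exact e ▸ hp.1
  constructor
  · intro hab
    rcases adj_cases hT r hab with h1 | h1
    · exact Or.inl h1.2.symm
    · exact Or.inr h1.2.symm
  · rintro (h1 | h1)
    · exact key a b h1
    · exact (key b a h1).symm

lemma isPathGraph_of_isTree [Finite V] {T : SimpleGraph V} (hT : T.IsTree)
    (h : ∀ z, ¬ IsMajor T z) : IsPathGraph T := by
  have hr : ∃ r, deg T r ≤ 1 := by
    rcases subsingleton_or_nontrivial V with hV | hV
    · obtain ⟨r⟩ := hT.connected.nonempty
      refine ⟨r, ?_⟩
      unfold deg
      rw [Set.ncard_le_one]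
      exact fun a _ b _ => Subsingleton.elim a b
    · have : Fintype V := Fintype.ofFinite V
      obtain ⟨r, hr⟩ := exists_leaf hT
      exact ⟨r, hr.le⟩
  obtain ⟨r, hr⟩ := hr
  obtain ⟨n, f, -, hf⟩ := exists_equiv_fin hT h hr
  refine ⟨n, ⟨⟨f, fun {a b} => ?_⟩⟩⟩
  rw [pathGraph_adj, hf]

/-! ### Induced subgraphs and principal submatrices -/

lemma deg_induce_le [Finite V] (G : SimpleGraph V) (P : Set V) (z : P) :
    deg (G.induce P) z ≤ deg G z := by
  unfold deg
  rw [← Set.ncard_image_of_injective _ Subtype.val_injective]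
  refine Set.ncard_le_ncard ?_ (Set.toFinite _)
  rintro _ ⟨w, hw, rfl⟩
  exact hw

lemma HasPattern.principal {G : SimpleGraph V} {B : Matrix V V ℂ} (hB : HasPattern G B)
    (P : Set V) : HasPattern (G.induce P) (principal B P) :=
  fun i j hij => hB i j fun h => hij (Subtype.ext h)

/-- If $y$ vanishes at the neighbours of $i$ outside $P$, row $i$ cannot tell $B$ from its principal
submatrix. Eigenvectors are restricted to components and extended from them in this way. -/
lemma sum_principal [Fintype V] {G : SimpleGraph V} {B : Matrix V V ℂ}
    (hB : HasPattern G B) {P : Set V} [Fintype P] {y : V → ℂ} (i : P)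
    (h : ∀ w, w ∉ P → G.Adj i w → y w = 0) :
    ∑ j : P, principal B P i j * y j = ∑ j, B i j * y j := by
  classical
  rw [← Finset.sum_subset (Finset.subset_univ (Finset.univ.filter (· ∈ P)))]
  · rw [Finset.sum_subtype (p := (· ∈ P)) (Finset.univ.filter (· ∈ P)) (by simp)]
    rfl
  · intro w _ hw
    have hwP : w ∉ P := by simpa using hw
    have hiw : (i : V) ≠ w := fun e => hwP (e ▸ i.2)
    by_cases hadj : G.Adj i w
    · rw [h w hwP hadj, mul_zero]
    · rw [show B i w = 0 from by_contra fun h => hadj ((hB i w hiw).1 h), zero_mul]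

lemma restrict_mem_eigenspace [Fintype V] {G : SimpleGraph V} {B : Matrix V V ℂ}
    (hB : HasPattern G B) {P : Set V} [Fintype P] {x : ℝ} {y : V → ℂ}
    (hy : y ∈ Module.End.eigenspace B.mulVecLin (x : ℂ))
    (h : ∀ z ∈ P, ∀ w, w ∉ P → G.Adj z w → y w = 0) :
    (fun z : P => y z) ∈ Module.End.eigenspace (principal B P).mulVecLin (x : ℂ) := by
  rw [mem_eigenspace] at hy ⊢
  intro i
  rw [← hy i, ← sum_principal hB i (h i i.2)]

lemma two_le_finrank {E : Type*} [AddCommGroup E] [Module ℂ E] [FiniteDimensional ℂ E]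
    {M : Submodule ℂ E} {y z : E} (hy : y ∈ M) (hz : z ∈ M)
    (h : ∀ a b : ℂ, a • y + b • z = 0 → a = 0 ∧ b = 0) : 2 ≤ Module.finrank ℂ M := by
  have hli : LinearIndependent ℂ ![(⟨y, hy⟩ : M), ⟨z, hz⟩] := by
    rw [LinearIndependent.pair_iff]
    intro a b hab
    exact h a b (congrArg Subtype.val hab)
  simpa using hli.fintype_card_le_finrank

lemma cyclomatic_of_isCut_singleton [Finite V] {G T : SimpleGraph V} {u v : V}
    (hc : IsCut G T {(u, v)}) : G.Connected ∧ cyclomatic G = 1 := by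
  have hle : T ≤ G := fun a b h => (hc.adj_iff a b).2 (Or.inl h)
  have hconn : G.Connected := hc.isTree.connected.mono hle
  have huv : G.Adj u v := (hc.adj_iff u v).2 (by simp)
  have he : G.deleteEdges {s(u, v)} = T := by
    ext a b
    rw [deleteEdge_adj, hc.adj_iff]
    simp only [Finset.mem_singleton, Prod.mk.injEq]
    constructor
    · rintro ⟨h1, h2, h3⟩
      rcases h1 with h1 | h1 | h1
      · exact h1
      · exact absurd h1 h2
      · exact absurd ⟨h1.2, h1.1⟩ h3
    · intro h
      have h1 := hc.not_adj u v (by simp)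
      refine ⟨Or.inl h, ?_, ?_⟩
      · rintro ⟨rfl, rfl⟩
        exact h1 h
      · rintro ⟨rfl, rfl⟩
        exact h1 h.symm
  have hb : ¬ G.IsBridge s(u, v) := by
    rw [isBridge_iff, he, not_not]
    exact hc.isTree.connected.preconnected u v
  refine ⟨hconn, ?_⟩
  rw [cyclomatic_deleteEdge hconn huv hb, he, (isTree_iff_cyclomatic.1 hc.isTree).2]
  rfl

/-! ### The extremal case -/

/-- The tree `T` without the edges at its major vertices. -/
def minorPart (T : SimpleGraph V) : SimpleGraph V where
  Adj a b := T.Adj a b ∧ ¬ IsMajor T a ∧ ¬ IsMajor T b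
  symm := ⟨fun _ _ h => ⟨h.1.symm, h.2.2, h.2.1⟩⟩
  loopless := ⟨fun _ h => h.1.ne rfl⟩

/-- An extremal cut: the bound for the multiplicity coming from the spanning tree `T` is attained,
and every removed edge produces a new leaf of `T`. -/
structure IsExtremal [Fintype V] (G T : SimpleGraph V) (D : Finset (V × V)) (B : Matrix V V ℂ)
    (x : ℝ) : Prop where
  cut : IsCut G T D
  pattern : HasPattern G B
  mult_eq : mult B x + 1 = pendentCount T + D.card
  leaf : ∀ a b, (a, b) ∈ D → deg T b = 1
  inj : ∀ a a' b, (a, b) ∈ D → (a', b) ∈ D → a = a'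
  three_le : 3 ≤ pendentCount T

/-- A vertex set of a connected component of `T` without its major vertices. -/
def IsBlock (T : SimpleGraph V) (P : Set V) : Prop :=
  ∃ z, ¬ IsMajor T z ∧ P = {w | (minorPart T).Reachable z w}

lemma not_isMajor_of_reachable {T : SimpleGraph V} {a b : V} (h : (minorPart T).Reachable a b)
    (ha : ¬ IsMajor T a) : ¬ IsMajor T b := by
  obtain ⟨W⟩ := h
  induction W with
  | nil => exact ha
  | cons h1 _ ih => exact ih h1.2.2

/-! ### Blocks: components of the tree minus its major vertices -/

namespace IsBlock

variable {T : SimpleGraph V} {P : Set V}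

lemma not_isMajor (hP : IsBlock T P) {z : V} (hz : z ∈ P) : ¬ IsMajor T z := by
  obtain ⟨z0, h0, rfl⟩ := hP
  exact not_isMajor_of_reachable hz h0

lemma nonempty (hP : IsBlock T P) : P.Nonempty := by
  obtain ⟨z0, h0, rfl⟩ := hP
  exact ⟨z0, Reachable.refl _⟩

lemma mem_of_reachable (hP : IsBlock T P) {z w : V} (hz : z ∈ P)
    (h : (minorPart T).Reachable z w) : w ∈ P := by
  obtain ⟨z0, h0, rfl⟩ := hP
  exact Reachable.trans hz h

lemma reachable (hP : IsBlock T P) {z w : V} (hz : z ∈ P) (hw : w ∈ P) :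
    (minorPart T).Reachable z w := by
  obtain ⟨z0, h0, rfl⟩ := hP
  exact (Reachable.symm hz).trans hw

lemma mem_of_adj (hP : IsBlock T P) {z w : V} (hz : z ∈ P) (h : T.Adj z w)
    (hw : ¬ IsMajor T w) : w ∈ P :=
  hP.mem_of_reachable hz (Adj.reachable ⟨h, hP.not_isMajor hz, hw⟩)

lemma isTree_induce (hP : IsBlock T P) (hT : T.IsTree) : (T.induce P).IsTree := by
  have hne : Nonempty P := hP.nonempty.to_subtype
  refine ⟨⟨fun a b => ?_⟩, hT.isAcyclic.induce P⟩
  obtain ⟨W⟩ := hP.reachable a.2 b.2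
  have key : ∀ (a b : V) (_ : (minorPart T).Walk a b) (ha : a ∈ P) (hb : b ∈ P),
      (T.induce P).Reachable ⟨a, ha⟩ ⟨b, hb⟩ := by
    intro a b W
    induction W with
    | nil => exact fun _ _ => Reachable.refl _
    | @cons a c b h1 _ ih =>
      intro ha hb
      have hc := hP.mem_of_adj ha h1.1 h1.2.2
      refine Reachable.trans (Adj.reachable ?_) (ih hc hb)
      exact h1.1
  exact key a b W a.2 b.2

lemma induce_not_isMajor [Finite V] (hP : IsBlock T P) (z : P) : ¬ IsMajor (T.induce P) z :=
  fun h => hP.not_isMajor z.2 (le_trans h (deg_induce_le T P z))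

end IsBlock

lemma reachable_deleteEdge_of_isCut {G T : SimpleGraph V} {D : Finset (V × V)} (hc : IsCut G T D)
    {a b : V} (hab : (a, b) ∈ D) : (G.deleteEdges {s(a, b)}).Reachable a b := by
  refine Reachable.mono ?_ (hc.isTree.connected.preconnected a b)
  intro c d hcd
  rw [deleteEdge_adj]
  have h1 := hc.not_adj a b hab
  refine ⟨(hc.adj_iff c d).2 (Or.inl hcd), ?_, ?_⟩
  · rintro ⟨rfl, rfl⟩
    exact h1 hcd
  · rintro ⟨rfl, rfl⟩
    exact h1 hcd.symm

lemma isCycleVertex_of_mem_support {G : SimpleGraph V} {u z : V} {c : G.Walk u u} (hc : c.IsCycle)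
    (hz : z ∈ c.support) : IsCycleVertex G z := by
  classical
  exact ⟨c.rotate z hz, hc.rotate hz⟩

/-! ### Position of the deleted edges in an extremal cut -/

namespace IsExtremal

variable [Fintype V] {G T : SimpleGraph V} {D : Finset (V × V)} {B : Matrix V V ℂ} {x : ℝ}

lemma le (h : IsExtremal G T D B x) : T ≤ G := fun a b hab => (h.cut.adj_iff a b).2 (Or.inl hab)

lemma exists_other_leaf (h : IsExtremal G T D B x) (a : V) : ∃ b, deg T b = 1 ∧ b ≠ a := by
  have h3 := h.three_le
  unfold pendentCount at h3
  obtain ⟨b, hb, hba⟩ := Set.exists_ne_of_one_lt_ncard (s := {b | deg T b = 1}) (by omega) a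
  exact ⟨b, hb, hba⟩

lemma nontrivial (h : IsExtremal G T D B x) : Nontrivial V := by
  obtain ⟨v⟩ := h.cut.isTree.connected.nonempty
  obtain ⟨b, -, hb⟩ := h.exists_other_leaf v
  exact ⟨b, v, hb⟩

lemma exists_mem_ne_zero (h : IsExtremal G T D B x) {t : ℂ} (ht : t ≠ 0) {v : V}
    (hv : deg T v = 1) :
    ∃ y ∈ Module.End.eigenspace (cutMatrix B D t).mulVecLin (x : ℂ), y v ≠ 0 := by
  have := h.nontrivial
  obtain ⟨b, hb, hbv⟩ := h.exists_other_leaf v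
  obtain ⟨y, hy, -, h1, -⟩ := exists_eigenvector_of_two_leaves h.cut.isTree
    (h.cut.hasPattern h.pattern ht) (h.cut.extremal h.pattern h.mult_eq ht).1 hv hb hbv.symm
  exact ⟨y, hy, h1⟩

lemma eq_zero_of_isMajor (h : IsExtremal G T D B x) {t : ℂ} (ht : t ≠ 0) {y : V → ℂ}
    (hy : y ∈ Module.End.eigenspace (cutMatrix B D t).mulVecLin (x : ℂ)) {v : V}
    (hv : IsMajor T v) : y v = 0 := by
  have := h.nontrivial
  exact GraphMult.eq_zero_of_isMajor h.cut.isTree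
    (h.cut.hasPattern h.pattern ht) (h.cut.extremal h.pattern h.mult_eq ht).1 hy hv

lemma coeff_ne_zero (h : IsExtremal G T D B x) {a b : V} (hab : (a, b) ∈ D) : B a b ≠ 0 :=
  (h.pattern a b (h.cut.ne hab)).2 ((h.cut.adj_iff a b).2 (Or.inr (Or.inl hab)))

lemma not_isMajor_snd (h : IsExtremal G T D B x) {a b : V} (hab : (a, b) ∈ D) :
    ¬ IsMajor T b := by
  intro hm
  have := h.leaf a b hab
  unfold IsMajor at hm
  omega

/-- At a major vertex $a$ all eigenvectors vanish, so $t y_a+b_{ab}y_b=0$ would force $y_b=0$ for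
all of them, whereas some eigenvector is non-zero at the leaf $b$. -/
lemma not_isMajor_fst (h : IsExtremal G T D B x) {a b : V} (hab : (a, b) ∈ D) :
    ¬ IsMajor T a := by
  have := h.nontrivial
  intro hm
  obtain ⟨y, hy, hyb⟩ := h.exists_mem_ne_zero one_ne_zero (h.leaf a b hab)
  have h1 := ((h.cut.extremal h.pattern h.mult_eq one_ne_zero).2 y hy).2 a b hab
  rw [h.eq_zero_of_isMajor one_ne_zero hy hm, mul_zero, zero_add] at h1
  exact (mul_ne_zero (h.coeff_ne_zero hab) hyb) h1

/-- The ends of a removed edge are joined in `T` by a path avoiding the major vertices. -/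
lemma reachable (h : IsExtremal G T D B x) {a b : V} (hab : (a, b) ∈ D) :
    (minorPart T).Reachable b a := by
  have := h.nontrivial
  by_contra hne
  have hT := h.cut.isTree
  obtain ⟨W, hW⟩ := hT.connected.exists_walk_length_eq_dist b a
  have hw : ∃ w ∈ W.support, IsMajor T w := by
    by_contra! hno
    exact hne (reachable_of_walk W fun c d hcd hc hd =>
      Adj.reachable ⟨hcd, hno c hc, hno d hd⟩)
  obtain ⟨w, hwW, hw⟩ := hw
  have hbet : Below T b w a := by
    classical
    unfold Below
    have h1 := dist_le (W.takeUntil w hwW)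
    have h2 := dist_le (W.dropUntil w hwW)
    have h3 := congrArg Walk.length (W.take_spec hwW)
    rw [Walk.length_append] at h3
    have h4 := hT.connected.dist_triangle (u := b) (v := w) (w := a)
    omega
  obtain ⟨h1, h2⟩ := h.cut.extremal h.pattern h.mult_eq one_ne_zero
  -- A major vertex between $b$ and $a$ permits an eigenvector with $y_b\ne 0=y_a$, against $t
  -- y_a+b_{ab}y_b=0$.
  obtain ⟨y, hy, hyb, hya⟩ := exists_ne_zero_eq_zero_of_between hT
    (h.cut.hasPattern h.pattern one_ne_zero) h1 (h.leaf a b hab) hw hbet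
  have h3 := (h2 y hy).2 a b hab
  rw [hya, mul_zero, zero_add] at h3
  exact (mul_ne_zero (h.coeff_ne_zero hab) hyb) h3

/-- Two leaves in one block have no major vertex between them; the tree would then be a path, but it
has at least three leaves. -/
lemma leaf_unique (h : IsExtremal G T D B x) {a b : V} (ha : deg T a = 1) (hb : deg T b = 1)
    (hab : (minorPart T).Reachable a b) : a = b := by
  by_contra hne
  have hT := h.cut.isTree
  have hma : ¬ IsMajor T a := by
    unfold IsMajor
    omega
  have key : ∀ c, (minorPart T).Reachable a c → ∀ z, Below T a z c → ¬ IsMajor T z := by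
    intro c hc
    rw [reachable_iff_reflTransGen] at hc
    induction hc with
    | refl =>
      intro z hz
      unfold Below at hz
      rw [dist_self] at hz
      have : a = z := hT.connected.dist_eq_zero_iff.1 (by omega)
      exact this ▸ hma
    | @tail c d _ hcd ih =>
      intro z hz
      rcases adj_cases hT a hcd.1 with h1 | h1
      · by_cases e : z = d
        · exact e ▸ hcd.2.2
        · exact ih z (hz.parent hT e h1)
      · exact ih z (hz.trans_child hT.connected h1)
  have h3 := h.three_le
  unfold pendentCount at h3
  have h4 : {c | deg T c = 1} ⊆ {a, b} := fun c hc =>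
    leaf_eq_of_between hT ha hc hb hne (key b hab)
  have h5 := Set.ncard_le_ncard h4 (Set.toFinite _)
  have h6 : ({a, b} : Set V).ncard ≤ 2 :=
    (Set.ncard_insert_le a {b}).trans (by rw [Set.ncard_singleton])
  omega

lemma snd_unique (h : IsExtremal G T D B x) {a b c : V} (hab : (a, b) ∈ D) (hc : deg T c = 1)
    (hac : (minorPart T).Reachable a c) : c = b :=
  (h.leaf_unique (h.leaf a b hab) hc ((h.reachable hab).trans hac)).symm

/-- A deleted edge brings its leaf into the block, and the block has only one: at most one deleted
edge per block. -/
lemma mem_unique (h : IsExtremal G T D B x) {a b a' b' : V} (hab : (a, b) ∈ D)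
    (hab' : (a', b') ∈ D) (haa : (minorPart T).Reachable a a') : a = a' ∧ b = b' := by
  have e := h.snd_unique hab (h.leaf a' b' hab') (haa.trans (h.reachable hab').symm)
  subst e
  exact ⟨h.inj a a' b' hab hab', rfl⟩

/-- Adjacent vertices of `G`, not major in `T`, lie in the same block. -/
lemma reachable_of_adj (h : IsExtremal G T D B x) {a b : V} (hab : G.Adj a b)
    (ha : ¬ IsMajor T a) (hb : ¬ IsMajor T b) : (minorPart T).Reachable a b := by
  rcases (h.cut.adj_iff a b).1 hab with h1 | h1 | h1
  · exact Adj.reachable ⟨h1, ha, hb⟩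
  · exact (h.reachable h1).symm
  · exact h.reachable h1

lemma adj_of_isMajor (h : IsExtremal G T D B x) {w z : V} (hw : IsMajor T w) (hwz : G.Adj w z) :
    T.Adj w z := by
  rcases (h.cut.adj_iff w z).1 hwz with h1 | h1 | h1
  · exact h1
  · exact absurd hw (h.not_isMajor_fst h1)
  · exact absurd hw (h.not_isMajor_snd h1)

/-- All edges at $w$ are tree edges. In a walk of $G$ avoiding one of them, each deleted edge can be
replaced by a route inside a block, which misses $w$; a detour in $T$ would result, although every
edge of $T$ is a bridge. -/
lemma not_isCycleVertex (h : IsExtremal G T D B x) {w : V} (hw : IsMajor T w) :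
    ¬ IsCycleVertex G w := by
  rw [isCycleVertex_iff]
  rintro ⟨z, hwz, hb⟩
  have hT := h.adj_of_isMajor hw hwz
  rw [isBridge_iff, not_not] at hb
  refine isAcyclic_iff_forall_adj_isBridge.1 h.cut.isTree.isAcyclic hT ?_
  have hle : minorPart T ≤ T.deleteEdges {s(w, z)} := by
    intro c d hcd
    rw [deleteEdge_adj]
    refine ⟨hcd.1, ?_, ?_⟩
    · rintro ⟨rfl, rfl⟩
      exact hcd.2.1 hw
    · rintro ⟨rfl, rfl⟩
      exact hcd.2.2 hw
  refine reachable_of_reachable hb fun c d hcd => ?_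
  rw [deleteEdge_adj, h.cut.adj_iff] at hcd
  obtain ⟨h1 | h1 | h1, h2⟩ := hcd
  · exact Adj.reachable (deleteEdge_adj.2 ⟨h1, h2⟩)
  · exact (h.reachable h1).symm.mono hle
  · exact (h.reachable h1).mono hle

/-- In $T$ the vertex $a$ has degree exactly $2$: it is not major, and the only leaf of its block is
$b$. The deleted edge $ab$ is the only one to be added back at $a$. -/
lemma deg_fst (h : IsExtremal G T D B x) {a b : V} (hab : (a, b) ∈ D) : deg G a = 3 := by
  have := h.nontrivial
  have h1 : G.neighborSet a = insert b (T.neighborSet a) := by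
    ext z
    rw [mem_neighborSet, h.cut.adj_iff, Set.mem_insert_iff, mem_neighborSet]
    constructor
    · rintro (h1 | h1 | h1)
      · exact Or.inr h1
      · exact Or.inl (h.mem_unique hab h1 (Reachable.refl _)).2.symm
      · exact absurd (h.snd_unique hab (h.leaf z a h1) (Reachable.refl _)) (h.cut.ne hab)
    · rintro (rfl | h1)
      · exact Or.inr (Or.inl hab)
      · exact Or.inl h1
  have h2 : deg T a ≠ 1 := fun h2 =>
    h.cut.ne hab (h.snd_unique hab h2 (Reachable.refl _))
  have h3 := h.not_isMajor_fst hab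
  obtain ⟨z, hz⟩ := h.cut.isTree.connected.preconnected.exists_adj_of_nontrivial a
  have h4 := one_le_deg hz
  unfold IsMajor at h3
  have h5 : b ∉ T.neighborSet a := h.cut.not_adj a b hab
  have h6 := Set.ncard_insert_of_notMem h5 (Set.toFinite _)
  unfold deg at *
  rw [h1, h6]
  omega

/-- A leaf of $T$ regains at most one edge, by `inj`; other vertices regain an edge only as first
ends. -/
lemma deg_le_two (h : IsExtremal G T D B x) {z : V} (hz : ¬ IsMajor T z)
    (hD : ∀ b, (z, b) ∉ D) : deg G z ≤ 2 := by
  unfold IsMajor at hz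
  by_cases hb : ∃ a, (a, z) ∈ D
  · obtain ⟨a, ha⟩ := hb
    have h1 : G.neighborSet z ⊆ insert a (T.neighborSet z) := by
      intro w hw
      rcases (h.cut.adj_iff z w).1 hw with h1 | h1 | h1
      · exact Or.inr h1
      · exact absurd h1 (hD w)
      · exact Or.inl (h.inj w a z h1 ha)
    have h2 := Set.ncard_le_ncard h1 (Set.toFinite _)
    have h3 := Set.ncard_insert_le a (T.neighborSet z)
    have h4 := h.leaf a z ha
    unfold deg at *
    omega
  · have h1 : G.neighborSet z ⊆ T.neighborSet z := by
      intro w hw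
      rcases (h.cut.adj_iff z w).1 hw with h1 | h1 | h1
      · exact h1
      · exact absurd h1 (hD w)
      · exact absurd ⟨w, h1⟩ hb
    have h2 := Set.ncard_le_ncard h1 (Set.toFinite _)
    unfold deg at *
    omega

lemma exists_mem_of_isMajor (h : IsExtremal G T D B x) {z : V} (hz : IsMajor G z)
    (hT : ¬ IsMajor T z) : ∃ b, (z, b) ∈ D := by
  by_contra! hne
  have := h.deg_le_two hT hne
  unfold IsMajor at hz
  omega

lemma nonCycleMajor_eq (h : IsExtremal G T D B x) : nonCycleMajor G = {w | IsMajor T w} := by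
  ext w
  constructor
  · rintro ⟨h1, h2⟩
    by_contra hT
    obtain ⟨b, hb⟩ := h.exists_mem_of_isMajor h1 hT
    refine h2 (isCycleVertex_iff.2 ⟨b, (h.cut.adj_iff w b).2 (Or.inr (Or.inl hb)), ?_⟩)
    rw [isBridge_iff, not_not]
    exact reachable_deleteEdge_of_isCut h.cut hb
  · intro hw
    exact ⟨le_trans hw (deg_mono h.le w), h.not_isCycleVertex hw⟩

/-- A cycle avoids the major vertices of $T$, so it stays in one block, and it must use the deleted
edge of that block. The first end of this edge is the only major vertex of $G$ there. -/
lemma exists_unique_major_of_isCycle (h : IsExtremal G T D B x) {u : V} (c : G.Walk u u)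
    (hc : c.IsCycle) :
    ∃ w ∈ c.support, deg G w = 3 ∧ ∀ z ∈ c.support, IsMajor G z → z = w := by
  classical
  have hm : ∀ z ∈ c.support, ¬ IsMajor T z := fun z hz hm =>
    h.not_isCycleVertex hm (isCycleVertex_of_mem_support hc hz)
  have hr : ∀ z ∈ c.support, (minorPart T).Reachable u z := by
    intro z hz
    refine reachable_of_walk (c.takeUntil z hz) fun a b hab ha hb => ?_
    exact h.reachable_of_adj hab (hm a (c.support_takeUntil_subset_support hz ha))
      (hm b (c.support_takeUntil_subset_support hz hb))
  have hD : ∃ a b, (a, b) ∈ D ∧ a ∈ c.support := by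
    by_contra! hne
    have hT : ∀ e ∈ c.edges, e ∈ T.edgeSet := by
      intro e he
      induction e with
      | h a b =>
        have hab := c.adj_of_mem_edges he
        rcases (h.cut.adj_iff a b).1 hab with h1 | h1 | h1
        · exact h1
        · exact absurd (c.fst_mem_support_of_mem_edges he) (hne a b h1)
        · exact absurd (c.snd_mem_support_of_mem_edges he) (hne b a h1)
    exact h.cut.isTree.isAcyclic _ (hc.transfer hT)
  obtain ⟨a, b, hab, ha⟩ := hD
  refine ⟨a, ha, h.deg_fst hab, fun z hz hzm => ?_⟩
  obtain ⟨b', hb'⟩ := h.exists_mem_of_isMajor hzm (hm z hz)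
  exact (h.mem_unique hab hb' ((hr a ha).symm.trans (hr z hz))).1.symm

lemma not_adj_of_isMajor (h : IsExtremal G T D B x) {u v : V} (hu : IsMajor T u)
    (hv : IsMajor T v) : ¬ G.Adj u v := by
  intro huv
  have := h.nontrivial
  obtain ⟨y, hy, h1⟩ := exists_ne_zero_of_adj h.cut.isTree
    (h.cut.hasPattern h.pattern one_ne_zero)
    (h.cut.extremal h.pattern h.mult_eq one_ne_zero).1 (h.adj_of_isMajor hu huv)
  rcases h1 with h1 | h1
  · exact h1 (h.eq_zero_of_isMajor one_ne_zero hy hu)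
  · exact h1 (h.eq_zero_of_isMajor one_ne_zero hy hv)

end IsExtremal

/-! ### Blocks as induced subgraphs, and form (b) -/

namespace IsExtremal

variable [Fintype V] {G T : SimpleGraph V} {D : Finset (V × V)} {B : Matrix V V ℂ} {x : ℝ}
  {P : Set V}

lemma induce_eq (h : IsExtremal G T D B x)
    (hD : ∀ a b, (a, b) ∈ D → b ∉ P) : G.induce P = T.induce P := by
  ext a b
  rw [induce_adj, induce_adj, h.cut.adj_iff]
  constructor
  · rintro (h1 | h1 | h1)
    · exact h1
    · exact absurd b.2 (hD _ _ h1)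
    · exact absurd a.2 (hD _ _ h1)
  · exact Or.inl

lemma isPathGraph_induce (h : IsExtremal G T D B x) (hP : IsBlock T P)
    (hD : ∀ a b, (a, b) ∈ D → b ∉ P) : IsPathGraph (G.induce P) ∧ (G.induce P).IsTree := by
  rw [h.induce_eq hD]
  have hT := hP.isTree_induce h.cut.isTree
  exact ⟨isPathGraph_of_isTree hT hP.induce_not_isMajor, hT⟩

/-- Eigenvectors of the tree restrict to eigenvectors on the blocks. -/
lemma restrict_mem (h : IsExtremal G T D B x) (hP : IsBlock T P) [Fintype P] {t : ℂ} (ht : t ≠ 0)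
    {y : V → ℂ} (hy : y ∈ Module.End.eigenspace (cutMatrix B D t).mulVecLin (x : ℂ)) :
    (fun z : P => y z) ∈ Module.End.eigenspace (principal B P).mulVecLin (x : ℂ) := by
  have := h.nontrivial
  have h1 := ((h.cut.extremal h.pattern h.mult_eq ht).2 y hy).1
  refine restrict_mem_eigenspace h.pattern h1 fun z hz w hw hzw => ?_
  refine h.eq_zero_of_isMajor ht hy ?_
  by_contra hm
  exact hw (hP.mem_of_reachable hz (h.reachable_of_adj hzw (hP.not_isMajor hz) hm))

/-- On any edge at a vertex of the block some eigenvector is non-zero at an end. If the other end is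
outside the block it is major, and the value there is zero. -/
lemma isEigenvalueOn (h : IsExtremal G T D B x) (hP : IsBlock T P) : IsEigenvalueOn B P x := by
  classical
  have := h.nontrivial
  obtain ⟨z, hz⟩ := hP.nonempty
  obtain ⟨w, hzw⟩ := h.cut.isTree.connected.preconnected.exists_adj_of_nontrivial z
  obtain ⟨y, hy, h1⟩ := exists_ne_zero_of_adj h.cut.isTree
    (h.cut.hasPattern h.pattern one_ne_zero)
    (h.cut.extremal h.pattern h.mult_eq one_ne_zero).1 hzw
  have h2 : ∃ v ∈ P, y v ≠ 0 := by
    rcases h1 with h1 | h1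
    · exact ⟨z, hz, h1⟩
    · refine ⟨w, hP.mem_of_adj hz hzw fun hm => ?_, h1⟩
      exact h1 (h.eq_zero_of_isMajor one_ne_zero hy hm)
  obtain ⟨v, hv, hyv⟩ := h2
  unfold IsEigenvalueOn IsEigenvalue
  exact Module.End.hasEigenvalue_of_hasEigenvector
    ⟨h.restrict_mem hP one_ne_zero hy, fun e => hyv (congrFun e ⟨v, hv⟩)⟩

lemma isCut_induce (h : IsExtremal G T D B x) (hP : IsBlock T P) {a b : V} (hab : (a, b) ∈ D)
    (ha : a ∈ P) (hb : b ∈ P) : IsCut (G.induce P) (T.induce P) {(⟨a, ha⟩, ⟨b, hb⟩)} := by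
  have key : ∀ c d : P, ((c : V), (d : V)) ∈ D ↔ (c, d) ∈ ({(⟨a, ha⟩, ⟨b, hb⟩)} : Finset (P × P)) := by
    intro c d
    rw [Finset.mem_singleton, Prod.mk.injEq, Subtype.ext_iff, Subtype.ext_iff]
    constructor
    · intro hcd
      have := h.mem_unique hcd hab (hP.reachable c.2 ha)
      exact this
    · rintro ⟨h1, h2⟩
      rw [h1, h2]
      exact hab
  refine ⟨hP.isTree_induce h.cut.isTree, fun c d => ?_, fun c d hcd => ?_, fun c d hcd hdc => ?_⟩
  · rw [induce_adj, induce_adj, h.cut.adj_iff, key, key]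
  · rw [← key] at hcd
    exact h.cut.not_adj _ _ hcd
  · rw [← key] at hcd hdc
    exact h.cut.not_mem _ _ hcd hdc

/-- The block is a path plus the edge $ab$. Of the at most two ends of the path, $b$ ceases to be
pendent. -/
lemma inU_induce (h : IsExtremal G T D B x) (hP : IsBlock T P) {a b : V} (hab : (a, b) ∈ D)
    (ha : a ∈ P) (hb : b ∈ P) : InU (G.induce P) := by
  have hc := h.isCut_induce hP hab ha hb
  obtain ⟨h1, h2⟩ := cyclomatic_of_isCut_singleton hc
  refine ⟨h1, h2, ?_⟩
  have hne : (⟨a, ha⟩ : P) ≠ ⟨b, hb⟩ := fun e => h.cut.ne hab (congrArg Subtype.val e)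
  have : Nontrivial P := ⟨_, _, hne⟩
  have hadj : (G.induce P).Adj ⟨b, hb⟩ ⟨a, ha⟩ := (hc.adj_iff _ _).2 (by simp)
  have hle : T.induce P ≤ G.induce P := fun c d hcd => (hc.adj_iff c d).2 (Or.inl hcd)
  have hnb : ∀ z : P, ∃ w, (T.induce P).Adj z w := fun z =>
    hc.isTree.connected.preconnected.exists_adj_of_nontrivial z
  have hb2 : 2 ≤ deg (G.induce P) ⟨b, hb⟩ := by
    obtain ⟨w, hw⟩ := hnb ⟨b, hb⟩
    refine two_le_deg hadj (hle hw) ?_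
    rintro rfl
    exact hc.not_adj _ _ (Finset.mem_singleton_self _) hw.symm
  have hb1 : deg (T.induce P) ⟨b, hb⟩ = 1 := by
    obtain ⟨w, hw⟩ := hnb ⟨b, hb⟩
    refine le_antisymm ?_ (one_le_deg hw)
    exact (deg_induce_le T P ⟨b, hb⟩).trans (h.leaf a b hab).le
  have hsub : {z | deg (G.induce P) z = 1} ⊆ {z | deg (T.induce P) z = 1} \ {⟨b, hb⟩} := by
    intro z hz
    have hz1 : deg (G.induce P) z = 1 := hz
    refine ⟨?_, ?_⟩
    · obtain ⟨w, hw⟩ := hnb z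
      exact le_antisymm ((deg_mono hle z).trans hz1.le) (one_le_deg hw)
    · rintro rfl
      omega
  have h3 := Set.ncard_le_ncard hsub (Set.toFinite _)
  have h4 := Set.ncard_sdiff_singleton_add_one (s := {z | deg (T.induce P) z = 1}) hb1
    (Set.toFinite _)
  have h5 := pendentCount_le_two hc.isTree hP.induce_not_isMajor
  unfold pendentCount at *
  omega

/-- Tree eigenvectors $y$ for $t=1$ and $z$ for $t=-1$, non-zero at $b$, satisfy $y_a=-b_{ab}y_b$
and $z_a=b_{ab}z_b$. Their restrictions to $\{a,b\}$ are already independent. -/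
lemma multOn_eq_two (h : IsExtremal G T D B x) (hP : IsBlock T P) {a b : V} (hab : (a, b) ∈ D)
    (ha : a ∈ P) (hb : b ∈ P) : multOn B P x = 2 := by
  classical
  have := h.nontrivial
  refine le_antisymm ((h.inU_induce hP hab ha hb).mult_le_two (h.pattern.principal P) x) ?_
  obtain ⟨y, hy, hyb⟩ := h.exists_mem_ne_zero one_ne_zero (h.leaf a b hab)
  have hn : (-1 : ℂ) ≠ 0 := by norm_num
  obtain ⟨z, hz, hzb⟩ := h.exists_mem_ne_zero hn (h.leaf a b hab)
  have e1 := ((h.cut.extremal h.pattern h.mult_eq one_ne_zero).2 y hy).2 a b hab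
  have e2 := ((h.cut.extremal h.pattern h.mult_eq hn).2 z hz).2 a b hab
  unfold multOn mult
  refine two_le_finrank (h.restrict_mem hP one_ne_zero hy) (h.restrict_mem hP hn hz) ?_
  intro c d hcd
  have ea : c * y a + d * z a = 0 := congrFun hcd ⟨a, ha⟩
  have eb : c * y b + d * z b = 0 := congrFun hcd ⟨b, hb⟩
  have hB := h.coeff_ne_zero hab
  have e3 : c * (B a b * y b) - d * (B a b * z b) = 0 := by
    linear_combination -ea + c * e1 - d * e2
  have e4 : B a b * y b * c = 0 := by
    linear_combination (e3 + B a b * eb) / 2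
  have hc : c = 0 := (mul_eq_zero.1 e4).resolve_left (mul_ne_zero hB hyb)
  refine ⟨hc, ?_⟩
  rw [hc, zero_mul, zero_add] at eb
  exact (mul_eq_zero.1 eb).resolve_right hzb

lemma mem_nonCycleMajor (h : IsExtremal G T D B x) (w : V) :
    w ∈ nonCycleMajor G ↔ IsMajor T w := by
  rw [h.nonCycleMajor_eq]
  rfl

lemma mem_compSet (h : IsExtremal G T D B x) (z : ↥(nonCycleMajor G)ᶜ) (w : V) :
    w ∈ compSet G ((reduced G).connectedComponentMk z) ↔ (minorPart T).Reachable z w := by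
  have hm : ∀ w, w ∈ (nonCycleMajor G)ᶜ ↔ ¬ IsMajor T w := fun w =>
    not_congr (h.mem_nonCycleMajor w)
  constructor
  · rintro ⟨w', hw', rfl⟩
    rw [ConnectedComponent.mem_supp_iff, ConnectedComponent.eq] at hw'
    obtain ⟨W⟩ := hw'.symm
    induction W with
    | nil => exact Reachable.refl _
    | @cons a b c hab W ih =>
      have h1 := h.reachable_of_adj (a := a) (b := b) hab ((hm _).1 a.2) ((hm _).1 b.2)
      exact h1.trans (ih W.reachable.symm)
  · rintro ⟨W⟩
    have key : ∀ (a b : V) (_ : (minorPart T).Walk a b) (ha : a ∈ (nonCycleMajor G)ᶜ),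
        ∃ hb : b ∈ (nonCycleMajor G)ᶜ, (reduced G).Reachable ⟨a, ha⟩ ⟨b, hb⟩ := by
      intro a b W
      induction W with
      | nil => exact fun ha => ⟨ha, Reachable.refl _⟩
      | @cons a c b hac _ ih =>
        intro ha
        obtain ⟨hb, hr⟩ := ih ((hm c).2 hac.2.2)
        refine ⟨hb, Reachable.trans (Adj.reachable ?_) hr⟩
        exact h.le hac.1
    obtain ⟨hb, hr⟩ := key z w W z.2
    refine ⟨⟨w, hb⟩, ?_, rfl⟩
    rw [ConnectedComponent.mem_supp_iff, ConnectedComponent.eq]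
    exact hr.symm

lemma isBlock_compSet (h : IsExtremal G T D B x) (c : (reduced G).ConnectedComponent) :
    IsBlock T (compSet G c) := by
  induction c using ConnectedComponent.ind with
  | h z =>
    refine ⟨z, ?_, ?_⟩
    · exact fun hm => z.2 ((h.mem_nonCycleMajor _).2 hm)
    · ext w
      exact h.mem_compSet z w

lemma fst_mem (h : IsExtremal G T D B x) (hP : IsBlock T P) {a b : V} (hab : (a, b) ∈ D)
    (hb : b ∈ P) : a ∈ P :=
  hP.mem_of_reachable hb (h.reachable hab)

theorem formB (h : IsExtremal G T D B x) (hD : (D.card : ℤ) = cyclomatic G) : FormB G B x := by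
  have hm := h.mem_nonCycleMajor
  refine ⟨fun u c hc => h.exists_unique_major_of_isCycle c hc, ?_, ?_, ?_⟩
  · intro u hu v hv
    exact h.not_adj_of_isMajor ((hm u).1 hu) ((hm v).1 hv)
  · intro c
    have hP := h.isBlock_compSet c
    by_cases hc : ∃ a b, (a, b) ∈ D ∧ b ∈ compSet G c
    · obtain ⟨a, b, hab, hb⟩ := hc
      have ha := h.fst_mem hP hab hb
      exact Or.inl ⟨h.inU_induce hP hab ha hb, h.multOn_eq_two hP hab ha hb⟩
    · push Not at hc
      exact Or.inr ⟨(h.isPathGraph_induce hP hc).1, h.isEigenvalueOn hP⟩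
  · rw [← hD]
    have hmem : ∀ p : D, p.1.2 ∈ (nonCycleMajor G)ᶜ := fun p hp =>
      h.not_isMajor_snd (a := p.1.1) p.2 ((hm _).1 hp)
    have hcomp : ∀ p : D, p.1.2 ∈
        compSet G ((reduced G).connectedComponentMk ⟨p.1.2, hmem p⟩) := fun p =>
      (h.mem_compSet _ _).2 (Reachable.refl _)
    -- A component without a deleted edge is a tree and has cyclomatic number $0$, so the components
    -- in $\mathcal U$ correspond to the deleted edges.
    let f : D → {c : (reduced G).ConnectedComponent // InU (G.induce (compSet G c))} := fun p =>
      ⟨(reduced G).connectedComponentMk ⟨p.1.2, hmem p⟩,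
        h.inU_induce (h.isBlock_compSet _) (a := p.1.1) (b := p.1.2) p.2
          (h.fst_mem (h.isBlock_compSet _) p.2 (hcomp p)) (hcomp p)⟩
    have hf : Function.Bijective f := by
      constructor
      · rintro ⟨⟨a, b⟩, hp⟩ ⟨⟨a', b'⟩, hq⟩ hpq
        have e : (reduced G).connectedComponentMk _ = (reduced G).connectedComponentMk _ :=
          congrArg Subtype.val hpq
        have h1 := hcomp ⟨(a', b'), hq⟩
        rw [← e, h.mem_compSet] at h1
        have h2 := h.mem_unique hp hq ((h.reachable hp).symm.trans (h1.trans (h.reachable hq)))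
        exact Subtype.ext (Prod.ext h2.1 h2.2)
      · rintro ⟨c, hc⟩
        have hP := h.isBlock_compSet c
        by_cases hD' : ∃ a b, (a, b) ∈ D ∧ b ∈ compSet G c
        · obtain ⟨a, b, hab, hb⟩ := hD'
          refine ⟨⟨(a, b), hab⟩, Subtype.ext ?_⟩
          obtain ⟨w, hw, rfl⟩ := hb
          exact hw
        · push Not at hD'
          have h1 := (isTree_iff_cyclomatic.1 (h.isPathGraph_induce hP hD').2).2
          have h2 := hc.2.1
          omega
    rw [← Nat.card_eq_of_bijective f hf, Nat.card_eq_fintype_card, Fintype.card_coe]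

end IsExtremal

/-! ### Bicyclic graphs without pendent vertices -/

lemma exists_segment {G : SimpleGraph V} {g : ℕ → V} {n : ℕ}
    (hadj : ∀ i < n, G.Adj (g i) (g (i + 1)))
    (hinj : ∀ i j, i ≤ n → j ≤ n → g i = g j → i = j) {i j : ℕ} (hij : i ≤ j) (hj : j ≤ n) :
    ∃ W : G.Walk (g i) (g j), W.IsPath ∧ W.length = j - i ∧
      (∀ v, v ∈ W.support ↔ ∃ t, i ≤ t ∧ t ≤ j ∧ g t = v) ∧
      (∀ e, e ∈ W.edges ↔ ∃ t, i ≤ t ∧ t < j ∧ e = s(g t, g (t + 1))) := by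
  induction j, hij using Nat.le_induction with
  | base =>
    refine ⟨Walk.nil, Walk.IsPath.nil, by simp, fun v => ?_, fun e => ?_⟩
    · simp only [Walk.support_nil, List.mem_singleton]
      constructor
      · rintro rfl
        exact ⟨i, le_rfl, le_rfl, rfl⟩
      · rintro ⟨t, h1, h2, rfl⟩
        rw [le_antisymm h1 h2]
    · simp only [Walk.edges_nil, List.not_mem_nil, false_iff]
      rintro ⟨t, h1, h2, -⟩
      omega
  | succ j hij ih =>
    obtain ⟨W, h1, h2, h3, h4⟩ := ih (by omega)
    have ha := hadj j (by omega)
    refine ⟨W.concat ha, ?_, ?_, fun v => ?_, fun e => ?_⟩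
    · refine h1.concat ?_ ha
      rw [h3]
      rintro ⟨t, k1, k2, k3⟩
      have := hinj _ _ (by omega) hj k3
      omega
    · rw [Walk.length_concat, h2]
      omega
    · rw [Walk.support_concat, List.mem_append, List.mem_singleton, h3]
      constructor
      · rintro (⟨t, k1, k2, k3⟩ | rfl)
        · exact ⟨t, k1, by omega, k3⟩
        · exact ⟨j + 1, by omega, le_rfl, rfl⟩
      · rintro ⟨t, k1, k2, k3⟩
        rcases Nat.lt_or_ge j t with h | h
        · have : t = j + 1 := by omega
          subst this
          exact Or.inr k3.symm
        · exact Or.inl ⟨t, k1, h, k3⟩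
    · rw [Walk.edges_concat, List.concat_eq_append, List.mem_append, List.mem_singleton, h4]
      constructor
      · rintro (⟨t, k1, k2, k3⟩ | rfl)
        · exact ⟨t, k1, by omega, k3⟩
        · exact ⟨j, by omega, by omega, rfl⟩
      · rintro ⟨t, k1, k2, k3⟩
        rcases Nat.lt_or_ge t j with h | h
        · exact Or.inl ⟨t, k1, h, k3⟩
        · have : t = j := by omega
          subst this
          exact Or.inr k3

/-- A path with vertices `0, …, n` together with the edges `0j` and `nk`. -/
lemma isInfty_or_isTheta_of_numbering {G : SimpleGraph V} {g : ℕ → V} {n j k : ℕ}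
    (hadj : ∀ i < n, G.Adj (g i) (g (i + 1)))
    (hinj : ∀ i j, i ≤ n → j ≤ n → g i = g j → i = j)
    (hsurj : ∀ v, ∃ i ≤ n, g i = v)
    (hj2 : 2 ≤ j) (hjn : j ≤ n) (hk : k + 2 ≤ n) (hne : ¬ (j = n ∧ k = 0))
    (h0j : G.Adj (g j) (g 0)) (hnk : G.Adj (g k) (g n))
    (hE : ∀ e ∈ G.edgeSet, (∃ t < n, e = s(g t, g (t + 1))) ∨ e = s(g j, g 0) ∨ e = s(g k, g n)) :
    IsInftyGraph G ∨ IsThetaGraph G := by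
  have hinj' : ∀ {a b}, g a = g b → a ≤ n → b ≤ n → a = b := fun h h1 h2 => hinj _ _ h1 h2 h
  rcases Nat.lt_or_ge k j with hkj | hjk
  -- Overlapping chords: the three paths from $k$ to $j$ run directly, through $0$, and through $n$.
  · right
    obtain ⟨P, p1, p2, p3, p4⟩ := exists_segment hadj hinj hkj.le hjn
    obtain ⟨Q, q1, q2, q3, q4⟩ := exists_segment hadj hinj (Nat.zero_le k) (by omega)
    obtain ⟨R, r1, r2, r3, r4⟩ := exists_segment hadj hinj hjn le_rfl
    have q5 : ∀ v, v ∈ (Q.reverse.concat h0j.symm).support ↔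
        (∃ t, t ≤ k ∧ g t = v) ∨ v = g j := fun v => by
      rw [Walk.support_concat, List.mem_append, List.mem_singleton, Walk.support_reverse, List.mem_reverse, q3]
      simp
    have r5 : ∀ v, v ∈ (Walk.cons hnk R.reverse).support ↔
        v = g k ∨ ∃ t, j ≤ t ∧ t ≤ n ∧ g t = v := fun v => by
      rw [Walk.support_cons, List.mem_cons, Walk.support_reverse, List.mem_reverse, r3]
    refine ⟨g k, g j, P, Q.reverse.concat h0j.symm, Walk.cons hnk R.reverse, ?_, p1, ?_, ?_,
      ?_, ?_, ?_, ?_, ?_, ?_, ?_, ?_⟩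
    · intro h
      have := hinj' h (by omega) hjn
      omega
    · refine q1.reverse.concat ?_ _
      rw [Walk.support_reverse, List.mem_reverse, q3]
      rintro ⟨t, k1, k2, k3⟩
      have := hinj' k3 (by omega) hjn
      omega
    · rw [Walk.cons_isPath_iff]
      refine ⟨r1.reverse, ?_⟩
      rw [Walk.support_reverse, List.mem_reverse, r3]
      rintro ⟨t, k1, k2, k3⟩
      have := hinj' k3 (by omega) (by omega)
      omega
    · intro w hP hQ
      rw [p3] at hP
      rw [q5] at hQ
      obtain ⟨t, k1, k2, rfl⟩ := hP
      rcases hQ with ⟨s, l1, l2⟩ | hQ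
      · have := hinj' l2 (by omega) (by omega)
        left
        rw [show t = k by omega]
      · exact Or.inr hQ
    · intro w hP hR
      rw [p3] at hP
      rw [r5] at hR
      obtain ⟨t, k1, k2, rfl⟩ := hP
      rcases hR with hR | ⟨s, l1, l2, l3⟩
      · exact Or.inl hR
      · have := hinj' l3 (by omega) (by omega)
        right
        rw [show t = j by omega]
    · intro w hQ hR
      rw [q5] at hQ
      rw [r5] at hR
      rcases hR with hR | ⟨s, l1, l2, rfl⟩
      · exact Or.inl hR
      · rcases hQ with ⟨t, k1, k2⟩ | hQ
        · have := hinj' k2 (by omega) (by omega)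
          omega
        · exact Or.inr hQ
    -- The lengths are $j-k$, $k+1$ and $n-j+1$. Two of them being $1$ is excluded in turn by $j\ge
    -- 2$, by $k+2\le n$, and by `hne`.
    · rw [p2, Walk.length_concat, Walk.length_reverse, q2]
      omega
    · rw [p2, Walk.length_cons, Walk.length_reverse, r2]
      omega
    · rw [Walk.length_concat, Walk.length_reverse, q2, Walk.length_cons, Walk.length_reverse, r2]
      omega
    · intro w
      obtain ⟨t, ht, rfl⟩ := hsurj w
      rw [p3, q5, r5]
      rcases Nat.lt_or_ge t k with h1 | h1
      · exact Or.inr (Or.inl (Or.inl ⟨t, h1.le, rfl⟩))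
      rcases Nat.lt_or_ge t j with h2 | h2
      · exact Or.inl ⟨t, h1, h2.le, rfl⟩
      · exact Or.inr (Or.inr (Or.inr ⟨t, h2, ht, rfl⟩))
    · intro e he
      rw [p4, Walk.edges_concat, List.concat_eq_append, List.mem_append, List.mem_singleton, Walk.edges_cons, List.mem_cons,
        Walk.edges_reverse, Walk.edges_reverse, List.mem_reverse, List.mem_reverse, q4, r4]
      rcases hE e he with ⟨t, ht, h⟩ | h | h
      · rcases Nat.lt_or_ge t k with h1 | h1
        · exact Or.inr (Or.inl (Or.inl ⟨t, by omega, h1, h⟩))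
        rcases Nat.lt_or_ge t j with h2 | h2
        · exact Or.inl ⟨t, h1, h2, h⟩
        · exact Or.inr (Or.inr (Or.inr ⟨t, h2, ht, h⟩))
      · exact Or.inr (Or.inl (Or.inr (h.trans Sym2.eq_swap)))
      · exact Or.inr (Or.inr (Or.inl h))
  -- Separated chords: the cycles are $0,\dots,j$ and $k,\dots,n$, joined by the segment from $j$ to
  -- $k$, which is trivial when $j=k$.
  · left
    obtain ⟨C, c1, c2, c3, c4⟩ := exists_segment hadj hinj (Nat.zero_le j) hjn
    obtain ⟨P, p1, p2, p3, p4⟩ := exists_segment hadj hinj hjk (by omega)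
    obtain ⟨D, d1, d2, d3, d4⟩ := exists_segment hadj hinj (show k ≤ n by omega) le_rfl
    have c5 : ∀ v, v ∈ (Walk.cons h0j C).support ↔ ∃ t, t ≤ j ∧ g t = v := fun v => by
      rw [Walk.support_cons, List.mem_cons, c3]
      constructor
      · rintro (rfl | ⟨t, -, h1, h2⟩)
        · exact ⟨j, le_rfl, rfl⟩
        · exact ⟨t, h1, h2⟩
      · rintro ⟨t, h1, h2⟩
        exact Or.inr ⟨t, by omega, h1, h2⟩
    have d5 : ∀ v, v ∈ (Walk.cons hnk D.reverse).support ↔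
        ∃ t, k ≤ t ∧ t ≤ n ∧ g t = v := fun v => by
      rw [Walk.support_cons, List.mem_cons, Walk.support_reverse, List.mem_reverse, d3]
      constructor
      · rintro (rfl | h)
        · exact ⟨k, le_rfl, by omega, rfl⟩
        · exact h
      · exact Or.inr
    refine ⟨g j, g k, Walk.cons h0j C, Walk.cons hnk D.reverse, P, ?_, ?_, p1, ?_, ?_, ?_, ?_, ?_⟩
    · rw [Walk.cons_isCycle_iff]
      refine ⟨c1, ?_⟩
      rw [c4]
      rintro ⟨t, -, h1, h2⟩
      rw [Sym2.eq_iff] at h2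
      rcases h2 with ⟨h2, -⟩ | ⟨h2, h3⟩
      · have := hinj' h2 (by omega) (by omega)
        omega
      · have := hinj' h2 (by omega) (by omega)
        have := hinj' h3 (by omega) (by omega)
        omega
    · rw [Walk.cons_isCycle_iff]
      refine ⟨d1.reverse, ?_⟩
      rw [Walk.edges_reverse, List.mem_reverse, d4]
      rintro ⟨t, h0, h1, h2⟩
      rw [Sym2.eq_iff] at h2
      rcases h2 with ⟨h2, h3⟩ | ⟨h2, -⟩
      · have := hinj' h2 (by omega) (by omega)
        have := hinj' h3 (by omega) (by omega)
        omega
      · have := hinj' h2 (by omega) (by omega)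
        omega
    · intro v hC hD
      rw [c5] at hC
      rw [d5] at hD
      obtain ⟨t, h1, rfl⟩ := hC
      obtain ⟨s, h2, h3, h4⟩ := hD
      have := hinj' h4 (by omega) (by omega)
      rw [show t = j by omega, show k = j by omega]
      exact ⟨rfl, rfl⟩
    · intro v hC hP
      rw [c5] at hC
      rw [p3] at hP
      obtain ⟨t, h1, rfl⟩ := hC
      obtain ⟨s, h2, h3, h4⟩ := hP
      have := hinj' h4 (by omega) (by omega)
      rw [show t = j by omega]
    · intro v hD hP
      rw [d5] at hD
      rw [p3] at hP
      obtain ⟨t, h1, h1', rfl⟩ := hD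
      obtain ⟨s, h2, h3, h4⟩ := hP
      have := hinj' h4 (by omega) (by omega)
      rw [show t = k by omega]
    · intro v
      obtain ⟨t, ht, rfl⟩ := hsurj v
      rw [c5, d5, p3]
      rcases Nat.lt_or_ge t j with h1 | h1
      · exact Or.inl ⟨t, h1.le, rfl⟩
      rcases Nat.lt_or_ge t k with h2 | h2
      · exact Or.inr (Or.inr ⟨t, h1, h2.le, rfl⟩)
      · exact Or.inr (Or.inl ⟨t, h2, ht, rfl⟩)
    · intro e he
      rw [Walk.edges_cons, List.mem_cons, Walk.edges_cons, List.mem_cons, Walk.edges_reverse,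
        List.mem_reverse, c4, d4, p4]
      rcases hE e he with ⟨t, ht, h⟩ | h | h
      · rcases Nat.lt_or_ge t j with h1 | h1
        · exact Or.inl (Or.inr ⟨t, by omega, h1, h⟩)
        rcases Nat.lt_or_ge t k with h2 | h2
        · exact Or.inr (Or.inr ⟨t, h1, h2, h⟩)
        · exact Or.inr (Or.inl (Or.inr ⟨t, h2, ht, h⟩))
      · exact Or.inl (Or.inl h)
      · exact Or.inr (Or.inl (Or.inl h))

lemma two_le_pendentCount [Finite V] [Nontrivial V] {T : SimpleGraph V} (hT : T.IsTree) :
    2 ≤ pendentCount T := by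
  have : Fintype V := Fintype.ofFinite V
  obtain ⟨r, hr⟩ := exists_leaf hT
  obtain ⟨b, h1, h2, -⟩ := exists_leaf_below hT r r
  exact (Set.one_lt_ncard (Set.toFinite _)).2 ⟨r, hr, b, h2, h1⟩

lemma three_le_pendentCount [Finite V] [Nontrivial V] {T : SimpleGraph V} (hT : T.IsTree) {w : V}
    (hw : IsMajor T w) : 3 ≤ pendentCount T := by
  have : Fintype V := Fintype.ofFinite V
  obtain ⟨r, hr⟩ := exists_leaf hT
  have hrw : r ≠ w := by
    rintro rfl
    unfold IsMajor at hw
    omega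
  obtain ⟨p, hp⟩ := exists_parent hT hrw
  obtain ⟨c, d, hc, hd, hcp, hdp, hcd⟩ := exists_two_adj_ne_of_three_le_deg hw p
  have hc := isChild_of_ne hT hp hc hcp
  have hd := isChild_of_ne hT hp hd hdp
  obtain ⟨b1, h1, h2, h3⟩ := exists_leaf_below hT r c
  obtain ⟨b2, k1, k2, k3⟩ := exists_leaf_below hT r d
  refine (Set.two_lt_ncard (Set.toFinite _)).2 ⟨r, hr, b1, h2, b2, k2, h1, k1, ?_⟩
  rintro rfl
  exact hcd (children_disjoint hT (by rw [hc.2, hd.2]) h3 k3)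

/-- The spanning tree of `exists_isCut` has at most $0+2$ leaves, so it is a path. As $G$ has no
pendent vertex, each end of the path is the second entry of a deleted pair, and this accounts for
both deleted edges. -/
theorem isInfty_or_isTheta [Finite V] {G : SimpleGraph V} (hG : G.Connected)
    (hcyc : cyclomatic G = 2) (hp : pendentCount G = 0) (h2 : ∃ z, deg G z ≠ 2) :
    IsInftyGraph G ∨ IsThetaGraph G := by
  classical
  have : Fintype V := Fintype.ofFinite V
  have hGT : ¬ G.IsTree := fun hT => by
    have := (isTree_iff_cyclomatic.1 hT).2
    omega
  have := nontrivial_of_not_isTree hG hGT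
  obtain ⟨T, D, hc, hD, hl⟩ := exists_isCut hG h2
  have hT := hc.isTree
  have h3 := pendentCount_le_of_leaf hl
  have hnm : ∀ z, ¬ IsMajor T z := fun z hz => by
    have := three_le_pendentCount hT hz
    omega
  have hl' : ∀ b, deg T b = 1 → ∃ a, (a, b) ∈ D := fun b hb => by
    refine (hl b hb).resolve_left fun h => ?_
    have h0 : {v | deg G v = 1} = ∅ := (Set.ncard_eq_zero (Set.toFinite _)).1 hp
    exact h0.le h
  obtain ⟨r, hr⟩ := exists_leaf hT
  obtain ⟨n, f, hf0, hf⟩ := exists_equiv_fin hT hnm hr.le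
  let g : ℕ → V := fun i => f.symm (Fin.ofNat (n + 1) i)
  have hfg : ∀ i, i ≤ n → (f (g i) : ℕ) = i := fun i hi => by
    simp [g, Nat.mod_eq_of_lt (Nat.lt_succ_of_le hi)]
  have hgf : ∀ v, g (f v) = v := fun v => by simp [g]
  have hfle : ∀ v, (f v : ℕ) ≤ n := fun v => Nat.le_of_lt_succ (f v).2
  have hinj : ∀ i j, i ≤ n → j ≤ n → g i = g j → i = j := fun i j hi hj hij => by
    rw [← hfg i hi, ← hfg j hj, hij]
  have hadjT : ∀ i < n, T.Adj (g i) (g (i + 1)) := fun i hi => by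
    rw [hf, hfg i hi.le, hfg (i + 1) hi]
    exact Or.inl rfl
  have hr0 : g 0 = r := by
    have := hgf r
    rwa [hf0] at this
  have hn0 : n ≠ 0 := by
    rintro rfl
    have : Subsingleton V :=
      ⟨fun a b => f.injective (Fin.ext (by have := hfle a; have := hfle b; omega))⟩
    exact not_subsingleton V this
  have hn : deg T (g n) = 1 := by
    rw [deg_eq_one_iff]
    refine ⟨g (n - 1), fun z => ?_⟩
    rw [hf, hfg n le_rfl]
    have h1 := hfle z
    constructor
    · rintro (h | h)
      · omega
      · rw [← hgf z]
        congr 1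
        omega
    · rintro rfl
      rw [hfg _ (by omega)]
      omega
  obtain ⟨u, hu⟩ := hl' r hr
  obtain ⟨w, hw⟩ := hl' _ hn
  have hne : (u, r) ≠ (w, g n) := by
    intro e
    have e2 : g 0 = g n := hr0.trans (Prod.mk.inj e).2
    exact hn0 (hinj _ _ (by omega) le_rfl e2).symm
  have hDeq : ({(u, r), (w, g n)} : Finset (V × V)) = D := by
    refine Finset.eq_of_subset_of_card_le ?_ ?_
    · intro p hp
      rw [Finset.mem_insert, Finset.mem_singleton] at hp
      rcases hp with rfl | rfl
      · exact hu
      · exact hw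
    · rw [Finset.card_pair hne]
      omega
  have hu0 : (f u : ℕ) ≠ 0 := fun e => by
    have h1 := hgf u
    rw [e, hr0] at h1
    exact hc.ne hu h1.symm
  have hu1 : (f u : ℕ) ≠ 1 := fun e => by
    refine hc.not_adj _ _ hu ?_
    rw [hf, hf0, e]
    exact Or.inr rfl
  have hwn : (f w : ℕ) ≠ n := fun e => by
    have h1 := hgf w
    rw [e] at h1
    exact hc.ne hw h1.symm
  have hwn1 : (f w : ℕ) + 1 ≠ n := fun e => by
    refine hc.not_adj _ _ hw ?_
    rw [hf, hfg n le_rfl, e]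
    exact Or.inl rfl
  have h5 := hfle u
  have h6 := hfle w
  refine isInfty_or_isTheta_of_numbering (G := G) (g := g) (n := n) (j := f u) (k := f w)
    (fun i hi => (hc.adj_iff _ _).2 (Or.inl (hadjT i hi))) hinj
    (fun v => ⟨f v, hfle v, hgf v⟩) (by omega) h5 (by omega) ?_ ?_ ?_ ?_
  · rintro ⟨e1, e2⟩
    have h7 := hgf u
    have h8 := hgf w
    rw [e1] at h7
    rw [e2, hr0] at h8
    rw [← h8, h7] at hw
    exact hc.not_mem _ _ hu hw
  · rw [hgf, hr0]
    exact (hc.adj_iff _ _).2 (Or.inr (Or.inl hu))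
  · rw [hgf]
    exact (hc.adj_iff _ _).2 (Or.inr (Or.inl hw))
  · intro e he
    induction e with
    | h a b =>
      rw [hgf, hgf, hr0]
      have key : ∀ a b, (f a : ℕ) + 1 = f b → ∃ t < n, s(a, b) = s(g t, g (t + 1)) := by
        intro a b hab
        refine ⟨f a, ?_, ?_⟩
        · have := hfle b
          omega
        · rw [hab, hgf, hgf]
      have keyD : ∀ a b, (a, b) ∈ D → s(a, b) = s(u, r) ∨ s(a, b) = s(w, g n) := by
        intro a b hab
        rw [← hDeq, Finset.mem_insert, Finset.mem_singleton] at hab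
        rcases hab with h | h
        · left
          rw [(Prod.mk.inj h).1, (Prod.mk.inj h).2]
        · right
          rw [(Prod.mk.inj h).1, (Prod.mk.inj h).2]
      rcases (hc.adj_iff a b).1 he with h | h | h
      · left
        rcases (hf a b).1 h with h | h
        · exact key a b h
        · rw [Sym2.eq_swap]
          exact key b a h
      · exact Or.inr (keyD a b h)
      · right
        rw [Sym2.eq_swap]
        exact keyD b a h

/-! ### Degree sums and deletion of a vertex -/

lemma deg_eq_degree [Fintype V] (G : SimpleGraph V) [DecidableRel G.Adj] (v : V) :
    deg G v = G.degree v := by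
  unfold deg
  rw [Set.ncard_eq_toFinset_card', ← card_neighborFinset_eq_degree]
  rfl

lemma card_edgeSet_eq [Fintype V] (G : SimpleGraph V) [DecidableEq V] [DecidableRel G.Adj] :
    Nat.card G.edgeSet = G.edgeFinset.card := by
  rw [Nat.card_eq_fintype_card, edgeFinset_card]

lemma sum_deg [Fintype V] (G : SimpleGraph V) : ∑ v, deg G v = 2 * Nat.card G.edgeSet := by
  classical
  rw [card_edgeSet_eq, ← sum_degrees_eq_twice_card_edges]
  exact Finset.sum_congr rfl fun v _ => deg_eq_degree G v

lemma card_edgeSet_induce_compl [Fintype V] (G : SimpleGraph V) (v : V) :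
    Nat.card (G.induce {v}ᶜ).edgeSet + deg G v = Nat.card G.edgeSet := by
  classical
  rw [card_edgeSet_eq, card_edgeSet_eq, deg_eq_degree, card_edgeFinset_induce_compl_singleton,
    card_edgeFinset_deleteIncidenceSet]
  exact Nat.sub_add_cancel (G.degree_le_card_edgeFinset v)

lemma card_compl_singleton [Finite V] (v : V) : Nat.card ↥({v}ᶜ : Set V) + 1 = Nat.card V := by
  rw [show Nat.card ↥({v}ᶜ : Set V) = ({v}ᶜ : Set V).ncard from rfl]
  have := Set.ncard_add_ncard_compl {v} (Set.toFinite _)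
  rw [Set.ncard_singleton] at this
  omega

lemma cyclomatic_induce_compl [Fintype V] {G : SimpleGraph V} (hG : G.Connected) {v : V}
    (hv : (G.induce {v}ᶜ).Connected) :
    cyclomatic (G.induce {v}ᶜ) = cyclomatic G + 1 - deg G v := by
  rw [cyclomatic_of_connected hG, cyclomatic_of_connected hv]
  have := card_edgeSet_induce_compl G v
  have := card_compl_singleton v
  omega

lemma deg_induce_compl [Finite V] (G : SimpleGraph V) (v : V) (z : ↥({v}ᶜ : Set V)) :
    deg G z ≤ deg (G.induce {v}ᶜ) z + 1 ∧
      (¬ G.Adj v z → deg G z ≤ deg (G.induce {v}ᶜ) z) := by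
  have h1 : Subtype.val '' (G.induce {v}ᶜ).neighborSet z = G.neighborSet z \ {v} := by
    ext w
    constructor
    · rintro ⟨w', hw', rfl⟩
      exact ⟨hw', w'.2⟩
    · rintro ⟨h1, h2⟩
      exact ⟨⟨w, h2⟩, h1, rfl⟩
  unfold deg
  rw [← Set.ncard_image_of_injective _ Subtype.val_injective, h1]
  constructor
  · have := Set.ncard_le_ncard_sdiff_add_ncard (G.neighborSet z) {v} (Set.toFinite _)
    rwa [Set.ncard_singleton] at this
  · intro h2
    rw [Set.sdiff_singleton_eq_self]
    exact fun h3 => h2 (Adj.symm h3)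

lemma reachable_induce {G : SimpleGraph V} {S : Set V} {a b : V} (p : G.Walk a b)
    (h : ∀ z ∈ p.support, z ∈ S) (ha : a ∈ S) (hb : b ∈ S) :
    (G.induce S).Reachable ⟨a, ha⟩ ⟨b, hb⟩ := by
  induction p with
  | nil => exact Reachable.refl _
  | @cons a c b hac p ih =>
    have hc : c ∈ S := h c (by simp)
    have hac' : (G.induce S).Adj ⟨a, ha⟩ ⟨c, hc⟩ := hac
    refine hac'.reachable.trans (ih (fun z hz => h z ?_) hc hb)
    simp [hz]

/-- The two neighbours of $y$ are joined by the rest of a cycle, and a path from $y$ to any other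
vertex passes through one of them. -/
lemma connected_induce_compl_of_cycleVertex [Finite V] {G : SimpleGraph V} (hG : G.Connected)
    {y : V} (hy : IsCycleVertex G y) (hd : deg G y = 2) : (G.induce {y}ᶜ).Connected := by
  classical
  obtain ⟨a, ha, hb⟩ := isCycleVertex_iff.1 hy
  have hay : a ∈ ({y}ᶜ : Set V) := ha.ne.symm
  have : Nonempty ↥({y}ᶜ : Set V) := ⟨⟨a, hay⟩⟩
  rw [isBridge_iff, not_not] at hb
  obtain ⟨p, hp⟩ := hb.exists_isPath
  obtain ⟨b, hby, hba, hyb, hr⟩ : ∃ b, ∃ hby : b ∈ ({y}ᶜ : Set V), b ≠ a ∧ G.Adj y b ∧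
      (G.induce {y}ᶜ).Reachable ⟨b, hby⟩ ⟨a, hay⟩ := by
    cases p with
    | nil => exact absurd rfl ha.ne
    | @cons _ b _ h q =>
      rw [Walk.cons_isPath_iff] at hp
      rw [deleteEdge_adj] at h
      refine ⟨b, h.1.ne.symm, fun e => h.2.1 ⟨rfl, e⟩, h.1, ?_⟩
      refine reachable_induce (q.mapLe (deleteEdges_le _)) (fun z hz => ?_) _ _
      rw [Walk.support_mapLe_eq_support] at hz
      rintro rfl
      exact hp.2 hz
  have key : ∀ z : ↥({y}ᶜ : Set V), (G.induce {y}ᶜ).Reachable ⟨a, hay⟩ z := by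
    rintro ⟨z, hz⟩
    obtain ⟨q, hq⟩ := hG.exists_isPath y z
    cases q with
    | nil => exact absurd rfl hz
    | @cons _ c _ h q =>
      rw [Walk.cons_isPath_iff] at hq
      have hc : c ∈ ({y}ᶜ : Set V) := h.ne.symm
      have h1 := reachable_induce (S := {y}ᶜ) q (fun w hw => by
        rintro rfl
        exact hq.2 hw) hc hz
      rcases eq_or_eq_of_deg_eq_two hd.le ha hyb h hba.symm with rfl | rfl
      · exact h1
      · exact hr.symm.trans h1
  exact ⟨fun z w => (key z).symm.trans (key w)⟩

lemma multOn_eq [Fintype V] (B : Matrix V V ℂ) (S : Set V) [h : Fintype S] (x : ℝ) :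
    multOn B S x = mult (principal B S) x := by
  unfold multOn
  congr!

/-- Deleting a vertex decreases the multiplicity by at most one. -/
lemma mult_le_multOn_compl [Fintype V] {G : SimpleGraph V} {B : Matrix V V ℂ}
    (hB : HasPattern G B) (v : V) (x : ℝ) : mult B x ≤ multOn B {v}ᶜ x + 1 := by
  classical
  have h1 := (finrank_le_of_inf_ker_le (LinearMap.proj v : (V → ℂ) →ₗ[ℂ] ℂ)
    (Module.End.eigenspace B.mulVecLin (x : ℂ)) _ le_rfl).1
  rw [Module.finrank_self] at h1
  rw [multOn_eq]
  unfold mult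
  refine h1.trans (Nat.add_le_add_right ?_ 1)
  let K := Module.End.eigenspace B.mulVecLin (x : ℂ) ⊓
    LinearMap.ker (LinearMap.proj v : (V → ℂ) →ₗ[ℂ] ℂ)
  let f : K →ₗ[ℂ] Module.End.eigenspace (principal B {v}ᶜ).mulVecLin (x : ℂ) :=
    LinearMap.codRestrict _
      ((LinearMap.funLeft ℂ ℂ (Subtype.val : ↥({v}ᶜ : Set V) → V)).comp K.subtype) (fun y => by
        refine restrict_mem_eigenspace hB y.2.1 fun z _ w hw _ => ?_
        have hwv : w = v := by simpa using hw
        rw [hwv]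
        exact y.2.2)
  refine LinearMap.finrank_le_finrank_of_injective (f := f) ?_
  rw [← LinearMap.ker_eq_bot, LinearMap.ker_eq_bot']
  rintro ⟨y, hy⟩ h0
  apply Subtype.ext
  ext z
  by_cases hz : z = v
  · rw [hz]
    exact hy.2
  · exact congrFun (congrArg Subtype.val h0) ⟨z, hz⟩

/-- In a graph with cyclomatic number `2` and no pendent vertex, deleting a cycle-vertex of degree
`2` next to a major vertex leaves a graph of `𝒰`. -/
lemma inU_induce_compl [Fintype V] {G : SimpleGraph V} (hG : G.Connected)
    (hcyc : cyclomatic G = 2) (h2 : ∀ z, 2 ≤ deg G z) {y w : V} (hy : IsCycleVertex G y)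
    (hd : deg G y = 2) (hyw : G.Adj y w) (hw : IsMajor G w) : InU (G.induce {y}ᶜ) := by
  have hconn := connected_induce_compl_of_cycleVertex hG hy hd
  refine ⟨hconn, ?_, ?_⟩
  · rw [cyclomatic_induce_compl hG hconn, hcyc, hd]
    rfl
  · unfold pendentCount
    rw [Set.ncard_le_one]
    -- A vertex pendent after the deletion was adjacent to $y$, and it is not $w$, whose degree
    -- stays at least $2$. Only one other neighbour of $y$ is left.
    have key : ∀ z : ↥({y}ᶜ : Set V), deg (G.induce {y}ᶜ) z = 1 → G.Adj y z ∧ (z : V) ≠ w := by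
      intro z hz
      have h3 := deg_induce_compl G y z
      have h4 := h2 z
      refine ⟨by_contra fun h5 => ?_, ?_⟩
      · have := h3.2 h5
        omega
      · intro h5
        have h6 := h3.1
        rw [hz, h5] at h6
        unfold IsMajor at hw
        omega
    intro a ha b hb
    obtain ⟨a1, a2⟩ := key a ha
    obtain ⟨b1, b2⟩ := key b hb
    by_contra hne
    have hne' : (a : V) ≠ b := fun e => hne (Subtype.ext e)
    have := three_le_deg hyw a1 b1 a2.symm b2.symm hne'
    omega

/-- Leaves of the tree are former neighbours of $w$, so there are at most three. -/
lemma mult_le_two_of_isTree_induce_compl [Fintype V] {G : SimpleGraph V} {B : Matrix V V ℂ}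
    (hB : HasPattern G B) (h2 : ∀ z, 2 ≤ deg G z) {w : V} (hd : deg G w = 3)
    (hT : (G.induce {w}ᶜ).IsTree) (x : ℝ) : multOn B {w}ᶜ x ≤ 2 := by
  classical
  have h3 : Nontrivial ↥({w}ᶜ : Set V) := by
    obtain ⟨a, ha⟩ := exists_adj_of_one_le_deg (G := G) (v := w) (by omega)
    obtain ⟨b, hb, hba⟩ := exists_adj_ne_of_two_le_deg (G := G) (v := w) (by omega) a
    exact ⟨⟨a, ha.ne.symm⟩, ⟨b, hb.ne.symm⟩, fun e => hba (congrArg Subtype.val e).symm⟩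
  have h4 := mult_lt_pendentCount hT (hB.principal {w}ᶜ) x
  have h5 : pendentCount (G.induce {w}ᶜ) ≤ 3 := by
    unfold pendentCount
    rw [← hd, ← Set.ncard_image_of_injective _ Subtype.val_injective]
    refine Set.ncard_le_ncard ?_ (Set.toFinite _)
    rintro _ ⟨z, hz, rfl⟩
    have hz1 : deg _ z = 1 := hz
    have h6 := deg_induce_compl G w z
    have h7 := h2 z
    by_contra h8
    have := h6.2 h8
    omega
  rw [multOn_eq]
  omega

/-! ### Numerical data of `∞`-graphs and `θ`-graphs -/

lemma card_edgeSet_le_of_cover [Finite V] {G : SimpleGraph V} (L M N : List (Sym2 V))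
    (h : ∀ e ∈ G.edgeSet, e ∈ L ∨ e ∈ M ∨ e ∈ N) :
    Nat.card G.edgeSet ≤ L.length + M.length + N.length := by
  classical
  have h1 : G.edgeSet ⊆ (L.toFinset ∪ M.toFinset ∪ N.toFinset : Finset (Sym2 V)) := by
    intro e he
    simpa [or_assoc] using h e he
  have h2 := Set.ncard_le_ncard h1 (Set.toFinite _)
  rw [Set.ncard_coe_finset] at h2
  have h3 := Finset.card_union_le (L.toFinset ∪ M.toFinset) N.toFinset
  have h4 := Finset.card_union_le L.toFinset M.toFinset
  have h5 := L.toFinset_card_le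
  have h6 := M.toFinset_card_le
  have h7 := N.toFinset_card_le
  rw [show Nat.card G.edgeSet = G.edgeSet.ncard from rfl]
  omega

lemma card_le_of_disjoint [Finite V] [DecidableEq V] {X Y Z : Finset V} (h1 : Disjoint X Y)
    (h2 : Disjoint X Z) (h3 : Disjoint Y Z) : X.card + Y.card + Z.card ≤ Nat.card V := by
  have : Fintype V := Fintype.ofFinite V
  rw [Nat.card_eq_fintype_card, ← Finset.card_union_of_disjoint h1,
    ← Finset.card_union_of_disjoint (Finset.disjoint_union_left.2 ⟨h2, h3⟩)]
  exact Finset.card_le_univ _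

lemma two_le_deg_of_cycleVertex [Finite V] {G : SimpleGraph V} {v : V}
    (h : IsCycleVertex G v) : 2 ≤ deg G v := by
  obtain ⟨a, ha, hb⟩ := isCycleVertex_iff.1 h
  exact two_le_deg_of_nonbridge ha hb

lemma two_le_deg_of_isPath [Finite V] {G : SimpleGraph V} {a b v : V} {p : G.Walk a b}
    (hp : p.IsPath) (hv : v ∈ p.support) (ha : v ≠ a) (hb : v ≠ b) : 2 ≤ deg G v := by
  rw [Walk.mem_support_iff_exists_getVert] at hv
  obtain ⟨i, rfl, hi⟩ := hv
  have hi0 : i ≠ 0 := by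
    rintro rfl
    simp at ha
  have hil : i ≠ p.length := by
    rintro rfl
    simp at hb
  have h1 := p.adj_getVert_succ (i := i) (by omega)
  have h2 := p.adj_getVert_succ (i := i - 1) (by omega)
  rw [Nat.sub_add_cancel (by omega)] at h2
  refine two_le_deg h1 h2.symm fun e => ?_
  have := hp.getVert_injOn (by rw [Set.mem_ofPred]; omega) (by rw [Set.mem_ofPred]; omega) e
  omega

lemma card_support_of_isPath [DecidableEq V] {G : SimpleGraph V} {a b : V} {p : G.Walk a b}
    (hp : p.IsPath) : p.support.toFinset.card = p.length + 1 := by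
  rw [List.toFinset_card_of_nodup hp.support_nodup, Walk.length_support]

lemma card_tail_support [DecidableEq V] {G : SimpleGraph V} {a b : V} {p : G.Walk a b}
    (hp : p.support.tail.Nodup) : p.support.tail.toFinset.card = p.length := by
  rw [List.toFinset_card_of_nodup hp, List.length_tail, Walk.length_support]
  rfl

/-- An upper bound on the cyclomatic number suffices: where this is used, multiplicity $3$ and the
general bound supply the other inequality. -/
lemma IsInftyGraph.data [Finite V] {G : SimpleGraph V} (hG : G.Connected) (h : IsInftyGraph G) :
    cyclomatic G ≤ 2 ∧ (∀ z, 2 ≤ deg G z) ∧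
      ∃ y w, IsCycleVertex G y ∧ deg G y = 2 ∧ G.Adj y w ∧ IsMajor G w := by
  classical
  obtain ⟨a, b, C, D, P, hC, hD, hP, hCD, hCP, hDP, hV, hE⟩ := h
  have hdeg : ∀ z, 2 ≤ deg G z := by
    intro z
    rcases hV z with h | h | h
    · exact two_le_deg_of_cycleVertex (isCycleVertex_of_mem_support hC h)
    · exact two_le_deg_of_cycleVertex (isCycleVertex_of_mem_support hD h)
    · by_cases ha : z = a
      · exact two_le_deg_of_cycleVertex (isCycleVertex_of_mem_support hC (ha ▸ C.start_mem_support))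
      by_cases hb : z = b
      · exact two_le_deg_of_cycleVertex (isCycleVertex_of_mem_support hD (hb ▸ D.start_mem_support))
      exact two_le_deg_of_isPath hP h ha hb
  refine ⟨?_, hdeg, ?_⟩
  · have h1 := card_edgeSet_le_of_cover _ _ _ hE
    rw [Walk.length_edges, Walk.length_edges, Walk.length_edges] at h1
    have c1 := card_tail_support hC.support_nodup
    have d1 := card_tail_support hD.support_nodup
    have p1 := card_tail_support (p := P) (hP.support_nodup.sublist (List.tail_sublist _))
    have d2 := Finset.pred_card_le_card_erase (s := D.support.tail.toFinset) (a := b)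
    have hD3 := hD.three_le_length
    have haP : a ∉ P.support.tail := by
      have := hP.support_nodup
      rw [← Walk.cons_tail_support, List.nodup_cons] at this
      exact this.1
    -- Dropping the starting vertex of each walk, and the join $b$ from $D$, makes the three vertex
    -- sets disjoint; only one is lost against the number of edges.
    have h2 := card_le_of_disjoint (X := C.support.tail.toFinset) (Y := P.support.tail.toFinset)
      (Z := D.support.tail.toFinset.erase b) (by
        rw [Finset.disjoint_left]
        intro v hvC hvP
        rw [List.mem_toFinset] at hvC hvP
        have := hCP v (List.mem_of_mem_tail hvC) (List.mem_of_mem_tail hvP)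
        exact haP (this ▸ hvP)) (by
        rw [Finset.disjoint_left]
        intro v hvC hvD
        rw [Finset.mem_erase, List.mem_toFinset] at hvD
        rw [List.mem_toFinset] at hvC
        exact hvD.1 (hCD v (List.mem_of_mem_tail hvC) (List.mem_of_mem_tail hvD.2)).2) (by
        rw [Finset.disjoint_left]
        intro v hvP hvD
        rw [Finset.mem_erase, List.mem_toFinset] at hvD
        rw [List.mem_toFinset] at hvP
        exact hvD.1 (hDP v (List.mem_of_mem_tail hvD.2) (List.mem_of_mem_tail hvP)))
    rw [cyclomatic_of_connected hG]
    omega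
  · have hy := C.adj_snd hC.not_nil
    have hz := C.adj_penultimate hC.not_nil
    have hyC : C.snd ∈ C.support := C.getVert_mem_support 1
    have hzC : C.penultimate ∈ C.support := C.getVert_mem_support _
    refine ⟨C.snd, a, isCycleVertex_of_mem_support hC hyC, ?_, hy.symm, ?_⟩
    · refine le_antisymm ?_ (hdeg _)
      have h1 := hC.ncard_neighborSet_toSubgraph_eq_two hyC
      unfold deg
      rw [← h1]
      refine Set.ncard_le_ncard ?_ (Set.toFinite _)
      intro w hw
      rw [Subgraph.mem_neighborSet, Walk.adj_toSubgraph_iff_mem_edges]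
      rcases hE s(C.snd, w) hw with h | h | h
      · exact h
      · exact absurd (hCD _ hyC (D.fst_mem_support_of_mem_edges h)).1 hy.ne.symm
      · exact absurd (hCP _ hyC (P.fst_mem_support_of_mem_edges h)) hy.ne.symm
    · by_cases hab : a = b
      · have hx := D.adj_snd hD.not_nil
        have hxD : D.snd ∈ D.support := D.getVert_mem_support 1
        have hx' : ∀ w ∈ C.support, w ≠ D.snd := by
          intro w hw e
          exact hx.ne.symm (hCD _ (e ▸ hw) hxD).2
        exact three_le_deg hy hz.symm (hab ▸ hx) hC.snd_ne_penultimate (hx' _ hyC) (hx' _ hzC)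
      · have hnil : ¬ P.Nil := Walk.not_nil_of_ne hab
        have hx := P.adj_snd hnil
        have hxP : P.snd ∈ P.support := P.getVert_mem_support 1
        have hx' : ∀ w ∈ C.support, w ≠ P.snd := by
          intro w hw e
          exact hx.ne.symm (hCP _ (e ▸ hw) hxP)
        exact three_le_deg hy hz.symm hx hC.snd_ne_penultimate (hx' _ hyC) (hx' _ hzC)

/-- Three internally disjoint paths between two vertices that cover the graph. -/
structure IsThetaData (G : SimpleGraph V) (u v : V) (P Q R : G.Walk u v) : Prop where
  ne : u ≠ v
  pathP : P.IsPath
  pathQ : Q.IsPath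
  pathR : R.IsPath
  disjPQ : ∀ w, w ∈ P.support → w ∈ Q.support → w = u ∨ w = v
  disjPR : ∀ w, w ∈ P.support → w ∈ R.support → w = u ∨ w = v
  disjQR : ∀ w, w ∈ Q.support → w ∈ R.support → w = u ∨ w = v
  lenPQ : ¬ (P.length = 1 ∧ Q.length = 1)
  lenPR : ¬ (P.length = 1 ∧ R.length = 1)
  lenQR : ¬ (Q.length = 1 ∧ R.length = 1)
  verts : ∀ w, w ∈ P.support ∨ w ∈ Q.support ∨ w ∈ R.support
  edges : ∀ e ∈ G.edgeSet, e ∈ P.edges ∨ e ∈ Q.edges ∨ e ∈ R.edges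

lemma isThetaGraph_iff {G : SimpleGraph V} :
    IsThetaGraph G ↔ ∃ u v P Q R, IsThetaData G u v P Q R := by
  constructor
  · rintro ⟨u, v, P, Q, R, h1, h2, h3, h4, h5, h6, h7, h8, h9, h10, h11, h12⟩
    exact ⟨u, v, P, Q, R, h1, h2, h3, h4, h5, h6, h7, h8, h9, h10, h11, h12⟩
  · rintro ⟨u, v, P, Q, R, h1, h2, h3, h4, h5, h6, h7, h8, h9, h10, h11, h12⟩
    exact ⟨u, v, P, Q, R, h1, h2, h3, h4, h5, h6, h7, h8, h9, h10, h11, h12⟩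

lemma snd_eq_end {G : SimpleGraph V} {u v : V} {P : G.Walk u v} (hP : P.IsPath) (h : u ≠ v)
    (hs : P.snd = v) : P.length = 1 := by
  have h0 : P.length ≠ 0 := fun e => h (Walk.eq_of_length_eq_zero e)
  have := hP.getVert_injOn (x₁ := 1) (x₂ := P.length) (by rw [Set.mem_ofPred]; omega)
    (by rw [Set.mem_ofPred]) (by rw [P.getVert_length]; exact hs)
  exact this.symm

lemma snd_ne_snd {G : SimpleGraph V} {u v : V} {P Q : G.Walk u v} (hP : P.IsPath) (hQ : Q.IsPath)
    (h : u ≠ v) (hd : ∀ w, w ∈ P.support → w ∈ Q.support → w = u ∨ w = v)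
    (hl : ¬ (P.length = 1 ∧ Q.length = 1)) : P.snd ≠ Q.snd := by
  intro e
  have h1 := P.adj_snd (Walk.not_nil_of_ne h)
  rcases hd P.snd (P.getVert_mem_support 1) (e ▸ Q.getVert_mem_support 1) with h2 | h2
  · exact h1.ne h2.symm
  · exact hl ⟨snd_eq_end hP h h2, snd_eq_end hQ h (e ▸ h2)⟩

/-! ### Degrees and connectivity of $\theta$-graphs -/

namespace IsThetaData

variable {G : SimpleGraph V} {u v : V} {P Q R : G.Walk u v}

lemma rotate (h : IsThetaData G u v P Q R) : IsThetaData G u v Q R P where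
  ne := h.ne
  pathP := h.pathQ
  pathQ := h.pathR
  pathR := h.pathP
  disjPQ := h.disjQR
  disjPR := fun w h1 h2 => h.disjPQ w h2 h1
  disjQR := fun w h1 h2 => h.disjPR w h2 h1
  lenPQ := h.lenQR
  lenPR := fun h' => h.lenPQ h'.symm
  lenQR := fun h' => h.lenPR h'.symm
  verts := fun w => or_rotate.1 (h.verts w)
  edges := fun e he => or_rotate.1 (h.edges e he)

lemma reverse (h : IsThetaData G u v P Q R) :
    IsThetaData G v u P.reverse Q.reverse R.reverse where
  ne := h.ne.symm
  pathP := h.pathP.reverse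
  pathQ := h.pathQ.reverse
  pathR := h.pathR.reverse
  disjPQ := fun w h1 h2 => (h.disjPQ w (by simpa using h1) (by simpa using h2)).symm
  disjPR := fun w h1 h2 => (h.disjPR w (by simpa using h1) (by simpa using h2)).symm
  disjQR := fun w h1 h2 => (h.disjQR w (by simpa using h1) (by simpa using h2)).symm
  lenPQ := by simpa using h.lenPQ
  lenPR := by simpa using h.lenPR
  lenQR := by simpa using h.lenQR
  verts := by simpa using h.verts
  edges := by simpa using h.edges

lemma three_le_deg [Finite V] (h : IsThetaData G u v P Q R) : 3 ≤ deg G u :=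
  GraphMult.three_le_deg (P.adj_snd (Walk.not_nil_of_ne h.ne)) (Q.adj_snd (Walk.not_nil_of_ne h.ne))
    (R.adj_snd (Walk.not_nil_of_ne h.ne)) (snd_ne_snd h.pathP h.pathQ h.ne h.disjPQ h.lenPQ)
    (snd_ne_snd h.pathP h.pathR h.ne h.disjPR h.lenPR)
    (snd_ne_snd h.pathQ h.pathR h.ne h.disjQR h.lenQR)

lemma three_le_deg' [Finite V] (h : IsThetaData G u v P Q R) : 3 ≤ deg G v :=
  h.reverse.three_le_deg

lemma two_le_deg [Finite V] (h : IsThetaData G u v P Q R) (z : V) : 2 ≤ deg G z := by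
  by_cases hu : z = u
  · rw [hu]
    exact le_trans (by norm_num) h.three_le_deg
  by_cases hv : z = v
  · rw [hv]
    exact le_trans (by norm_num) h.three_le_deg'
  rcases h.verts z with hz | hz | hz
  · exact two_le_deg_of_isPath h.pathP hz hu hv
  · exact two_le_deg_of_isPath h.pathQ hz hu hv
  · exact two_le_deg_of_isPath h.pathR hz hu hv

lemma cyclomatic_le [Finite V] (h : IsThetaData G u v P Q R) (hG : G.Connected) :
    cyclomatic G ≤ 2 := by
  classical
  have h1 := card_edgeSet_le_of_cover _ _ _ h.edges
  rw [Walk.length_edges, Walk.length_edges, Walk.length_edges] at h1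
  have hlen : ∀ {W : G.Walk u v}, W.length ≠ 0 := fun e => h.ne (Walk.eq_of_length_eq_zero e)
  have hp := hlen (W := P)
  have hq := hlen (W := Q)
  have hr := hlen (W := R)
  have p1 := card_support_of_isPath h.pathP
  have key : ∀ (W : G.Walk u v), W.IsPath →
      ((W.support.toFinset.erase u).erase v).card + 1 = W.length := by
    intro W hW
    have hu : u ∈ W.support.toFinset := by simp
    have hv : v ∈ W.support.toFinset.erase u := by simp [h.ne.symm]
    have h2 := Finset.card_erase_add_one hu
    have h3 := Finset.card_erase_add_one hv
    rw [card_support_of_isPath hW] at h2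
    omega
  have q1 := key Q h.pathQ
  have r1 := key R h.pathR
  have h2 := card_le_of_disjoint (X := P.support.toFinset)
    (Y := (Q.support.toFinset.erase u).erase v) (Z := (R.support.toFinset.erase u).erase v) (by
      rw [Finset.disjoint_left]
      intro w h1 h2
      simp only [Finset.mem_erase, List.mem_toFinset] at h1 h2
      rcases h.disjPQ w h1 h2.2.2 with e | e
      · exact h2.2.1 e
      · exact h2.1 e) (by
      rw [Finset.disjoint_left]
      intro w h1 h2
      simp only [Finset.mem_erase, List.mem_toFinset] at h1 h2
      rcases h.disjPR w h1 h2.2.2 with e | e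
      · exact h2.2.1 e
      · exact h2.1 e) (by
      rw [Finset.disjoint_left]
      intro w h1 h2
      simp only [Finset.mem_erase, List.mem_toFinset] at h1 h2
      rcases h.disjQR w h1.2.2 h2.2.2 with e | e
      · exact h2.2.1 e
      · exact h2.1 e)
  rw [cyclomatic_of_connected hG]
  omega

/-- The excesses $\deg z-2\ge 0$ sum to $2(|E|-|V|)\le 2$, and each of $u$, $v$ already contributes
at least $1$. -/
lemma degrees [Fintype V] (h : IsThetaData G u v P Q R) (hG : G.Connected) :
    deg G u = 3 ∧ deg G v = 3 ∧ ∀ z, z ≠ u → z ≠ v → deg G z = 2 := by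
  classical
  have hcyc := h.cyclomatic_le hG
  rw [cyclomatic_of_connected hG, Nat.card_eq_fintype_card (α := V)] at hcyc
  have hsum := sum_deg G
  have h3 := h.three_le_deg
  have h4 := h.three_le_deg'
  have key : ∀ S : Finset V, ∑ z ∈ S, (deg G z - 2) ≤ 2 := by
    intro S
    refine (Finset.sum_le_sum_of_subset (Finset.subset_univ S)).trans ?_
    have h5 : ∑ z, (deg G z - 2) + ∑ _z : V, 2 = ∑ z, deg G z := by
      rw [← Finset.sum_add_distrib]
      exact Finset.sum_congr rfl fun z _ => Nat.sub_add_cancel (h.two_le_deg z)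
    rw [Finset.sum_const, Finset.card_univ, smul_eq_mul] at h5
    omega
  have k1 := key {u, v}
  rw [Finset.sum_pair h.ne] at k1
  refine ⟨by omega, by omega, fun z hu hv => ?_⟩
  have k2 := key {z, u, v}
  rw [Finset.sum_insert (by simp [hu, hv]), Finset.sum_pair h.ne] at k2
  have := h.two_le_deg z
  omega

/-- The second vertex of $P$ works: from it one reaches $v$ along $P$ and returns to $u$ along $Q$,
so its edge to $u$ is not a bridge. -/
lemma exists_cycleVertex [Fintype V] (h : IsThetaData G u v P Q R) (hG : G.Connected)
    (hl : P.length ≠ 1) :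
    ∃ y, IsCycleVertex G y ∧ deg G y = 2 ∧ G.Adj y u := by
  have hadj := P.adj_snd (Walk.not_nil_of_ne h.ne)
  have hyv : P.snd ≠ v := fun e => hl (snd_eq_end h.pathP h.ne e)
  refine ⟨P.snd, ?_, (h.degrees hG).2.2 _ hadj.ne.symm hyv, hadj.symm⟩
  refine isCycleVertex_iff.2 ⟨u, hadj.symm, ?_⟩
  rw [isBridge_iff, not_not]
  have hnil : ¬ P.Nil := Walk.not_nil_of_ne h.ne
  have h1 : u ∉ P.tail.support := by
    have h2 := h.pathP
    rw [← P.cons_tail_eq hnil, Walk.cons_isPath_iff] at h2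
    exact h2.2
  refine Reachable.trans (v := v) ?_ (Reachable.symm ?_)
  · refine reachable_of_walk P.tail fun c d hcd hc hd => Adj.reachable ?_
    rw [deleteEdge_adj]
    refine ⟨hcd, ?_, ?_⟩
    · rintro ⟨-, rfl⟩
      exact h1 hd
    · rintro ⟨rfl, -⟩
      exact h1 hc
  · have h2 : P.snd ∉ Q.support := by
      intro h3
      rcases h.disjPQ _ (P.getVert_mem_support 1) h3 with e | e
      · exact hadj.ne e.symm
      · exact hyv e
    refine reachable_of_walk Q fun c d hcd hc hd => Adj.reachable ?_
    rw [deleteEdge_adj]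
    refine ⟨hcd, ?_, ?_⟩
    · rintro ⟨rfl, -⟩
      exact h2 hc
    · rintro ⟨-, rfl⟩
      exact h2 hd

lemma connected_induce_compl (h : IsThetaData G u v P Q R) : (G.induce {u}ᶜ).Connected := by
  classical
  have hv : v ∈ ({u}ᶜ : Set V) := h.ne.symm
  have : Nonempty ↥({u}ᶜ : Set V) := ⟨⟨v, hv⟩⟩
  have key : ∀ W : G.Walk u v, W.IsPath → ∀ z : ↥({u}ᶜ : Set V), (z : V) ∈ W.support →
      (G.induce {u}ᶜ).Reachable z ⟨v, hv⟩ := by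
    intro W hW z hz
    refine reachable_induce (W.dropUntil z hz) (fun w hw => ?_) z.2 hv
    rintro rfl
    have h1 := hW.support_nodup
    rw [← W.take_spec hz, Walk.support_append, List.nodup_append] at h1
    have h2 : w ∈ (W.dropUntil z hz).support.tail := by
      rw [← Walk.cons_tail_support, List.mem_cons] at hw
      rcases hw with hw | hw
      · exact absurd hw.symm z.2
      · exact hw
    exact h1.2.2 w (Walk.start_mem_support _) w h2 rfl
  have key' : ∀ z : ↥({u}ᶜ : Set V), (G.induce {u}ᶜ).Reachable z ⟨v, hv⟩ := by
    intro z
    rcases h.verts z with hz | hz | hz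
    · exact key P h.pathP z hz
    · exact key Q h.pathQ z hz
    · exact key R h.pathR z hz
  exact ⟨fun z w => (key' z).trans (key' w).symm⟩

end IsThetaData

lemma IsThetaGraph.data [Fintype V] {G : SimpleGraph V} (hG : G.Connected) (h : IsThetaGraph G) :
    cyclomatic G ≤ 2 ∧ (∀ z, 2 ≤ deg G z) ∧
      ∃ y w, IsCycleVertex G y ∧ deg G y = 2 ∧ G.Adj y w ∧ IsMajor G w := by
  obtain ⟨u, v, P, Q, R, h⟩ := isThetaGraph_iff.1 h
  refine ⟨h.cyclomatic_le hG, h.two_le_deg, ?_⟩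
  have hy : ∃ y, IsCycleVertex G y ∧ deg G y = 2 ∧ G.Adj y u := by
    by_cases hP : P.length = 1
    · exact h.rotate.exists_cycleVertex hG fun hQ => h.lenPQ ⟨hP, hQ⟩
    · exact h.exists_cycleVertex hG hP
  obtain ⟨y, h1, h2, h3⟩ := hy
  exact ⟨y, u, h1, h2, h3, h.three_le_deg⟩

/-- The major vertices are exactly the two branch vertices, and deleting one lowers the cyclomatic
number by $3-1=2$. -/
lemma IsThetaGraph.isTree_induce_compl [Fintype V] {G : SimpleGraph V} (hG : G.Connected)
    (h : IsThetaGraph G) (hcyc : cyclomatic G = 2) {w : V} (hw : IsMajor G w) :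
    deg G w = 3 ∧ (G.induce {w}ᶜ).IsTree := by
  obtain ⟨u, v, P, Q, R, h⟩ := isThetaGraph_iff.1 h
  obtain ⟨h1, h2, h3⟩ := h.degrees hG
  have hconn : deg G w = 3 ∧ (G.induce {w}ᶜ).Connected := by
    by_cases hu : w = u
    · subst hu
      exact ⟨h1, h.connected_induce_compl⟩
    by_cases hv : w = v
    · subst hv
      exact ⟨h2, h.reverse.connected_induce_compl⟩
    · have := h3 w hu hv
      unfold IsMajor at hw
      omega
  refine ⟨hconn.1, isTree_iff_cyclomatic.2 ⟨hconn.2, ?_⟩⟩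
  rw [cyclomatic_induce_compl hG hconn.2, hcyc, hconn.1]
  norm_num

/-! ### Components of `G - 𝓜(G)` -/

lemma mem_compSet_iff {G : SimpleGraph V} {c : (reduced G).ConnectedComponent} {z : V} :
    z ∈ compSet G c ↔
      ∃ h : z ∈ (nonCycleMajor G)ᶜ, (reduced G).connectedComponentMk ⟨z, h⟩ = c := by
  constructor
  · rintro ⟨z, hz, rfl⟩
    exact ⟨z.2, hz⟩
  · rintro ⟨h, hz⟩
    exact ⟨⟨z, h⟩, hz, rfl⟩

lemma notMem_of_mem_compSet {G : SimpleGraph V} {c : (reduced G).ConnectedComponent} {z : V}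
    (hz : z ∈ compSet G c) : z ∉ nonCycleMajor G := (mem_compSet_iff.1 hz).1

lemma compSet_unique {G : SimpleGraph V} {c d : (reduced G).ConnectedComponent} {z : V}
    (hc : z ∈ compSet G c) (hd : z ∈ compSet G d) : c = d := by
  obtain ⟨h, rfl⟩ := mem_compSet_iff.1 hc
  obtain ⟨_, rfl⟩ := mem_compSet_iff.1 hd
  rfl

lemma mem_compSet_of_adj {G : SimpleGraph V} {c : (reduced G).ConnectedComponent} {z w : V}
    (hz : z ∈ compSet G c) (hzw : G.Adj z w) (hw : w ∉ nonCycleMajor G) : w ∈ compSet G c := by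
  obtain ⟨h, rfl⟩ := mem_compSet_iff.1 hz
  refine mem_compSet_iff.2 ⟨hw, ?_⟩
  rw [ConnectedComponent.eq]
  exact Adj.reachable (Adj.symm hzw)

lemma mem_compSet_of_walk {G : SimpleGraph V} {c : (reduced G).ConnectedComponent} {z w : V}
    (p : G.Walk z w) (hz : z ∈ compSet G c) (h : ∀ v ∈ p.support, v ∉ nonCycleMajor G) :
    ∀ v ∈ p.support, v ∈ compSet G c := by
  induction p with
  | nil =>
    intro v hv
    rw [Walk.support_nil, List.mem_singleton] at hv
    exact hv ▸ hz
  | @cons a b d hab p ih =>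
    intro v hv
    rw [Walk.support_cons, List.mem_cons] at hv
    rcases hv with rfl | hv
    · exact hz
    · refine ih (mem_compSet_of_adj hz hab (h b (by simp))) (fun v hv => h v ?_) v hv
      simp [hv]

/-- The sum of the multiplicities of the components of `G - 𝓜(G)` exceeds the multiplicity of `G`
by at most `|𝓜(G)|`. -/
theorem sum_multOn_le [Fintype V] {G : SimpleGraph V} {B : Matrix V V ℂ} (hB : HasPattern G B)
    [Fintype (reduced G).ConnectedComponent] (x : ℝ) :
    ∑ c : (reduced G).ConnectedComponent, multOn B (compSet G c) x ≤
      mult B x + (nonCycleMajor G).ncard := by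
  classical
  let E : ∀ c : (reduced G).ConnectedComponent,
      Submodule ℂ (compSet G c → ℂ) := fun c =>
    Module.End.eigenspace (principal B (compSet G c)).mulVecLin (x : ℂ)
  let ext : ∀ c : (reduced G).ConnectedComponent, (compSet G c → ℂ) →ₗ[ℂ] (V → ℂ) := fun c =>
    Function.ExtendByZero.linearMap ℂ Subtype.val
  have ext_mem : ∀ c (f : compSet G c → ℂ) z (hz : z ∈ compSet G c), ext c f z = f ⟨z, hz⟩ :=
    fun c f z hz => Subtype.val_injective.extend_apply f 0 ⟨z, hz⟩
  have ext_notMem : ∀ c (f : compSet G c → ℂ) z, z ∉ compSet G c → ext c f z = 0 :=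
    fun c f z hz => Function.extend_apply' _ _ _ fun ⟨w, hw⟩ => hz (hw ▸ w.2)
  let Φ : (∀ c, E c) →ₗ[ℂ] (V → ℂ) :=
    ∑ c, (ext c).comp ((E c).subtype.comp (LinearMap.proj c))
  have Φ_apply : ∀ f z, Φ f z = ∑ c, ext c (f c).1 z := fun f z => by
    simp [Φ, LinearMap.sum_apply]
  have Φ_mem : ∀ f c z (hz : z ∈ compSet G c), Φ f z = (f c).1 ⟨z, hz⟩ := by
    intro f c z hz
    rw [Φ_apply, Finset.sum_eq_single c, ext_mem c _ z hz]
    · intro d _ hdc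
      exact ext_notMem d _ z fun hd => hdc (compSet_unique hd hz)
    · simp
  have Φ_notMem : ∀ f z, z ∈ nonCycleMajor G → Φ f z = 0 := by
    intro f z hz
    rw [Φ_apply]
    exact Finset.sum_eq_zero fun c _ => ext_notMem c _ z fun hc => notMem_of_mem_compSet hc hz
  have Φ_inj : Function.Injective Φ := by
    rw [← LinearMap.ker_eq_bot, LinearMap.ker_eq_bot']
    intro f hf
    funext c
    apply Subtype.ext
    funext z
    rw [← Φ_mem f c z z.2, hf]
    rfl
  -- A vector glued from component eigenvectors and extended by zero satisfies the eigenvalue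
  -- equation off $\mathcal M(G)$; `K` records the defects at the vertices of $\mathcal M(G)$.
  let K : (V → ℂ) →ₗ[ℂ] (nonCycleMajor G → ℂ) :=
    (LinearMap.funLeft ℂ ℂ Subtype.val).comp (B.mulVecLin - (x : ℂ) • LinearMap.id)
  have h1 := (finrank_le_of_inf_ker_le K (LinearMap.range Φ)
    (Module.End.eigenspace B.mulVecLin (x : ℂ)) (by
      rintro _ ⟨⟨f, rfl⟩, hK⟩
      rw [mem_eigenspace]
      intro i
      by_cases hi : i ∈ nonCycleMajor G
      · have h2 : ∑ j, B i j * Φ f j - x * Φ f i = 0 := congrFun hK ⟨i, hi⟩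
        exact sub_eq_zero.1 h2
      · have hic := mem_compSet_iff.2 ⟨hi, rfl⟩
        rw [← sum_principal hB ⟨i, hic⟩ (P := compSet G _) (y := Φ f)]
        · have h2 := mem_eigenspace.1 (f ((reduced G).connectedComponentMk ⟨i, hi⟩)).2 ⟨i, hic⟩
          rw [Φ_mem f _ i hic, ← h2]
          exact Finset.sum_congr rfl fun j _ => by rw [Φ_mem f _ j j.2]
        · intro w hw hiw
          refine Φ_notMem f w ?_
          by_contra hwM
          exact hw (mem_compSet_of_adj hic hiw hwM))).1
  rw [LinearMap.finrank_range_of_inj Φ_inj, Module.finrank_pi_fintype,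
    Module.finrank_fintype_fun_eq_card] at h1
  have h3 : Fintype.card (nonCycleMajor G) = (nonCycleMajor G).ncard := by
    rw [← Nat.card_eq_fintype_card]
    rfl
  rw [h3] at h1
  refine le_trans (le_of_eq ?_) h1
  exact Finset.sum_congr rfl fun c _ => multOn_eq B _ x

/-! ### Path graphs and unicyclic graphs -/

lemma isTree_pathGraph (n : ℕ) : (pathGraph (n + 1)).IsTree := by
  refine ⟨pathGraph_connected n, isAcyclic_iff_forall_adj_isBridge.2 ?_⟩
  have key : ∀ a b : Fin (n + 1), (a : ℕ) + 1 = b → (pathGraph (n + 1)).IsBridge s(a, b) := by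
    intro a b hab
    rw [isBridge_iff]
    rintro ⟨W⟩
    have : ∀ (c d : Fin (n + 1)) (_ : ((pathGraph (n + 1)).deleteEdges {s(a, b)}).Walk c d),
        c ≤ a → d ≤ a := by
      intro c d W
      induction W with
      | nil => exact id
      | @cons c e d h _ ih =>
        intro hca
        apply ih
        rw [deleteEdge_adj, pathGraph_adj] at h
        obtain ⟨h1, h2, -⟩ := h
        by_contra hea
        rw [Fin.le_def] at hca hea
        refine h2 ⟨Fin.ext (by omega), Fin.ext (by omega)⟩
    have h1 := this a b W le_rfl
    rw [Fin.le_def] at h1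
    omega
  intro a b hab
  rcases pathGraph_adj.1 hab with h | h
  · exact key a b h
  · exact isBridge_comm.1 (key b a h)

lemma IsPathGraph.isTree {G : SimpleGraph V} (h : IsPathGraph G) : G.IsTree := by
  obtain ⟨n, ⟨f⟩⟩ := h
  exact f.isTree_iff.2 (isTree_pathGraph n)

/-- Two cycles of a unicyclic graph have the same edges. -/
lemma mem_edges_of_cyclomatic_eq_one [Finite V] {G : SimpleGraph V} (hG : G.Connected)
    (hcyc : cyclomatic G = 1) {u v : V} {c : G.Walk u u} {d : G.Walk v v} (hc : c.IsCycle)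
    (hd : d.IsCycle) {e : Sym2 V} (he : e ∈ c.edges) : e ∈ d.edges := by
  by_contra hed
  have heG := c.edges_subset_edgeSet he
  induction e with
  | h a b =>
    have hb : ¬ G.IsBridge s(a, b) := fun hb => hb.notMem_edges_of_isCycle hc he
    have hT : (G.deleteEdges {s(a, b)}).IsTree := by
      refine isTree_iff_cyclomatic.2 ⟨hG.connected_delete_edge_of_not_isBridge hb, ?_⟩
      have h1 := cyclomatic_deleteEdge hG ((G.mem_edgeSet).1 heG) hb
      rw [hcyc] at h1
      omega
    -- Deleting an edge of one cycle leaves a tree, so the other cycle must have used that edge.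
    refine hT.isAcyclic _ (hd.transfer (H := G.deleteEdges {s(a, b)}) fun e' he' => ?_)
    rw [edgeSet_deleteEdges]
    exact ⟨d.edges_subset_edgeSet he', fun h => hed ((Set.mem_singleton_iff.1 h) ▸ he')⟩

/-! ### Counting in graphs of form (b) -/

lemma deg_eq_sum [Fintype V] (G : SimpleGraph V) [DecidableRel G.Adj] (v : V) :
    (deg G v : ℤ) = ∑ w, if G.Adj v w then 1 else 0 := by
  rw [deg_eq_degree, ← card_neighborFinset_eq_degree, Finset.sum_boole,
    neighborFinset_eq_filter]

/-- The number of neighbours of `z` in `M`. -/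
noncomputable def degIn (G : SimpleGraph V) (M : Set V) (z : V) : ℕ := (G.neighborSet z ∩ M).ncard

lemma sum_degIn [Fintype V] (G : SimpleGraph V) (M : Set V) [DecidablePred (· ∈ M)] :
    ∑ z, (degIn G M z : ℤ) = ∑ z ∈ Finset.univ.filter (· ∈ M), (deg G z : ℤ) := by
  classical
  have h1 : ∀ z, (degIn G M z : ℤ) = ∑ w ∈ Finset.univ.filter (· ∈ M), if G.Adj z w then 1 else 0 := by
    intro z
    rw [Finset.sum_boole, Finset.filter_filter, degIn, Set.ncard_eq_toFinset_card']
    congr 2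
    ext w
    simp [and_comm]
  simp only [h1, deg_eq_sum]
  rw [Finset.sum_comm]
  simp only [G.adj_comm]

lemma deg_eq_deg_induce_add [Fintype V] {G : SimpleGraph V} {c : (reduced G).ConnectedComponent}
    (z : compSet G c) :
    deg G z = deg (G.induce (compSet G c)) z + degIn G (nonCycleMajor G) z := by
  unfold deg degIn
  rw [← Set.ncard_image_of_injective _ Subtype.val_injective, ← Set.ncard_union_eq _
    (Set.toFinite _) (Set.toFinite _)]
  · congr 1
    ext w
    constructor
    · intro hw
      by_cases hM : w ∈ nonCycleMajor G
      · exact Or.inr ⟨hw, hM⟩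
      · exact Or.inl ⟨⟨w, mem_compSet_of_adj z.2 hw hM⟩, hw, rfl⟩
    · rintro (⟨w, hw, rfl⟩ | hw)
      · exact hw
      · exact hw.1
  · rw [Set.disjoint_left]
    rintro _ ⟨w, -, rfl⟩ hw
    exact notMem_of_mem_compSet w.2 hw.2

lemma sum_compSet [Fintype V] {G : SimpleGraph V} [Fintype (reduced G).ConnectedComponent]
    [∀ c, Fintype (compSet G c)] [DecidablePred (· ∈ nonCycleMajor G)] (g : V → ℤ) :
    ∑ c, ∑ z : compSet G c, g z = ∑ z ∈ Finset.univ.filter (· ∉ nonCycleMajor G), g z := by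
  classical
  have h1 : ∀ c, ∑ z : compSet G c, g z = ∑ z, if z ∈ compSet G c then g z else 0 := by
    intro c
    rw [← Finset.sum_filter, Finset.sum_subtype (p := (· ∈ compSet G c)) _ (by simp)]
  simp only [h1]
  rw [Finset.sum_comm, Finset.sum_filter]
  refine Finset.sum_congr rfl fun z _ => ?_
  by_cases hz : z ∈ nonCycleMajor G
  · rw [if_neg (not_not.2 hz)]
    exact Finset.sum_eq_zero fun c _ => if_neg fun hc => notMem_of_mem_compSet hc hz
  · have hc := mem_compSet_iff.2 ⟨hz, rfl⟩
    rw [if_pos hz, Finset.sum_eq_single ((reduced G).connectedComponentMk ⟨z, hz⟩), if_pos hc]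
    · intro d _ hd
      exact if_neg fun hzd => hd (compSet_unique hzd hc)
    · simp

section FormB

variable [Fintype V] {G : SimpleGraph V} {B : Matrix V V ℂ} {x : ℝ}

lemma FormB.component (h : FormB G B x) (c : (reduced G).ConnectedComponent) [Decidable (InU (G.induce (compSet G c)))] :
    (G.induce (compSet G c)).Connected ∧
      cyclomatic (G.induce (compSet G c)) = (if InU (G.induce (compSet G c)) then 1 else 0) ∧
      1 + (if InU (G.induce (compSet G c)) then 1 else 0) ≤ multOn B (compSet G c) x := by
  classical
  rcases h.2.2.1 c with ⟨h1, h2⟩ | ⟨h1, h2⟩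
  · rw [if_pos h1, if_pos h1, h2]
    exact ⟨h1.1, h1.2.1, le_rfl⟩
  · have h3 := isTree_iff_cyclomatic.1 h1.isTree
    have h4 : ¬ InU (G.induce (compSet G c)) := fun h4 => by
      have := h4.2.1
      omega
    rw [if_neg h4, if_neg h4]
    refine ⟨h3.1, h3.2, ?_⟩
    unfold IsEigenvalueOn IsEigenvalue Module.End.HasEigenvalue Module.End.HasUnifEigenvalue at h2
    unfold multOn mult
    rw [add_zero, Nat.one_le_iff_ne_zero]
    intro h5
    exact h2 (Submodule.finrank_eq_zero.1 h5)

/-- Major cycle-vertices lie in different components of `G - 𝓜(G)`, all of them in `𝒰`. -/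
lemma FormB.card_cycleMajor_le (h : FormB G B x) :
    {v | IsMajor G v ∧ IsCycleVertex G v}.ncard ≤
      Nat.card {c : (reduced G).ConnectedComponent // InU (G.induce (compSet G c))} := by
  classical
  have hnM : ∀ v, IsCycleVertex G v → v ∈ (nonCycleMajor G)ᶜ := fun v hv hM => hM.2 hv
  have hcyc : ∀ c (v : V) (hv : v ∈ compSet G c), IsCycleVertex G v →
      ∃ (d : (G.induce (compSet G c)).Walk ⟨v, hv⟩ ⟨v, hv⟩) (C : G.Walk v v),
        d.IsCycle ∧ C.IsCycle ∧ ∀ z ∈ d.support, (z : V) ∈ C.support := by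
    rintro c v hv ⟨C, hC⟩
    have hsub := mem_compSet_of_walk C hv fun z hz =>
      hnM z (isCycleVertex_of_mem_support hC hz)
    refine ⟨C.induce _ hsub, C, ?_, hC, fun z hz => ?_⟩
    swap
    · rw [C.support_induce hsub] at hz
      exact (List.mem_attachWith hsub z).1 hz
    refine Walk.IsCycle.of_map (f := (Embedding.induce (G := G) (compSet G c)).toHom) ?_
    rwa [C.map_induce hsub]
  have hU : ∀ v, (hv : IsCycleVertex G v) →
      InU (G.induce (compSet G ((reduced G).connectedComponentMk ⟨v, hnM v hv⟩))) := by
    intro v hv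
    rcases h.2.2.1 ((reduced G).connectedComponentMk ⟨v, hnM v hv⟩) with h1 | h1
    · exact h1.1
    · obtain ⟨d, C, hd, -⟩ := hcyc _ v (mem_compSet_iff.2 ⟨hnM v hv, rfl⟩) hv
      exact absurd hd (h1.1.isTree.isAcyclic d)
  let f : {v | IsMajor G v ∧ IsCycleVertex G v} →
      {c : (reduced G).ConnectedComponent // InU (G.induce (compSet G c))} := fun v =>
    ⟨(reduced G).connectedComponentMk ⟨v, hnM v v.2.2⟩, hU v v.2.2⟩
  refine Nat.card_le_card_of_injective f ?_
  rintro ⟨v, hv⟩ ⟨w, hw⟩ hvw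
  apply Subtype.ext
  have e : (reduced G).connectedComponentMk ⟨v, hnM v hv.2⟩ =
      (reduced G).connectedComponentMk ⟨w, hnM w hw.2⟩ := congrArg Subtype.val hvw
  have hvc := mem_compSet_iff.2 ⟨hnM v hv.2, rfl⟩
  have hwc := mem_compSet_iff.2 ⟨hnM w hw.2, e.symm⟩
  have hI := hU v hv.2
  obtain ⟨d1, C1, hd1, hC1, -⟩ := hcyc _ v hvc hv.2
  obtain ⟨d2, C2, hd2, hC2, e2⟩ := hcyc _ w hwc hw.2
  -- In a common unicyclic component $v$ would lie on the cycle through $w$, which has only one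
  -- major vertex.
  have h3 := mem_edges_of_cyclomatic_eq_one hI.1 hI.2.1 hd1 hd2
    (Walk.mk_start_snd_mem_edges hd1.not_nil)
  have h4 := d2.fst_mem_support_of_mem_edges h3
  have h5 : v ∈ C2.support := e2 _ h4
  obtain ⟨z, -, -, hz⟩ := h.1 w C2 hC2
  exact (hz v h5 hv.1).trans (hz w C2.start_mem_support hw.1).symm

/-- Let $k$ be the number of components, $M=\mathcal M(G)$, $N$ its complement, and $c$ the number
of major cycle-vertices. Component multiplicities give $m\ge k+\theta-|M|$. Handshaking in $G$ and
in the components gives $\sum_N(\deg-2)=2\theta-k+|M|-1$, which is at most $c-p\le\theta-p$.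
Eliminating $k-|M|$ yields the claim. -/
theorem FormB.le_mult (h : FormB G B x) (hG : G.Connected) [Nontrivial V]
    (hB : HasPattern G B) :
    2 * cyclomatic G + (pendentCount G : ℤ) - 1 ≤ mult B x := by
  classical
  have : Fintype (reduced G).ConnectedComponent := Fintype.ofFinite _
  let ι : (reduced G).ConnectedComponent → ℕ := fun c =>
    if InU (G.induce (compSet G c)) then 1 else 0
  let MF : Finset V := Finset.univ.filter (· ∈ nonCycleMajor G)
  let NF : Finset V := Finset.univ.filter (· ∉ nonCycleMajor G)
  have hMF : (nonCycleMajor G).ncard = MF.card := by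
    rw [Set.ncard_eq_toFinset_card']
    congr 1
    ext
    simp [MF]
  have hsplit : ∀ g : V → ℤ, ∑ z, g z = ∑ z ∈ MF, g z + ∑ z ∈ NF, g z := fun g =>
    (Finset.sum_filter_add_sum_filter_not _ _ _).symm
  have hι : ((∑ c, ι c : ℕ) : ℤ) = cyclomatic G := by
    rw [← h.2.2.2, Nat.card_eq_fintype_card, Fintype.card_subtype, Finset.sum_boole]
    rfl
  have hmult : Fintype.card (reduced G).ConnectedComponent + ∑ c, ι c ≤
      mult B x + MF.card := by
    rw [← hMF]
    refine le_trans ?_ (sum_multOn_le hB x)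
    rw [← Finset.card_univ, Finset.card_eq_sum_ones, ← Finset.sum_add_distrib]
    exact Finset.sum_le_sum fun c _ => (h.component c).2.2
  -- Handshaking in one component, whose number of edges exceeds its number of vertices by
  -- $\iota(c)-1$.
  have hcomp : ∀ c, ∑ z : compSet G c, ((deg G z : ℤ) - degIn G (nonCycleMajor G) z) =
      ∑ z : compSet G c, 2 - 2 + 2 * ι c := by
    intro c
    obtain ⟨h1, h2, -⟩ := h.component c
    have h3 := sum_deg (G.induce (compSet G c))
    rw [cyclomatic_of_connected h1, Nat.card_eq_fintype_card (α := compSet G c)] at h2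
    have h4 : ∑ z : compSet G c, ((deg G z : ℤ) - degIn G (nonCycleMajor G) z) =
        ∑ z, (deg (G.induce (compSet G c)) z : ℤ) := by
      refine Finset.sum_congr rfl fun z _ => ?_
      rw [deg_eq_deg_induce_add z]
      push_cast
      ring
    rw [h4, Finset.sum_const, Finset.card_univ, nsmul_eq_mul]
    have h5 : (ι c : ℤ) = if InU (G.induce (compSet G c)) then 1 else 0 := by
      simp only [ι]
      split_ifs <;> rfl
    rw [h5, ← h2]
    have h6 : (∑ z, (deg (G.induce (compSet G c)) z : ℤ)) =
        2 * (Nat.card (G.induce (compSet G c)).edgeSet : ℤ) := by exact_mod_cast h3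
    rw [h6]
    ring
  have hsum1 : ∑ z ∈ NF, ((deg G z : ℤ) - degIn G (nonCycleMajor G) z) =
      2 * NF.card - 2 * Fintype.card (reduced G).ConnectedComponent + 2 * cyclomatic G := by
    rw [← sum_compSet, Finset.sum_congr rfl fun c _ => hcomp c, Finset.sum_add_distrib,
      Finset.sum_sub_distrib, sum_compSet (G := G) (fun _ => 2), ← Finset.mul_sum, ← hι]
    simp only [Finset.sum_const, Finset.card_univ, nsmul_eq_mul]
    push_cast
    ring
  -- As $\mathcal M(G)$ is independent, its degrees are all spent on edges to the other vertices.
  have hdegIn0 : ∑ z ∈ MF, (degIn G (nonCycleMajor G) z : ℤ) = 0 := by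
    refine Finset.sum_eq_zero fun z hz => ?_
    have hz' : z ∈ nonCycleMajor G := by simpa [MF] using hz
    have : degIn G (nonCycleMajor G) z = 0 := by
      unfold degIn
      rw [Set.ncard_eq_zero (Set.toFinite _), Set.eq_empty_iff_forall_notMem]
      rintro w ⟨hw1, hw2⟩
      exact h.2.1 z hz' w hw2 hw1
    rw [this]
    rfl
  have hdegIn := sum_degIn G (nonCycleMajor G)
  rw [hsplit, hdegIn0, zero_add] at hdegIn
  have hE : ∑ z, (deg G z : ℤ) = 2 * (Nat.card G.edgeSet : ℤ) := by exact_mod_cast sum_deg G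
  rw [hsplit] at hE
  rw [Finset.sum_sub_distrib, hdegIn] at hsum1
  have hcard : MF.card + NF.card = Fintype.card V := by
    rw [← Finset.card_univ]
    exact Finset.card_filter_add_card_filter_not _
  have hθ := cyclomatic_of_connected hG
  rw [Nat.card_eq_fintype_card (α := V)] at hθ
  -- Outside $\mathcal M(G)$ the excess $\deg-2$ is $1$ at a major cycle-vertex, $-1$ at a pendent
  -- vertex and $0$ otherwise.
  have hpoint : ∑ z ∈ NF, ((deg G z : ℤ) - 2) ≤
      {v | IsMajor G v ∧ IsCycleVertex G v}.ncard - (pendentCount G : ℤ) := by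
    have e1 : (({v | IsMajor G v ∧ IsCycleVertex G v}.ncard : ℕ) : ℤ) =
        ∑ z ∈ NF, if IsMajor G z ∧ IsCycleVertex G z then 1 else 0 := by
      rw [Finset.sum_boole, Finset.filter_filter, Set.ncard_eq_toFinset_card']
      congr 2
      ext z
      simp only [Set.mem_toFinset, Set.mem_ofPred_eq, Finset.mem_filter, Finset.mem_univ, true_and]
      exact ⟨fun hz => ⟨fun hM => hM.2 hz.2, hz⟩, fun hz => hz.2⟩
    have e2 : ((pendentCount G : ℕ) : ℤ) = ∑ z ∈ NF, if deg G z = 1 then 1 else 0 := by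
      rw [Finset.sum_boole, Finset.filter_filter, pendentCount, Set.ncard_eq_toFinset_card']
      congr 2
      ext z
      simp only [Set.mem_toFinset, Set.mem_ofPred_eq, Finset.mem_filter, Finset.mem_univ, true_and]
      refine ⟨fun hz => ⟨fun hM => ?_, hz⟩, fun hz => hz.2⟩
      have := hM.1
      unfold IsMajor at this
      omega
    rw [e1, e2, ← Finset.sum_sub_distrib]
    refine Finset.sum_le_sum fun z hz => ?_
    have hz' : z ∉ nonCycleMajor G := by simpa [NF] using hz
    obtain ⟨w, hw⟩ := hG.preconnected.exists_adj_of_nontrivial z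
    have h1 := one_le_deg hw
    by_cases hm : IsMajor G z
    · have hc : IsCycleVertex G z := by_contra fun hc => hz' ⟨hm, hc⟩
      obtain ⟨C, hC⟩ := hc
      obtain ⟨w, -, hw3, hw⟩ := h.1 z C hC
      have h3 : deg G z = 3 := by rw [hw z C.start_mem_support hm, hw3]
      rw [if_pos ⟨hm, ⟨C, hC⟩⟩, h3]
      norm_num
    · rw [if_neg fun h => hm h.1]
      unfold IsMajor at hm
      split_ifs with h1' <;> omega
  rw [Finset.sum_sub_distrib, Finset.sum_const, nsmul_eq_mul] at hpoint
  have hcm := h.card_cycleMajor_le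
  have hcm' : (({v | IsMajor G v ∧ IsCycleVertex G v}.ncard : ℕ) : ℤ) ≤ cyclomatic G := by
    rw [← h.2.2.2]
    exact_mod_cast hcm
  have hmult' : (Fintype.card (reduced G).ConnectedComponent : ℤ) + cyclomatic G ≤
      mult B x + MF.card := by
    rw [← hι]
    exact_mod_cast hmult
  have hcard' : (MF.card : ℤ) + NF.card = Fintype.card V := by exact_mod_cast hcard
  linarith

end FormB

/-! ### The characterization -/

section

variable [Fintype V] {G : SimpleGraph V} {B : Matrix V V ℂ} {x : ℝ}

/-- If all degrees were $2$ there would be as many edges as vertices, and no pendent vertex. -/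
lemma exists_deg_ne_two (hG : G.Connected) (hU : ¬ InU G) : ∃ z, deg G z ≠ 2 := by
  by_contra! h
  refine hU ⟨hG, ?_, ?_⟩
  · have h1 := sum_deg G
    simp only [h, Finset.sum_const, Finset.card_univ, smul_eq_mul] at h1
    rw [cyclomatic_of_connected hG, Nat.card_eq_fintype_card (α := V)]
    omega
  · simp [pendentCount, h]

/-- With $p(T)=p(G)+|D|$ nothing is lost in the leaf count: the second entries of $D$ are distinct
and all of them are leaves. -/
lemma IsCut.isExtremal {T : SimpleGraph V} {D : Finset (V × V)} (hc : IsCut G T D)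
    (hB : HasPattern G B) (hl : ∀ b, deg T b = 1 → deg G b = 1 ∨ ∃ a, (a, b) ∈ D)
    (hT : pendentCount T = pendentCount G + D.card)
    (hm : mult B x + 1 = pendentCount T + D.card) (h3 : 3 ≤ pendentCount T) :
    IsExtremal G T D B x := by
  classical
  have h1 : {b | deg T b = 1} ⊆ {b | deg G b = 1} ∪ (D.image Prod.snd : Finset V) := by
    intro b hb
    rcases hl b hb with h | ⟨a, h⟩
    · exact Or.inl h
    · exact Or.inr (by simpa using ⟨a, h⟩)
  have h2 := Set.ncard_le_ncard h1 (Set.toFinite _)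
  have h4 := Set.ncard_union_le {b | deg G b = 1} ((D.image Prod.snd : Finset V) : Set V)
  rw [Set.ncard_coe_finset] at h4
  have h5 := Finset.card_image_le (s := D) (f := Prod.snd)
  have h6 : {b | deg T b = 1}.ncard = {b | deg G b = 1}.ncard + D.card := hT
  have h7 := Set.eq_of_subset_of_ncard_le h1 (by omega) (Set.toFinite _)
  have h8 : Set.InjOn Prod.snd (D : Set (V × V)) := Finset.card_image_iff.1 (by omega)
  refine ⟨hc, hB, hm, fun a b hab => ?_, fun a a' b h h' => ?_, h3⟩
  · have : b ∈ {b | deg T b = 1} := h7 ▸ Or.inr (Finset.mem_coe.2 (Finset.mem_image.2 ⟨_, hab, rfl⟩))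
    exact this
  · exact congrArg Prod.fst (h8 h h' rfl)

lemma pendentCount_eq_zero (h : ∀ z, 2 ≤ deg G z) : pendentCount G = 0 := by
  unfold pendentCount
  rw [Set.ncard_eq_zero]
  ext z
  have := h z
  simp only [Set.mem_ofPred_eq, Set.mem_empty_iff_false, iff_false]
  omega

/-- Deleting one vertex costs at most one, so multiplicity at least $2$ remains. Each graph left
over is in $\mathcal U$ or is a tree with at most three leaves, which allows no more. -/
lemma formA_of_mult_eq_three (hG : G.Connected) (hB : HasPattern G B) (hcyc : cyclomatic G = 2)
    (h : IsInftyGraph G ∨ IsThetaGraph G) (hm : mult B x = 3) : FormA G B x := by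
  classical
  have h2 : ∀ z, 2 ≤ deg G z := h.elim (fun h => (h.data hG).2.1) fun h => (h.data hG).2.1
  refine ⟨h, fun y hy hd ⟨w, hyw, hw⟩ => ⟨?_, by omega⟩, fun hθ w hw => ?_⟩
  · have h3 := mult_le_multOn_compl hB y x
    have h4 := (inU_induce_compl hG hcyc h2 hy hd hyw hw).mult_le_two (hB.principal _) x
    rw [← multOn_eq] at h4
    omega
  · obtain ⟨h3, h4⟩ := hθ.isTree_induce_compl hG hcyc hw
    have h5 := mult_le_multOn_compl hB w x
    have h6 := mult_le_two_of_isTree_induce_compl hB h2 h3 h4 x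
    omega

/-- A vertex $y$ as in the condition must exist, otherwise (a) would say nothing about the
multiplicity. It gives $3\le 2\theta-1$ by the upper bound, hence $\theta=2$. -/
lemma FormA.mult_eq (h : FormA G B x) (hG : G.Connected) (hB : HasPattern G B) [Nontrivial V]
    (h2 : ∃ z, deg G z ≠ 2) :
    (mult B x : ℤ) = 2 * cyclomatic G + (pendentCount G : ℤ) - 1 := by
  obtain ⟨h3, h4, y, w, hy, hd, hyw, hw⟩ := h.1.elim (fun h => h.data hG) fun h => h.data hG
  have h5 := (h.2.1 y hy hd ⟨w, hyw, hw⟩).2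
  have h6 := mult_le_of_exists_deg_ne_two hG h2 hB x
  rw [pendentCount_eq_zero h4] at h6 ⊢
  push_cast at h6 ⊢
  omega

theorem formA_or_formB (hG : G.Connected) (hU : ¬ InU G) (hB : HasPattern G B) [Nontrivial V]
    (hθ : 1 ≤ cyclomatic G)
    (h : (mult B x : ℤ) = 2 * cyclomatic G + (pendentCount G : ℤ) - 1) :
    FormA G B x ∨ FormB G B x := by
  have h2 := exists_deg_ne_two hG hU
  obtain ⟨T, D, hc, hD, hl⟩ := exists_isCut hG h2
  have h3 := hc.mult_le hB x
  have h4 := pendentCount_le_of_leaf hl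
  have h5 := two_le_pendentCount hc.isTree
  by_cases hL : 3 ≤ pendentCount T
  · exact Or.inr ((hc.isExtremal hB hl (by omega) (by omega) hL).formB hD)
  · left
    -- Here $p(G)+\theta(G)=p(T)=2$, so $\theta=1$ would put $G$ in $\mathcal U$.
    have h6 : cyclomatic G ≠ 1 := fun h6 => hU ⟨hG, h6, by omega⟩
    have h7 : cyclomatic G = 2 := by omega
    exact formA_of_mult_eq_three hG hB h7
      (isInfty_or_isTheta hG h7 (by omega) h2) (by omega)

end

end GraphMult

theorem theorem4p4 {V : Type*} [Fintype V] (G : SimpleGraph V)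
    (hconn : G.Connected) (hθ : 1 ≤ GraphMult.cyclomatic G) (hU : ¬ GraphMult.InU G)
    (B : Matrix V V ℂ) (hB : GraphMult.InS G B)
    (x : ℝ) (hx : GraphMult.IsEigenvalue B x) :
    (GraphMult.mult B x : ℤ)
        = 2 * GraphMult.cyclomatic G + (GraphMult.pendentCount G : ℤ) - 1 ↔
      GraphMult.FormA G B x ∨ GraphMult.FormB G B x := by
  have hT : ¬ G.IsTree := fun hT => by
    have := (GraphMult.isTree_iff_cyclomatic.1 hT).2
    omega
  have := GraphMult.nontrivial_of_not_isTree hconn hT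
  have h2 := GraphMult.exists_deg_ne_two hconn hU
  refine ⟨GraphMult.formA_or_formB hconn hU hB.2 hθ, ?_⟩
  rintro (h | h)
  · exact h.mult_eq hconn hB.2 h2
  · exact le_antisymm (GraphMult.mult_le_of_exists_deg_ne_two hconn h2 hB.2 x)
      (h.le_mult hconn hB.2)
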